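/- Let $K$ be a two-dimensional local field identified with one of the following fields: $\mathbb F_q((u))((t))$; $L((t))$; $L\{\{u\}\}$. Here $L$ is a nonarchimedean local field of characteristic zero with ring of integers $\mathcal O_L$, maximal ideal $m_L$ and residue field $\mathbb F_q$, and $L\{\{u\}\}$ is the completion of $\mathrm{Frac}(\mathcal O_L[[u]])$ by the discrete valuation given by the height $1$ prime ideal $m_L\mathcal O_L[[u]]$. Let $B\subset K$ be, respectively, the subring $\mathbb F_q[[u]]((t))$, $\mathcal O_L((t))$, $L\cdot\mathcal O_L[[u]]$. Let $\nu_K$ be the discrete valuation of $K$, $\mathcal O_K$ its valuation ring, $\bar K$ its residue field ($\mathbb F_q((u))$, $L$, $\mathbb F_q((u))$, respectively) with discrete valuation $\nu_{\bar K}$, and for $f,g\in K^*$ put $$\nu_K(f,g)=\nu_{\bar K}\Bigl(\overline{f^{\nu_K(g)}/g^{\nu_K(f)}}\Bigr)\in\mathbb Z .$$ Let $\widetilde{SL_2(K)}$ be the pullback to $SL_2(K)\subset SL(K)=\varinjlim_n SL_n(K)$ of the universal central extension $1\to K_2(K)\to St(K)\to SL(K)\to 1$, where $St(K)$ is the Steinberg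 group, and let $$1\to K_2(K)\to\widehat{GL_2(K)}=\widetilde{SL_2(K)}\rtimes K^*\to GL_2(K)\to 1$$ be the central extension in which $a\in K^*$, mapped to $\mathrm{diag}(a,1)$, acts on $\widetilde{SL_2(K)}$ by the lift of the conjugation by $\mathrm{diag}(a,1)$. Let $1\to\mathbb C^*\to\hat G\to GL_2(K)\to1$ be a central extension. Then there is an $a\in\mathbb C/\bigl(\tfrac{2\pi i}{\ln q}\bigr)\mathbb Z$ such that $\hat G$ is obtained from $\widehat{GL_2(K)}$ by means of the homomorphism $K_2(K)\to\mathbb C^*$, $(f,g)\mapsto q^{-a\,\nu_K(f,g)}$, of the kernels (where $(f,g)\in K_2(K)$ is the universal symbol of $f,g\in K^*$), if and only if $\hat G$ splits over each of the subgroups $GL_2(\mathcal O_K)$, $GL_2(B)$ and $K^*$ of $GL_2(K)$, where $K^*$ is embedded in the upper-left corner by $a\mapsto\mathrm{diag}(a,1)$. -/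

import Mathlib

noncomputable section

namespace TwoDim

open Matrix
open scoped commutatorElement

/-! ### The Steinberg group, `K₂`, and the central extension of `GL₂` -/

section Steinberg

variable (K : Type*) [Field K]

/-- Index set of the generators `x_{ij}(r)`, `i ≠ j`, of the stable Steinberg group. -/
structure StGen where
  i : ℕ
  j : ℕ
  ne : i ≠ j
  r : K

variable {K} in
/-- The free generator `x_{ij}(r)`. -/
def genX (i j : ℕ) (h : i ≠ j) (r : K) : FreeGroup (StGen K) := FreeGroup.of ⟨i, j, h, r⟩

/-- The Steinberg relations. -/
inductive StRel : FreeGroup (StGen K) → Prop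
  | add (i j : ℕ) (h : i ≠ j) (r s : K) :
      StRel (genX i j h r * genX i j h s * (genX i j h (r + s))⁻¹)
  | comm_one (i j k l : ℕ) (hij : i ≠ j) (hkl : k ≠ l) (hjk : j ≠ k) (hil : i ≠ l) (r s : K) :
      StRel ⁅genX i j hij r, genX k l hkl s⁆
  | comm (i j k : ℕ) (hij : i ≠ j) (hjk : j ≠ k) (hik : i ≠ k) (r s : K) :
      StRel (⁅genX i j hij r, genX j k hjk s⁆ * (genX i k hik (r * s))⁻¹)

/-- The (stable) Steinberg group `St(K)`. -/
abbrev St : Type _ := PresentedGroup {w : FreeGroup (StGen K) | StRel K w}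

variable {K}

/-- The generator `x_{ij}(r)` of `St(K)`. -/
def St.x (i j : ℕ) (h : i ≠ j) (r : K) : St K := PresentedGroup.of ⟨i, j, h, r⟩

/-- The element `w_{ij}(u) = x_{ij}(u) x_{ji}(-u⁻¹) x_{ij}(u)`. -/
def St.w (i j : ℕ) (h : i ≠ j) (u : Kˣ) : St K :=
  St.x i j h (u : K) * St.x j i h.symm (-((u⁻¹ : Kˣ) : K)) * St.x i j h (u : K)

/-- The element `h_{ij}(u) = w_{ij}(u) w_{ij}(-1)`. -/
def St.h (i j : ℕ) (h : i ≠ j) (u : Kˣ) : St K := St.w i j h u * St.w i j h (-1)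

theorem St.x_add (i j : ℕ) (h : i ≠ j) (r s : K) :
    St.x i j h (r + s) = St.x i j h r * St.x i j h s := by
  have := PresentedGroup.one_of_mem (rels := {w : FreeGroup (StGen K) | StRel K w})
    (StRel.add i j h r s)
  exact (mul_inv_eq_one.1 this).symm

theorem St.x_comm_one (i j k l : ℕ) (hij : i ≠ j) (hkl : k ≠ l) (hjk : j ≠ k) (hil : i ≠ l)
    (r s : K) : ⁅St.x i j hij r, St.x k l hkl s⁆ = 1 :=
  PresentedGroup.one_of_mem (rels := {w : FreeGroup (StGen K) | StRel K w})
    (StRel.comm_one i j k l hij hkl hjk hil r s)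

theorem St.x_comm (i j k : ℕ) (hij : i ≠ j) (hjk : j ≠ k) (hik : i ≠ k) (r s : K) :
    ⁅St.x i j hij r, St.x j k hjk s⁆ = St.x i k hik (r * s) :=
  mul_inv_eq_one.1 (PresentedGroup.one_of_mem (rels := {w : FreeGroup (StGen K) | StRel K w})
    (StRel.comm i j k hij hjk hik r s))

/-- Homomorphisms out of `St(K)`. -/
def St.lift {G : Type*} [Group G] (f : ∀ i j : ℕ, i ≠ j → K → G)
    (hadd : ∀ i j (h : i ≠ j) r s, f i j h (r + s) = f i j h r * f i j h s)
    (hone : ∀ i j k l (hij : i ≠ j) (hkl : k ≠ l), j ≠ k → i ≠ l → ∀ r s,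
      ⁅f i j hij r, f k l hkl s⁆ = 1)
    (hcomm : ∀ i j k (hij : i ≠ j) (hjk : j ≠ k) (hik : i ≠ k) r s,
      ⁅f i j hij r, f j k hjk s⁆ = f i k hik (r * s)) : St K →* G :=
  PresentedGroup.toGroup (f := fun g : StGen K => f g.i g.j g.ne g.r) (by
    rintro w (⟨i, j, h, r, s⟩ | ⟨i, j, k, l, hij, hkl, hjk, hil, r, s⟩ |
      ⟨i, j, k, hij, hjk, hik, r, s⟩)
    · simp [genX, hadd]
    · simpa [genX, map_commutatorElement] using hone i j k l hij hkl hjk hil r s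
    · simp [genX, map_commutatorElement, hcomm i j k hij hjk hik r s])

@[simp] theorem St.lift_x {G : Type*} [Group G] (f : ∀ i j : ℕ, i ≠ j → K → G) (h₁ h₂ h₃)
    (i j : ℕ) (h : i ≠ j) (r : K) : St.lift f h₁ h₂ h₃ (St.x i j h r) = f i j h r :=
  PresentedGroup.toGroup.of _

theorem St.hom_ext {G : Type*} [Group G] {f g : St K →* G}
    (h : ∀ i j (hij : i ≠ j) r, f (St.x i j hij r) = g (St.x i j hij r)) : f = g :=
  PresentedGroup.ext fun x => h x.i x.j x.ne x.r

variable (K) in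
/-- Infinite matrices over `K` with finite columns, i.e. endomorphisms of `K^{(ℕ)}`. The groups
`SL(K) = ⋃ SLₙ(K)` and `GL(K) = ⋃ GLₙ(K)` are regarded as subgroups of its unit group. -/
abbrev MatInf : Type _ := Module.End K (ℕ →₀ K)

/-- The matrix with the single entry `r` at the place `(i, j)`. -/
def entry (i j : ℕ) (r : K) : MatInf K := (Finsupp.lsingle i).comp (r • Finsupp.lapply j)

theorem entry_mul (i j l : ℕ) (r s : K) : entry i j r * entry j l s = entry i l (r * s) := by
  ext k m; simp [entry, Finsupp.single_apply]

theorem entry_mul_of_ne (i j k l : ℕ) (h : j ≠ k) (r s : K) : entry i j r * entry k l s = 0 := by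
  ext k m; simp [entry, Finsupp.single_apply, h.symm]

theorem entry_add (i j : ℕ) (r s : K) : entry i j (r + s) = entry i j r + entry i j s := by
  ext k m; simp [entry, add_mul]

@[simp] theorem entry_zero (i j : ℕ) : entry i j (0 : K) = 0 := by
  ext k m; simp [entry]

theorem entry_neg (i j : ℕ) (r : K) : entry i j (-r) = -entry i j r := by
  ext k m; simp [entry]

theorem mi_mul_neg (A B : MatInf K) : A * -B = -(A * B) := by ext; simp
theorem mi_neg_mul (A B : MatInf K) : -A * B = -(A * B) := by ext; simp
theorem mi_mul_sub (A B C : MatInf K) : A * (B - C) = A * B - A * C := by ext; simp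
theorem mi_sub_mul (A B C : MatInf K) : (A - B) * C = A * C - B * C := by ext; simp

/-- The elementary matrix `e_{ij}(r)`. -/
def elemMat (i j : ℕ) (h : i ≠ j) (r : K) : (MatInf K)ˣ where
  val := 1 + entry i j r
  inv := 1 + entry i j (-r)
  val_inv := by
    simp only [mul_add, add_mul, entry_mul_of_ne i j i j h.symm, entry_neg, mi_mul_neg, mi_neg_mul,
      one_mul, mul_one]; abel
  inv_val := by
    simp only [mul_add, add_mul, entry_mul_of_ne i j i j h.symm, entry_neg, mi_mul_neg, mi_neg_mul,
      one_mul, mul_one]; abel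

/-- The canonical homomorphism `St(K) → SL(K)`, `x_{ij}(r) ↦ e_{ij}(r)`. -/
def St.toSL : St K →* (MatInf K)ˣ :=
  St.lift elemMat
    (by
      intro i j h r s
      ext1
      simp only [elemMat, Units.val_mul, mul_add, add_mul, one_mul, mul_one, entry_mul_of_ne i j i j h.symm, entry_add]
      abel)
    (by
      intro i j k l hij hkl hjk hil r s
      rw [commutatorElement_eq_one_iff_mul_comm]
      ext1
      simp only [elemMat, Units.val_mul, mul_add, add_mul, one_mul, mul_one, entry_mul_of_ne i j k l hjk,
        entry_mul_of_ne k l i j hil.symm]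
      abel)
    (by
      intro i j k hij hjk hik r s
      rw [commutatorElement_def, mul_inv_eq_iff_eq_mul, mul_inv_eq_iff_eq_mul]
      ext1
      simp only [elemMat, Units.val_mul, mul_add, add_mul, entry_mul,
        entry_mul_of_ne i k j k hjk.symm, entry_mul_of_ne j k i j hik.symm,
        entry_mul_of_ne i k i j hik.symm, zero_mul, mul_one, one_mul]
      abel)

@[simp] theorem St.toSL_x (i j : ℕ) (h : i ≠ j) (r : K) :
    St.toSL (St.x i j h r) = elemMat i j h r := St.lift_x ..

variable (K) in
/-- `K₂(K)`, the kernel of `St(K) → SL(K)`. -/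
def K2 : Subgroup (St K) := (St.toSL (K := K)).ker

theorem St.toSL_w (i j : ℕ) (h : i ≠ j) (u : Kˣ) :
    ((St.toSL (St.w i j h u) : (MatInf K)ˣ) : MatInf K)
      = 1 - entry i i 1 - entry j j 1 + entry i j (u : K) - entry j i ((u⁻¹ : Kˣ) : K) := by
  simp only [St.w, map_mul, St.toSL_x, elemMat, Units.val_mul, mul_add, add_mul, one_mul, mul_one,
    entry_mul, entry_mul_of_ne _ _ _ _ h, entry_mul_of_ne _ _ _ _ h.symm, entry_neg, mi_mul_neg,
    mi_neg_mul, Units.mul_inv, Units.inv_mul]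
  abel

theorem St.toSL_h (i j : ℕ) (h : i ≠ j) (u : Kˣ) :
    ((St.toSL (St.h i j h u) : (MatInf K)ˣ) : MatInf K)
      = 1 + (entry i i (u : K) - entry i i 1) + (entry j j ((u⁻¹ : Kˣ) : K) - entry j j 1) := by
  rw [St.h, map_mul, Units.val_mul, St.toSL_w, St.toSL_w]
  simp only [mul_add, add_mul, mi_mul_sub, mi_sub_mul, one_mul, mul_one, entry_mul,
    entry_mul_of_ne _ _ _ _ h, entry_mul_of_ne _ _ _ _ h.symm, Units.val_neg, Units.val_one,
    inv_neg, inv_one, entry_neg, mi_mul_neg, mi_neg_mul]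
  abel

/-- The universal symbol `(f, g) = [h₁₂(f), h₁₃(g)]` in `K₂(K)` (indices start from `0` here). -/
def symbol (f g : Kˣ) : K2 K :=
  ⟨⁅St.h 0 1 (by decide) f, St.h 0 2 (by decide) g⁆, by
    rw [K2, MonoidHom.mem_ker, map_commutatorElement, commutatorElement_eq_one_iff_mul_comm]
    ext1
    rw [Units.val_mul, Units.val_mul, St.toSL_h, St.toSL_h]
    simp only [mul_add, add_mul, mi_mul_sub, mi_sub_mul, one_mul, mul_one, entry_mul,
      entry_mul_of_ne _ _ _ _ (show (0 : ℕ) ≠ 1 by decide),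
      entry_mul_of_ne _ _ _ _ (show (1 : ℕ) ≠ 0 by decide),
      entry_mul_of_ne _ _ _ _ (show (0 : ℕ) ≠ 2 by decide),
      entry_mul_of_ne _ _ _ _ (show (2 : ℕ) ≠ 0 by decide),
      entry_mul_of_ne _ _ _ _ (show (1 : ℕ) ≠ 2 by decide),
      entry_mul_of_ne _ _ _ _ (show (2 : ℕ) ≠ 1 by decide), mul_comm (g : K) (f : K)]
    abel⟩

/-- A `2 × 2` matrix placed in the upper left corner of the zero infinite matrix. -/
def corner (A : Matrix (Fin 2) (Fin 2) K) : MatInf K := 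
  ∑ i : Fin 2, ∑ j : Fin 2, entry (i : ℕ) (j : ℕ) (A i j)

theorem corner_add (A B : Matrix (Fin 2) (Fin 2) K) : corner (A + B) = corner A + corner B := by
  simp [corner, entry_add]; abel

theorem corner_mul (A B : Matrix (Fin 2) (Fin 2) K) : corner (A * B) = corner A * corner B := by
  have h01 : (0 : ℕ) ≠ 1 := by decide
  simp only [corner, Fin.sum_univ_two, Matrix.mul_apply, entry_add, mul_add, add_mul,
    Fin.val_zero, Fin.val_one, entry_mul, entry_mul_of_ne _ _ _ _ h01,
    entry_mul_of_ne _ _ _ _ h01.symm]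
  abel

variable (K) in
/-- The block embedding `A ↦ diag(A, 1, 1, …)` of `2 × 2` matrices in infinite matrices. -/
def stabMat : Matrix (Fin 2) (Fin 2) K →* MatInf K where
  toFun A := 1 + corner (A - 1)
  map_one' := by simp [corner]
  map_mul' A B := by
    have : A * B - 1 = (A - 1) + (B - 1) + (A - 1) * (B - 1) := by noncomm_ring
    rw [this, corner_add, corner_add, corner_mul]; noncomm_ring

variable (K) in
/-- The block embedding `GL₂(K) → GL(K)`. -/
def stabGL : GL (Fin 2) K →* (MatInf K)ˣ := Units.map (stabMat K)

variable (K) in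
/-- The embedding `a ↦ diag(a, 1)` of `K^*` in the upper left corner of `GL₂(K)`. -/
def upperLeft : Kˣ →* GL (Fin 2) K where
  toFun a := ⟨diagonal ![(a : K), 1], diagonal ![((a⁻¹ : Kˣ) : K), 1],
    by rw [diagonal_mul_diagonal]; ext i j; fin_cases i <;> fin_cases j <;> simp,
    by rw [diagonal_mul_diagonal]; ext i j; fin_cases i <;> fin_cases j <;> simp⟩
  map_one' := by ext i j; fin_cases i <;> fin_cases j <;> simp
  map_mul' a b := by ext i j; fin_cases i <;> fin_cases j <;> simp

/-- The diagonal entries of `diag(a, 1, 1, …)`. -/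
def torusEntry (a : Kˣ) (i : ℕ) : Kˣ := if i = 0 then a else 1

@[simp] theorem torusEntry_one (i : ℕ) : torusEntry (1 : Kˣ) i = 1 := by simp [torusEntry]

theorem torusEntry_mul (a b : Kˣ) (i : ℕ) :
    torusEntry (a * b) i = torusEntry a i * torusEntry b i := by
  unfold torusEntry; split_ifs <;> simp

/-- Conjugation by `diag(a, 1, 1, …)`, lifted to `St(K)`:
`x_{ij}(r) ↦ x_{ij}(dᵢ r dⱼ⁻¹)`, where `d = (a, 1, 1, …)`. -/
def torusHom (a : Kˣ) : St K →* St K :=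
  St.lift (fun i j h r => St.x i j h (torusEntry a i * r * ((torusEntry a j)⁻¹ : Kˣ)))
    (by intro i j h r s; rw [← St.x_add]; congr 1; ring)
    (by intro i j k l hij hkl hjk hil r s; exact St.x_comm_one _ _ _ _ _ _ hjk hil _ _)
    (by
      intro i j k hij hjk hik r s
      rw [St.x_comm i j k hij hjk hik]
      congr 1
      have : ((torusEntry a j : Kˣ) : K) ≠ 0 := Units.ne_zero _
      simp only [Units.val_inv_eq_inv_val]
      field_simp)

@[simp] theorem torusHom_x (a : Kˣ) (i j : ℕ) (h : i ≠ j) (r : K) :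
    torusHom a (St.x i j h r) = St.x i j h (torusEntry a i * r * ((torusEntry a j)⁻¹ : Kˣ)) :=
  St.lift_x ..

theorem torusHom_one : torusHom (1 : Kˣ) = MonoidHom.id (St K) :=
  St.hom_ext fun i j h r => by simp

theorem torusHom_mul (a b : Kˣ) : torusHom (a * b) = (torusHom a).comp (torusHom b) :=
  St.hom_ext fun i j h r => by
    simp only [torusHom_x, MonoidHom.comp_apply, torusEntry_mul, Units.val_mul, mul_inv]
    congr 1; ring

theorem toSL_torusHom (a : Kˣ) (s : St K) :
    St.toSL (torusHom a s)
      = stabGL K (upperLeft K a) * St.toSL s * (stabGL K (upperLeft K a))⁻¹ := by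
  have key : St.toSL.comp (torusHom a)
      = (MulAut.conj (stabGL K (upperLeft K a))).toMonoidHom.comp St.toSL := by
    refine St.hom_ext fun i j h r => ?_
    simp only [MonoidHom.comp_apply, torusHom_x, St.toSL_x, MulEquiv.coe_toMonoidHom,
      MulAut.conj_apply]
    rw [eq_mul_inv_iff_mul_eq]
    ext1
    have hD : ((stabGL K (upperLeft K a) : (MatInf K)ˣ) : MatInf K)
        = 1 + entry 0 0 ((a : K) - 1) := by
      simp [stabGL, stabMat, upperLeft, corner, Fin.sum_univ_two]
    rw [Units.val_mul, Units.val_mul, hD]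
    simp only [elemMat, mul_add, add_mul, one_mul, mul_one]
    rcases Nat.eq_zero_or_pos i with hi | hi
    · subst hi
      rw [entry_mul_of_ne _ _ _ _ h.symm, entry_mul]
      simp only [torusEntry, if_true, if_neg h.symm, Units.val_one, inv_one, mul_one,
        show ((a : K) - 1) * r = a * r + -r by ring, entry_add, entry_neg]
      abel
    · rw [entry_mul_of_ne 0 0 i j hi.ne]
      rcases Nat.eq_zero_or_pos j with hj | hj
      · subst hj
        rw [entry_mul]
        have : ((torusEntry a i : Kˣ) : K) * r * ((torusEntry a 0)⁻¹ : Kˣ) * ((a : K) - 1)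
            = r - r * (a : K)⁻¹ := by
          have := a.ne_zero
          simp [torusEntry, hi.ne']; field_simp
        rw [this]
        simp only [torusEntry, if_true, if_neg hi.ne', Units.val_one, one_mul, sub_eq_add_neg,
          Units.val_inv_eq_inv_val,
          entry_add, entry_neg]
        abel
      · rw [entry_mul_of_ne _ _ _ _ hj.ne']
        simp [torusEntry, hi.ne', hj.ne']
        abel
  simpa using DFunLike.congr_fun key s

variable (K) in
/-- The pullback of `St(K) → SL(K)` under `SL₂(K) → SL(K)`, with `SL₂(K)` regarded as the group of
elements of determinant `1` in `GL₂(K)`. -/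
def SL2tilde : Subgroup (St K × GL (Fin 2) K) where
  carrier := {p | p.2.det = 1 ∧ St.toSL p.1 = stabGL K p.2}
  one_mem' := by simp
  mul_mem' := by
    rintro p q ⟨hp, hp'⟩ ⟨hq, hq'⟩
    exact ⟨by simp [hp, hq], by simp [hp', hq']⟩
  inv_mem' := by
    rintro p ⟨hp, hp'⟩
    exact ⟨by simp [hp], by simp [hp']⟩

/-- The lifted conjugation by `diag(a, 1)` on the pullback. -/
def tildeHom (a : Kˣ) : SL2tilde K →* SL2tilde K where
  toFun p := ⟨(torusHom a p.1.1, upperLeft K a * p.1.2 * (upperLeft K a)⁻¹), by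
    obtain ⟨h, h'⟩ := p.2
    exact ⟨by simp [h], by simp [toSL_torusHom, h']⟩⟩
  map_one' := by ext1; simp
  map_mul' p q := by ext1; simp

theorem tildeHom_one : tildeHom (1 : Kˣ) = MonoidHom.id (SL2tilde K) := by
  ext1 p; apply Subtype.ext; simp [tildeHom, torusHom_one]

theorem tildeHom_mul (a b : Kˣ) : tildeHom (a * b) = (tildeHom a).comp (tildeHom b) := by
  ext1 p; apply Subtype.ext; simp [tildeHom, torusHom_mul, mul_assoc]

variable (K) in
/-- The action of `K^*` on the pullback. -/
def tildeAct : Kˣ →* MulAut (SL2tilde K) where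
  toFun a := MonoidHom.toMulEquiv (tildeHom a) (tildeHom a⁻¹)
    (by rw [← tildeHom_mul, inv_mul_cancel, tildeHom_one])
    (by rw [← tildeHom_mul, mul_inv_cancel, tildeHom_one])
  map_one' := by ext1 p; exact DFunLike.congr_fun tildeHom_one p
  map_mul' a b := by ext1 p; exact DFunLike.congr_fun (tildeHom_mul a b) p

variable (K) in
/-- The group `\widehat{GL₂(K)}`: the semidirect product of the pullback and `K^*`. -/
abbrev GL2hat : Type _ := SemidirectProduct (SL2tilde K) Kˣ (tildeAct K)

variable (K) in
/-- The projection `\widehat{GL₂(K)} → GL₂(K)`. -/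
def GL2hat.proj : GL2hat K →* GL (Fin 2) K :=
  SemidirectProduct.lift ((MonoidHom.snd _ _).comp (SL2tilde K).subtype) (upperLeft K) (by
    intro a; ext1 p; rfl)

theorem GL2hat.proj_apply (p : GL2hat K) :
    GL2hat.proj K p = p.left.1.2 * upperLeft K p.right := rfl

variable (K) in
/-- The inclusion `K₂(K) → \widehat{GL₂(K)}`. -/
def GL2hat.incl : K2 K →* GL2hat K :=
  SemidirectProduct.inl.comp
    { toFun := fun k => ⟨(k.1, 1), by simp, by simpa [K2] using k.2⟩
      map_one' := rfl
      map_mul' := fun _ _ => by apply Subtype.ext; simp }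

theorem det_upperLeft (a : Kˣ) : (upperLeft K a).det = a := by
  ext; simp [upperLeft]

theorem stabGL_unipotent (c : K) (i j : Fin 2) (h : i ≠ j) (g : GL (Fin 2) K)
    (hg : (g : Matrix (Fin 2) (Fin 2) K) = Matrix.transvection i j c) :
    stabGL K g = St.toSL (St.x i j (Fin.val_ne_of_ne h) c) := by
  ext1
  fin_cases i <;> fin_cases j <;>
    simp_all [stabGL, stabMat, elemMat, corner, Fin.sum_univ_two, Matrix.transvection]

theorem exists_lift_SL2 (g : GL (Fin 2) K) (hg : g.det = 1) :
    ∃ s : St K, St.toSL s = stabGL K g := by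
  have hT : ∀ (i j : Fin 2) (_ : i ≠ j) (c : K), ∃ u : GL (Fin 2) K,
      (u : Matrix (Fin 2) (Fin 2) K) = Matrix.transvection i j c ∧
      stabGL K u ∈ (St.toSL (K := K)).range := by
    intro i j h c
    have hu : IsUnit (Matrix.transvection i j c) := by
      rw [Matrix.isUnit_iff_isUnit_det, Matrix.det_transvection_of_ne _ _ h]; exact isUnit_one
    exact ⟨hu.unit, rfl, _, (stabGL_unipotent c i j h hu.unit rfl).symm⟩
  have h01 : (0 : Fin 2) ≠ 1 := by decide
  have main : ∀ g : GL (Fin 2) K, g.det = 1 → g 1 0 ≠ 0 →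
      stabGL K g ∈ (St.toSL (K := K)).range := by
    intro g hg hc
    obtain ⟨u, hu, hu'⟩ := hT 0 1 h01 ((g 0 0 - 1) / g 1 0)
    obtain ⟨v, hv, hv'⟩ := hT 1 0 h01.symm (g 1 0)
    obtain ⟨w, hw, hw'⟩ := hT 0 1 h01 ((g 1 1 - 1) / g 1 0)
    have hd : g 0 0 * g 1 1 - g 0 1 * g 1 0 = 1 := by
      have := congrArg (fun x : Kˣ => (x : K)) hg
      simpa [Matrix.det_fin_two] using this
    have : g = u * v * w := by
      ext i j
      simp only [Units.val_mul, hu, hv, hw]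
      fin_cases i <;> fin_cases j <;>
        simp [Matrix.transvection, Matrix.mul_apply, Fin.sum_univ_two, Matrix.single]
          <;> field_simp <;> first | ring1 | linear_combination -hd
    rw [this, map_mul, map_mul]
    exact mul_mem (mul_mem hu' hv') hw'
  by_cases hc : g 1 0 = 0
  · obtain ⟨u, hu, hu'⟩ := hT 1 0 h01.symm 1
    have hd : g 0 0 * g 1 1 - g 0 1 * g 1 0 = 1 := by
      have := congrArg (fun x : Kˣ => (x : K)) hg
      simpa [Matrix.det_fin_two] using this
    have h2 : (u * g).det = 1 := by
      ext
      simp [hg, hu, Matrix.det_transvection_of_ne _ _ h01.symm]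
    have h3 : (u * g) 1 0 ≠ 0 := by
      simp only [Units.val_mul, hu]
      intro h0
      simp [Matrix.transvection, Matrix.mul_apply, Fin.sum_univ_two, Matrix.single, hc] at h0
      simp [h0, hc] at hd
    have := main _ h2 h3
    rw [map_mul] at this
    exact (Subgroup.mul_mem_cancel_left _ hu').1 this
  · exact main g hg hc

variable (K) in
/-- The extension `1 → K₂(K) → \widehat{GL₂(K)} → GL₂(K) → 1`. -/
def GL2hat.extension : GroupExtension (K2 K) (GL2hat K) (GL (Fin 2) K) where
  inl := GL2hat.incl K
  rightHom := GL2hat.proj K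
  inl_injective := by
    intro k l h
    have h1 := SemidirectProduct.inl_injective h
    have h2 := congrArg (fun p : SL2tilde K => p.1.1) h1
    exact Subtype.ext h2
  range_inl_eq_ker_rightHom := by
    ext p
    rw [MonoidHom.mem_ker, GL2hat.proj_apply]
    constructor
    · rintro ⟨k, rfl⟩
      simp [GL2hat.incl]
    · intro h
      have hdet := congrArg (fun g : GL (Fin 2) K => g.det) h
      simp only [map_mul, map_one, p.left.2.1, det_upperLeft, one_mul] at hdet
      rw [hdet, map_one, mul_one] at h
      have hk : p.left.1.1 ∈ K2 K := by
        rw [K2, MonoidHom.mem_ker, p.left.2.2, h, map_one]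
      refine ⟨⟨_, hk⟩, ?_⟩
      apply SemidirectProduct.ext
      · apply Subtype.ext
        exact Prod.ext rfl h.symm
      · exact hdet.symm
  rightHom_surjective := by
    intro g
    have hd : (g * (upperLeft K g.det)⁻¹).det = 1 := by
      rw [map_mul, map_inv, det_upperLeft, mul_inv_cancel]
    obtain ⟨s, hs⟩ := exists_lift_SL2 _ hd
    refine ⟨⟨⟨(s, g * (upperLeft K g.det)⁻¹), hd, hs⟩, g.det⟩, ?_⟩
    rw [GL2hat.proj_apply]
    simp

end Steinberg

section Approx

open IsDedekindDomain HeightOneSpectrum IsLocalRing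

variable {R F : Type*} [CommRing R] [IsDedekindDomain R] [Field F] [Algebra R F]
  [IsFractionRing R F] (v : HeightOneSpectrum R)

theorem adic_approx (x : v.adicCompletionIntegers F) :
    ∃ a : R, algebraMap R (v.adicCompletionIntegers F) a - x ∈
      maximalIdeal (v.adicCompletionIntegers F) := by
  have hnhds : {z : v.adicCompletion F | Valued.v (z - x.1) < 1} ∈ nhds x.1 :=
    Valued.mem_nhds.2 ⟨1, fun z hz => (Valuation.restrict_lt_one_iff _).1 hz⟩
  obtain ⟨r, hr⟩ := (denseRange_algebraMap (K := F) v).exists_mem_open isOpen_interior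
    ⟨x.1, mem_interior_iff_mem_nhds.2 hnhds⟩
  have hr : Valued.v (algebraMap F (v.adicCompletion F) r - x.1) < 1 := by
    have := interior_subset hr
    exact this
  have hval : ∀ s : F, Valued.v (algebraMap F (v.adicCompletion F) s) = v.valuation F s :=
    fun s => valuedAdicCompletion_eq_valuation' v s
  have hr1 : v.valuation F r ≤ 1 := by
    rw [← hval]
    have := Valued.v.map_add (algebraMap F (v.adicCompletion F) r - x.1) x.1
    rw [sub_add_cancel] at this
    exact this.trans (max_le hr.le x.2)
  obtain ⟨a, ha⟩ := v.exists_valuation_sub_lt_of_integer hr1 1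
  refine ⟨a, ?_⟩
  have hlt : Valued.v ((algebraMap R (v.adicCompletionIntegers F) a - x :
      v.adicCompletionIntegers F) : v.adicCompletion F) < 1 := by
    have e : ((algebraMap R (v.adicCompletionIntegers F) a - x :
        v.adicCompletionIntegers F) : v.adicCompletion F)
        = algebraMap F (v.adicCompletion F) (algebraMap R F a - r)
          + (algebraMap F (v.adicCompletion F) r - x.1) := by
      rw [map_sub, sub_add_sub_cancel]; rfl
    rw [e]
    refine (Valued.v.map_add _ _).trans_lt (max_lt ?_ hr)
    rw [hval]; exact ha
  rw [mem_maximalIdeal, mem_nonunits_iff]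
  intro hu
  obtain ⟨b, hb⟩ := hu.exists_right_inv
  have h1 := congrArg (fun z : v.adicCompletionIntegers F => Valued.v (z : v.adicCompletion F)) hb
  simp only [MulMemClass.coe_mul, map_mul, OneMemClass.coe_one, map_one] at h1
  exact absurd h1 (ne_of_lt (mul_lt_one_of_lt_of_le hlt b.2))

theorem adic_residue_surjective : Function.Surjective
    ((residue (v.adicCompletionIntegers F)).comp
      (algebraMap R (v.adicCompletionIntegers F))) := by
  intro y
  obtain ⟨x, rfl⟩ := residue_surjective y
  obtain ⟨a, ha⟩ := adic_approx v x
  refine ⟨a, ?_⟩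
  rw [RingHom.comp_apply, ← sub_eq_zero, ← map_sub, residue_eq_zero_iff]
  exact ha

theorem adic_ker_le {κ : Type*} [Field κ] (g : R →+* κ) (hg : v.asIdeal ≤ RingHom.ker g) :
    RingHom.ker ((residue (v.adicCompletionIntegers F)).comp
      (algebraMap R (v.adicCompletionIntegers F))) ≤ RingHom.ker g := by
  intro a ha
  by_contra h
  obtain ⟨b, i, hi, hbi⟩ := v.isMaximal.exists_inv (x := a) (fun hm => h (hg hm))
  have h1 : residue (v.adicCompletionIntegers F)
      (algebraMap R (v.adicCompletionIntegers F) i) = 1 := by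
    have := congrArg ((residue (v.adicCompletionIntegers F)).comp
      (algebraMap R (v.adicCompletionIntegers F))) hbi
    rw [map_add, map_mul, (RingHom.mem_ker).1 ha, mul_zero, zero_add, map_one] at this
    exact this
  have h2 : residue (v.adicCompletionIntegers F)
      (algebraMap R (v.adicCompletionIntegers F) i) = 0 := by
    rw [residue_eq_zero_iff, mem_maximalIdeal, mem_nonunits_iff]
    intro hu
    obtain ⟨c, hc⟩ := hu.exists_right_inv
    have h1 := congrArg
      (fun z : v.adicCompletionIntegers F => Valued.v (z : v.adicCompletion F)) hc
    simp only [MulMemClass.coe_mul, map_mul, OneMemClass.coe_one, map_one] at h1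
    have hlt : Valued.v ((algebraMap R (v.adicCompletionIntegers F) i :
        v.adicCompletionIntegers F) : v.adicCompletion F) < 1 := by
      have := valuedAdicCompletion_eq_valuation' v (algebraMap R F i)
      exact this.trans_lt ((v.valuation_lt_one_iff_mem i).2 hi)
    exact absurd h1 (ne_of_lt (mul_lt_one_of_lt_of_le hlt c.2))
  exact zero_ne_one (h2.symm.trans h1)

variable (F) in
/-- The extension to the completed ring of integers of a homomorphism `g : R → κ` to a field with
kernel `v`. -/
def adicResidue {κ : Type*} [Field κ] (g : R →+* κ) (hg : v.asIdeal ≤ RingHom.ker g) :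
    v.adicCompletionIntegers F →+* κ :=
  (RingHom.liftOfSurjective _ (adic_residue_surjective v) ⟨g, adic_ker_le v g hg⟩).comp
    (residue (v.adicCompletionIntegers F))

theorem adicResidue_algebraMap {κ : Type*} [Field κ] (g : R →+* κ)
    (hg : v.asIdeal ≤ RingHom.ker g) (a : R) :
    adicResidue F v g hg (algebraMap R (v.adicCompletionIntegers F) a) = g a :=
  RingHom.liftOfRightInverse_comp_apply (f := (residue (v.adicCompletionIntegers F)).comp
    (algebraMap R (v.adicCompletionIntegers F))) _
    (Function.rightInverse_surjInv (adic_residue_surjective v)) ⟨g, adic_ker_le v g hg⟩ a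

end Approx

section Curly

open PowerSeries IsLocalRing

variable (A : Type*) [CommRing A] [IsDomain A] [IsDiscreteValuationRing A]

/-- The ideal `m A[[u]]` of `A[[u]]`, where `m` is the maximal ideal of `A`. -/
def curlyPrime : Ideal A⟦X⟧ := (maximalIdeal A).map (PowerSeries.C (R := A))

theorem curlyPrime_eq_ker : curlyPrime A = RingHom.ker (PowerSeries.map (residue A)) := by
  obtain ⟨ϖ, hϖ⟩ := IsDiscreteValuationRing.exists_irreducible A
  have hm := hϖ.maximalIdeal_eq
  rw [curlyPrime, hm, Ideal.map_span, Set.image_singleton]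
  ext f
  rw [Ideal.mem_span_singleton, RingHom.mem_ker]
  have hmem : ∀ a : A, residue A a = 0 ↔ ϖ ∣ a := by
    intro a; rw [residue_eq_zero_iff, hm, Ideal.mem_span_singleton]
  constructor
  · rintro ⟨g, rfl⟩
    rw [map_mul, PowerSeries.map_C, (hmem ϖ).2 dvd_rfl, map_zero, zero_mul]
  · intro h
    have : ∀ n, ∃ b, coeff n f = ϖ * b := fun n => (hmem _).1 (by
      simpa using congrArg (coeff n) h)
    choose b hb using this
    exact ⟨PowerSeries.mk b, by ext n; simp [hb]⟩

instance curlyPrime_isPrime : (curlyPrime A).IsPrime := by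
  rw [curlyPrime_eq_ker]; exact RingHom.ker_isPrime _

/-- The localization of `A[[u]]` at the prime ideal `m A[[u]]`, as a subring of the fraction field
of `A[[u]]`. -/
abbrev CurlyLoc : Subalgebra A⟦X⟧ (FractionRing A⟦X⟧) :=
  Localization.subalgebra.ofField (FractionRing A⟦X⟧) (curlyPrime A).primeCompl
    (curlyPrime A).primeCompl_le_nonZeroDivisors

instance curlyLoc_isLocalization : IsLocalization.AtPrime (CurlyLoc A) (curlyPrime A) :=
  Localization.subalgebra.isLocalization_ofField _ _ _

instance curlyLoc_isLocalRing : IsLocalRing (CurlyLoc A) :=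
  IsLocalization.AtPrime.isLocalRing (CurlyLoc A) (curlyPrime A)

theorem curlyLoc_maximalIdeal :
    maximalIdeal (CurlyLoc A) = (curlyPrime A).map (algebraMap A⟦X⟧ (CurlyLoc A)) :=
  (IsLocalization.AtPrime.map_eq_maximalIdeal (curlyPrime A) (CurlyLoc A)).symm

instance curlyLoc_isDiscreteValuationRing : IsDiscreteValuationRing (CurlyLoc A) := by
  have : IsNoetherianRing (CurlyLoc A) :=
    IsLocalization.isNoetherianRing (curlyPrime A).primeCompl _ inferInstance
  obtain ⟨ϖ, hϖ⟩ := IsDiscreteValuationRing.exists_irreducible A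
  have hspan : maximalIdeal (CurlyLoc A)
      = Ideal.span {algebraMap A⟦X⟧ (CurlyLoc A) (PowerSeries.C ϖ)} := by
    rw [curlyLoc_maximalIdeal, curlyPrime, hϖ.maximalIdeal_eq, Ideal.map_span,
      Set.image_singleton, Ideal.map_span, Set.image_singleton]
  have hinj : Function.Injective (algebraMap A⟦X⟧ (CurlyLoc A)) :=
    IsLocalization.injective _ (curlyPrime A).primeCompl_le_nonZeroDivisors
  have hne : ¬ IsField (CurlyLoc A) := by
    rw [isField_iff_maximalIdeal_eq, hspan, Ideal.span_singleton_eq_bot]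
    rw [map_eq_zero_iff _ hinj, map_eq_zero_iff _ PowerSeries.C_injective]
    exact hϖ.ne_zero
  exact ((IsDiscreteValuationRing.TFAE (CurlyLoc A) hne).out 0 4 (by rfl) (by rfl)).2 (by rw [hspan]; exact ⟨⟨_, rfl⟩⟩)

/-- The discrete valuation of `Frac(A[[u]])` given by the prime ideal `m A[[u]]`. -/
abbrev curlyPlace : IsDedekindDomain.HeightOneSpectrum (CurlyLoc A) :=
  IsDiscreteValuationRing.maximalIdeal (CurlyLoc A)

/-- Reduction of coefficients, from `A[[u]]` localized at `m A[[u]]` to `k((u))`, where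
`k = A / m`. -/
def curlyLocResidue : CurlyLoc A →+* LaurentSeries (ResidueField A) :=
  IsLocalization.lift (M := (curlyPrime A).primeCompl)
    (g := (HahnSeries.ofPowerSeries ℤ (ResidueField A)).comp (PowerSeries.map (residue A))) (by
      rintro ⟨s, hs⟩
      rw [isUnit_iff_ne_zero, RingHom.comp_apply]
      intro h
      rw [map_eq_zero_iff _ HahnSeries.ofPowerSeries_injective] at h
      exact hs (by rw [curlyPrime_eq_ker]; exact h))

theorem curlyPlace_le_ker :
    (curlyPlace A).asIdeal ≤ RingHom.ker (curlyLocResidue A) := by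
  change maximalIdeal (CurlyLoc A) ≤ _
  rw [curlyLoc_maximalIdeal, Ideal.map_le_iff_le_comap]
  intro f hf
  rw [curlyPrime_eq_ker] at hf
  rw [Ideal.mem_comap, RingHom.mem_ker, curlyLocResidue, IsLocalization.lift_eq,
    RingHom.comp_apply, hf, map_zero]

/-- The field `L{{u}}`, where `L` is the fraction field of `A`: the completion of `Frac(A[[u]])`
by the discrete valuation given by the prime ideal `m A[[u]]`. -/
def CurlyField : Type _ := (curlyPlace A).adicCompletion (FractionRing A⟦X⟧)

instance : Field (CurlyField A) :=
  inferInstanceAs (Field ((curlyPlace A).adicCompletion (FractionRing A⟦X⟧)))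

/-- The ring of integers of `L{{u}}`. -/
def curlyIntegers : ValuationSubring (CurlyField A) :=
  (curlyPlace A).adicCompletionIntegers (FractionRing A⟦X⟧)

/-- The normalized discrete valuation `L{{u}}^* → ℤ` (with the value `0` at `0`). -/
def curlyVal (x : CurlyField A) : ℤ :=
  -WithZero.log
    (Valued.v (R := (curlyPlace A).adicCompletion (FractionRing A⟦X⟧)) x)

/-- The reduction homomorphism from the ring of integers of `L{{u}}` to its residue field
`k((u))`: the continuous extension of the reduction of the coefficients of power series. -/
def curlyResidue : curlyIntegers A →+* LaurentSeries (ResidueField A) :=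
  adicResidue (FractionRing A⟦X⟧) (curlyPlace A) (curlyLocResidue A) (curlyPlace_le_ker A)

open Classical in
/-- The valuation of the reduction of an element of the ring of integers of `L{{u}}` (with the
value `0` outside the ring of integers). -/
def curlyResidueVal (x : CurlyField A) : ℤ :=
  if h : x ∈ curlyIntegers A then (curlyResidue A ⟨x, h⟩).order else 0

/-- The embedding of `A[[u]]` in `L{{u}}`. -/
def curlyOfPowerSeries : A⟦X⟧ →+* CurlyField A :=
  (algebraMap (FractionRing A⟦X⟧)
    ((curlyPlace A).adicCompletion (FractionRing A⟦X⟧))).comp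
      (algebraMap A⟦X⟧ (FractionRing A⟦X⟧))

/-- The subring `L · A[[u]]` of `L{{u}}`: the elements `f / c` with `f ∈ A[[u]]`, `0 ≠ c ∈ A`. -/
def curlyB : Subring (CurlyField A) where
  carrier := {x | ∃ c : A, c ≠ 0 ∧ ∃ f : A⟦X⟧,
    x * curlyOfPowerSeries A (PowerSeries.C c) = curlyOfPowerSeries A f}
  one_mem' := ⟨1, one_ne_zero, 1, by simp⟩
  zero_mem' := ⟨1, one_ne_zero, 0, by simp⟩
  mul_mem' := by
    rintro x y ⟨c, hc, f, hf⟩ ⟨d, hd, g, hg⟩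
    refine ⟨c * d, mul_ne_zero hc hd, f * g, ?_⟩
    rw [map_mul, map_mul, map_mul, ← hf, ← hg]; ring
  add_mem' := by
    rintro x y ⟨c, hc, f, hf⟩ ⟨d, hd, g, hg⟩
    refine ⟨c * d, mul_ne_zero hc hd, f * PowerSeries.C d + g * PowerSeries.C c, ?_⟩
    rw [map_mul, map_mul, map_add, map_mul, map_mul, ← hf, ← hg]; ring
  neg_mem' := by
    rintro x ⟨c, hc, f, hf⟩
    exact ⟨c, hc, -f, by rw [map_neg, ← hf, neg_mul]⟩

end Curly

section Models

open ValuativeRel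
open scoped Valued

/-- `R((t)) ⊆ κ((t))` for a subring `R` of a ring `κ`: the Laurent series with coefficients
in `R`. -/
def coeffSubring {κ : Type*} [CommRing κ] (R : Subring κ) : Subring (LaurentSeries κ) where
  carrier := {f | ∀ n, f.coeff n ∈ R}
  one_mem' n := by
    rw [HahnSeries.coeff_one]; split_ifs
    · exact R.one_mem
    · exact R.zero_mem
  zero_mem' n := R.zero_mem
  mul_mem' {f g} hf hg n := by
    rw [HahnSeries.coeff_mul]
    exact R.sum_mem fun _ _ => R.mul_mem (hf _) (hg _)
  add_mem' {f g} hf hg n := R.add_mem (hf n) (hg n)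
  neg_mem' {f} hf n := R.neg_mem (hf n)

/-- The normalized discrete valuation `L^* → ℤ` of a nonarchimedean local field `L`
(with the value `0` at `0`). -/
def localVal (L : Type*) [Field L] [ValuativeRel L] [TopologicalSpace L]
    [IsNonarchimedeanLocalField L] (x : L) : ℤ :=
  -WithZero.log (IsNonarchimedeanLocalField.valueGroupWithZeroIsoInt L (valuation L x))

/-- An isomorphism of `K` with one of the fields `F_q((u))((t))`, `L((t))`, `L{{u}}`, where `F_q`
is a finite field and `L` is a nonarchimedean local field of characteristic zero. -/
inductive Model.{u, v} (K : Type u) [Field K] : Type (max u (v + 1))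
  | equalChar (F : Type v) [Field F] [Finite F] (e : K ≃+* LaurentSeries (LaurentSeries F))
  | laurent (L : Type v) [Field L] [CharZero L] [ValuativeRel L] [TopologicalSpace L]
      [IsNonarchimedeanLocalField L] (e : K ≃+* LaurentSeries L)
  | curly (L : Type v) [Field L] [CharZero L] [ValuativeRel L] [TopologicalSpace L]
      [IsNonarchimedeanLocalField L] (e : K ≃+* CurlyField 𝒪[L])

namespace Model

variable {K : Type*} [Field K]

/-- The number `q` of elements of the last residue field. -/
def q : Model K → ℕ
  | equalChar F _ => Nat.card F
  | laurent L _ => Nat.card 𝓀[L]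
  | curly L _ => Nat.card 𝓀[L]

/-- The ring of integers `O_K`: `F_q((u))[[t]]`, `L[[t]]`, or the ring of integers of `L{{u}}`. -/
def integers : Model K → Subring K
  | equalChar F e => (HahnSeries.ofPowerSeries ℤ (LaurentSeries F)).range.comap e.toRingHom
  | laurent L e => (HahnSeries.ofPowerSeries ℤ L).range.comap e.toRingHom
  | curly L e => (curlyIntegers 𝒪[L]).toSubring.comap e.toRingHom

/-- The subring `B`: `F_q[[u]]((t))`, `O_L((t))`, or `L · O_L[[u]]`. -/
def B : Model K → Subring K
  | equalChar F e => (coeffSubring (HahnSeries.ofPowerSeries ℤ F).range).comap e.toRingHom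
  | laurent L e => (coeffSubring 𝒪[L]).comap e.toRingHom
  | curly L e => (curlyB 𝒪[L]).comap e.toRingHom

/-- The discrete valuation `ν_K : K^* → ℤ`. -/
def val : Model K → K → ℤ
  | equalChar _ e, x => (e x).order
  | laurent _ e, x => (e x).order
  | curly L e, x => curlyVal 𝒪[L] (e x)

/-- `ν_{\bar K}(\bar x)` for a unit `x` of `O_K`: the discrete valuation of the residue field
(`F_q((u))`, `L`, or `k((u))` with `k` the residue field of `L`) at the reduction of `x`. -/
def residueVal : Model K → K → ℤ
  | equalChar _ e, x => ((e x).coeff 0).order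
  | laurent L e, x => localVal L ((e x).coeff 0)
  | curly L e, x => curlyResidueVal 𝒪[L] (e x)

/-- The pairing `ν_K(f, g) = ν_{\bar K}(\overline{f^{ν_K(g)} / g^{ν_K(f)}})`. The argument of
`residueVal` is always a unit of `O_K`. -/
def nu (M : Model K) (f g : Kˣ) : ℤ :=
  M.residueVal ((f : K) ^ M.val g / (g : K) ^ M.val f)

end Model

end Models

section Extensions

variable {K : Type*} [Field K]

/-- The subgroup `GL₂(R)` of `GL₂(K)` for a subring `R` of `K`. -/
def GL2sub (R : Subring K) : Subgroup (GL (Fin 2) K) :=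
  (Matrix.GeneralLinearGroup.map R.subtype).range

/-- A group extension is central if the image of the kernel is contained in the center. -/
def IsCentral {A E G : Type*} [Group A] [Group E] [Group G] (S : GroupExtension A E G) : Prop :=
  S.inl.range ≤ Subgroup.center E

/-- The extension `S` splits over the subgroup `H`. -/
def SplitsOver {A E G : Type*} [Group A] [Group E] [Group G] (S : GroupExtension A E G)
    (H : Subgroup G) : Prop :=
  ∃ s : H →* E, ∀ h : H, S.rightHom (s h) = h

/-- The extension `S` of `G` by `A` is obtained from the extension `S₀` of `G` by `A₀` by means of
the homomorphism `φ : A₀ → A` of the kernels: there is a morphism of extensions from `S₀` to `S`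
which is `φ` on the kernels and the identity on `G`. -/
def ObtainedBy {A₀ E₀ A E G : Type*} [Group A₀] [Group E₀] [Group A] [Group E] [Group G]
    (S₀ : GroupExtension A₀ E₀ G) (φ : A₀ →* A) (S : GroupExtension A E G) : Prop :=
  ∃ F : E₀ →* E, (∀ k, F (S₀.inl k) = S.inl (φ k)) ∧ ∀ x, S.rightHom (F x) = S₀.rightHom x

end Extensions

end TwoDim

end

noncomputable section

namespace TwoDim

open scoped commutatorElement

/-! ### Central extensions and lifts of root subgroups -/

section CentralLifts

variable {D G : Type*} [Group D] [Group G] {p : D →* G}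

/-! A central extension of GL₂(K) that splits over K^* is governed by one invariant: the commutators
of lifts of diag(a, 1) and diag(1, b), which form a pairing on K^* with values in the kernel. If
this pairing is trivial, the extension splits (`exists_section_of_diag_commute`): the unipotent
subgroups have canonical lifts, and these together with the lifted torus satisfy enough of the
relations of GL₂(K) for the Bruhat normal forms to make up a subgroup that maps isomorphically to
GL₂(K). Applied to the quotient of the fibre product of two extensions by the graph of φ, this shows
that S is obtained from S₀ by means of φ as soon as φ carries the pairing of S₀ to that of S
(`obtainedBy_of_diag_commutator`). For the extension by K₂(K) the pairing at (a, b) is the symbol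
(b, a) (`GL2hat.diag_commutator`); its centrality rests on Steinberg's theorem that K₂(K) is central
in St(K) (`K2_le_center`).

The second ingredient is an explicit extension by ℝ. Put L = O^{(ℕ)} and W = B^{(ℕ)}. The groups gW
and ghW have commensurable traces on quotients of lattices, and the difference of their logarithmic
relative indices on L and on gL defines a 2-cocycle c(g, h) (`indexCocycle`). It vanishes if gL = L
or if hW = W, so it is trivial on matrices over O and on matrices over B. Its commutator pairing on
a one-dimensional torus is -ν log q (`torusPairing_eq`). On GL₂(K) the pullback along the
determinant is subtracted, so that the extension also splits over K^*; its diagonal commutators are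
then ν log q.

If Ĝ comes from the extension by K₂(K) with q^{-aν}, it has the same diagonal commutators as the
pushout of the index extension under x ↦ exp(ax). It is therefore obtained from the index extension,
and inherits the three splittings.

Conversely, suppose that Ĝ splits over the three subgroups. Its diagonal pairing is
bimultiplicative, skew-symmetric by conjugation with the Weyl element, and trivial on O^* and on B^*
by the splittings. It is trivial on (t, 1 + tO) because two factorizations in GL₂(O) are
interchanged by diag(t, 1) (`commutator_t_one_add`). As K^* is generated by t, u, the common units
of O and B, and 1 + tO, the pairing is z^{-ν} for some z = q^{-a}. The homomorphism of K₂(K) with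
the values q^{-aν} on symbols is constructed by lifting St(K) to the index extension
(`exists_K2_hom`), and the comparison result applies again.

The three kinds of field enter only through `LocalDatum`, a list of the properties of O, B, the
local parameters and ν that the argument uses. -/

theorem mem_ker_of_map_eq {x x' : D} (h : p x = p x') : x * x'⁻¹ ∈ p.ker := by
  rw [MonoidHom.mem_ker, map_mul, map_inv, h, mul_inv_cancel]

theorem ker_comm (hc : p.ker ≤ Subgroup.center D) {z : D} (hz : p z = 1) (x : D) :
    x * z = z * x :=
  Subgroup.mem_center_iff.1 (hc (MonoidHom.mem_ker.2 hz)) x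

theorem exists_central_mul (hc : p.ker ≤ Subgroup.center D) {x x' : D} (h : p x = p x') :
    ∃ z ∈ Subgroup.center D, x = z * x' :=
  ⟨x * x'⁻¹, hc (mem_ker_of_map_eq h), by group⟩

theorem commutator_central_mul {z z' : D} (hz : z ∈ Subgroup.center D)
    (hz' : z' ∈ Subgroup.center D) (x y : D) : ⁅z * x, z' * y⁆ = ⁅x, y⁆ := by
  rw [Subgroup.mem_center_iff] at hz hz'
  have h1 : ∀ y, ⁅z * x, y⁆ = ⁅x, y⁆ := fun y => by
    have : ⁅z * x, y⁆ = z * (x * y * x⁻¹) * z⁻¹ * y⁻¹ := by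
      simp only [commutatorElement_def]; group
    rw [this, ← hz, mul_inv_cancel_right, commutatorElement_def]
  have h2 : ∀ x, ⁅x, z' * y⁆ = ⁅x, y⁆ := fun x => by
    have : ⁅x, z' * y⁆ = x * z' * (y * x⁻¹ * y⁻¹) * z'⁻¹ := by
      simp only [commutatorElement_def]; group
    rw [this, mul_assoc x, ← hz', ← mul_assoc, mul_inv_cancel_right, commutatorElement_def]
    group
  rw [h1, h2]

/-- The commutator of lifts to a central extension depends only on the lifted elements. -/
theorem commutator_congr (hc : p.ker ≤ Subgroup.center D) {x x' y y' : D} (hx : p x = p x')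
    (hy : p y = p y') : ⁅x, y⁆ = ⁅x', y'⁆ := by
  obtain ⟨z, hz, rfl⟩ := exists_central_mul hc hx
  obtain ⟨z', hz', rfl⟩ := exists_central_mul hc hy
  exact commutator_central_mul hz hz' _ _

theorem commutator_central_of_commute {x y : D} (h : Commute (p x) (p y)) :
    p ⁅x, y⁆ = 1 := by
  rw [map_commutatorElement, commutatorElement_eq_one_iff_mul_comm]; exact h

theorem commutator_mul_left_of_central {x x' y : D} (h : ⁅x', y⁆ ∈ Subgroup.center D) :
    ⁅x * x', y⁆ = ⁅x, y⁆ * ⁅x', y⁆ := by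
  have h1 := Subgroup.mem_center_iff.1 h x
  have : ⁅x * x', y⁆ = x * ⁅x', y⁆ * x⁻¹ * ⁅x, y⁆ := by
    simp only [commutatorElement_def]; group
  rw [this, h1, mul_inv_cancel_right]
  exact (Subgroup.mem_center_iff.1 h _).symm

theorem commutator_mul_right_of_central {x y y' : D} (h : ⁅x, y'⁆ ∈ Subgroup.center D) :
    ⁅x, y * y'⁆ = ⁅x, y⁆ * ⁅x, y'⁆ := by
  have : ⁅x, y * y'⁆ = ⁅x, y⁆ * (y * ⁅x, y'⁆ * y⁻¹) := by
    simp only [commutatorElement_def]; group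
  rw [this, Subgroup.mem_center_iff.1 h, mul_inv_cancel_right]

theorem conj_eq_of_central {z : D} (hz : z ∈ Subgroup.center D) (x : D) : x * z * x⁻¹ = z := by
  rw [Subgroup.mem_center_iff.1 hz x, mul_inv_cancel_right]

theorem conj_commutator (g x y : D) : g * ⁅x, y⁆ * g⁻¹ = ⁅g * x * g⁻¹, g * y * g⁻¹⁆ := by
  simp only [commutatorElement_def]; group

/-- An element lying over a central element commutes with all commutators. -/
theorem commute_commutator_of_central_image (hc : p.ker ≤ Subgroup.center D) {z : D}
    (hz : p z ∈ Subgroup.center G) (x y : D) : z * ⁅x, y⁆ * z⁻¹ = ⁅x, y⁆ := by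
  rw [conj_commutator]
  refine commutator_congr hc ?_ ?_ <;>
  · rw [map_mul, map_mul, map_inv, ← Subgroup.mem_center_iff.1 hz, mul_inv_cancel_right]

variable {K : Type*} [Field K]

theorem exists_unit_ne_one [Infinite K] : ∃ a : Kˣ, (a : K) ≠ 1 := by
  classical
  obtain ⟨x, hx⟩ := Set.Infinite.exists_notMem_finset (Set.infinite_univ (α := K)) {0, 1}
  simp only [Finset.mem_insert, Finset.mem_singleton, not_or] at hx
  exact ⟨Units.mk0 x hx.2.1, hx.2.2⟩

open Polynomial in
theorem exists_unit_quadratic [Infinite K] :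
    ∃ a : K, a ≠ 0 ∧ 1 - a ≠ 0 ∧ a * (1 - a) ≠ 1 := by
  by_contra! h
  have h0 : (X * (1 - X) * (1 - X * (1 - X)) : K[X]) = 0 := by
    refine Polynomial.funext fun a => ?_
    simp only [eval_mul, eval_X, eval_sub, eval_one, eval_zero]
    by_cases h1 : a = 0
    · simp [h1]
    by_cases h2 : 1 - a = 0
    · simp [h2]
    · simp [h a h1 h2]
  have h1 : (X : K[X]) ≠ 0 := X_ne_zero
  have h2 : (1 - X : K[X]) ≠ 0 := fun h => by simpa using congrArg (eval 0) h
  have h3 : (1 - X * (1 - X) : K[X]) ≠ 0 := fun h => by simpa using congrArg (eval 0) h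
  exact mul_ne_zero (mul_ne_zero h1 h2) h3 h0

/-- A bimultiplicative central pairing on `K` which is invariant under simultaneous scaling is
trivial. -/
theorem pairing_eq_one_of_scale [Infinite K] {b : K → K → D}
    (hl : ∀ r r' s, b (r + r') s = b r s * b r' s) (hr : ∀ r s s', b r (s + s') = b r s * b r s')
    (hs : ∀ (a : K) r s, a ≠ 0 → b (a * r) (a * s) = b r s) (r s : K) : b r s = 1 := by
  obtain ⟨a, h0, h1, h2⟩ := exists_unit_quadratic (K := K)
  -- Scale invariance gives b(a⁻¹r, s) = b(r, as). With 1/(a(1 - a)) = 1/a + 1/(1 - a),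
  -- multiplication of r by c = 1/(a(1 - a)) therefore leaves b(r, s) unchanged. Since c ≠ 1, every
  -- element of K has the form (c - 1)r, which kills the pairing.
  have key : ∀ r, b ((a * (1 - a))⁻¹ * r) s = b r s := fun r => by
    have e : (a * (1 - a))⁻¹ * r = a⁻¹ * r + (1 - a)⁻¹ * r := by field_simp; ring
    have e1 : b (a⁻¹ * r) s = b r (a * s) := by
      rw [← hs a _ _ h0, mul_inv_cancel_left₀ h0]
    have e2 : b ((1 - a)⁻¹ * r) s = b r ((1 - a) * s) := by
      rw [← hs (1 - a) _ _ h1, mul_inv_cancel_left₀ h1]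
    rw [e, hl, e1, e2, ← hr]
    congr 1; ring
  have h3 : (a * (1 - a))⁻¹ - 1 ≠ 0 := by
    rw [sub_ne_zero]; intro h; rw [inv_eq_one] at h; exact h2 h
  have e := key (((a * (1 - a))⁻¹ - 1)⁻¹ * r)
  have e' : (a * (1 - a))⁻¹ * (((a * (1 - a))⁻¹ - 1)⁻¹ * r)
      = r + ((a * (1 - a))⁻¹ - 1)⁻¹ * r := by
    set c := (a * (1 - a))⁻¹
    field_simp; ring
  rw [e', hl] at e
  exact mul_eq_right.1 e

/-- In a central extension, a root subgroup that is scaled by a torus has a canonical lift. -/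
theorem exists_root_lift [Infinite K] (hc : p.ker ≤ Subgroup.center D) (e : K → G)
    (he : ∀ r s, e (r + s) = e r * e s) (hsurj : ∀ r, ∃ x, p x = e r) (d : Kˣ →* G)
    (hd : ∀ a, ∃ y, p y = d a) (hde : ∀ (a : Kˣ) r, d a * e r * (d a)⁻¹ = e (a * r)) :
    ∃ X : K → D, (∀ r, p (X r) = e r) ∧ (∀ r s, X (r + s) = X r * X s) ∧
      ∀ (a : Kˣ) r x y, p y = d a → p x = e r → ⁅y, x⁆ = X ((a - 1) * r) := by
  choose x hx using hsurj
  choose y hy using hd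
  have e_comm : ∀ r s, Commute (e r) (e s) := fun r s => by
    rw [commute_iff_eq, ← he, ← he, add_comm]
  have e_zero : e 0 = 1 := by simpa using he 0 0
  have e_sub : ∀ (a : Kˣ) r, ⁅d a, e r⁆ = e ((a - 1) * r) := fun a r => by
    rw [commutatorElement_def, hde, mul_inv_eq_iff_eq_mul, ← he]; congr 1; ring
  have hcen : ∀ r s, ⁅x r, x s⁆ ∈ Subgroup.center D := fun r s =>
    hc (commutator_central_of_commute (by rw [hx, hx]; exact e_comm r s))
  -- The commutator of two lifts is a central bimultiplicative pairing. Conjugation by a lift of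
  -- d(a) fixes it and scales both arguments by a.
  have hb : ∀ r s, ⁅x r, x s⁆ = 1 := by
    refine pairing_eq_one_of_scale (b := fun r s => ⁅x r, x s⁆) ?_ ?_ ?_
    · intro r r' s
      rw [← commutator_mul_left_of_central (hcen _ _)]
      exact commutator_congr hc (by rw [hx, map_mul, hx, hx, he]) rfl
    · intro r s s'
      rw [← commutator_mul_right_of_central (hcen _ _)]
      exact commutator_congr hc rfl (by rw [hx, map_mul, hx, hx, he])
    · intro a r s ha
      rw [← conj_eq_of_central (hcen r s) (y (Units.mk0 a ha)), conj_commutator]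
      refine commutator_congr hc ?_ ?_ <;>
      · simp only [map_mul, map_inv, hx, hy, hde, Units.val_mk0]
  have comm : ∀ {r s u v}, p u = e r → p v = e s → Commute u v := fun {r s u v} hu hv => by
    have : ⁅u, v⁆ = 1 := by
      rw [← hb r s]; exact commutator_congr hc (by rw [hu, hx]) (by rw [hv, hx])
    exact commutatorElement_eq_one_iff_mul_comm.1 this
  obtain ⟨a₀, ha₀⟩ := exists_unit_ne_one (K := K)
  have ha₀' : (a₀ : K) - 1 ≠ 0 := sub_ne_zero.2 ha₀
  have pcomm : ∀ {a : Kˣ} {r u v}, p u = d a → p v = e r → p ⁅u, v⁆ = e ((a - 1) * r) :=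
    fun hu hv => by rw [map_commutatorElement, hu, hv, e_sub]
  have cmul : ∀ {a : Kˣ} {r s u v v'}, p u = d a → p v = e r → p v' = e s →
      ⁅u, v * v'⁆ = ⁅u, v⁆ * ⁅u, v'⁆ := fun {a r s u v v'} hu hv hv' => by
    have h1 : ⁅u, v * v'⁆ = ⁅u, v⁆ * (v * ⁅u, v'⁆ * v⁻¹) := by
      simp only [commutatorElement_def]; group
    rw [h1, (comm hv (pcomm hu hv')).eq, mul_inv_cancel_right]
  -- The canonical lift of e(r) is the commutator of lifts of d(a₀) and e((a₀ - 1)⁻¹ r), for one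
  -- fixed a₀ ≠ 1; it does not depend on the lifts chosen.
  have hX : ∀ r, p ⁅y a₀, x (((a₀ : K) - 1)⁻¹ * r)⁆ = e r := fun r => by
    rw [pcomm (hy _) (hx _), mul_inv_cancel_left₀ ha₀']
  refine ⟨fun r => ⁅y a₀, x (((a₀ : K) - 1)⁻¹ * r)⁆, hX, ?_, ?_⟩
  · intro r s
    rw [← cmul (hy _) (hx _) (hx _)]
    exact commutator_congr hc rfl (by rw [hx, map_mul, hx, hx, ← he, mul_add])
  · intro a r u v hv hu
    set x' := x (((a₀ : K) - 1)⁻¹ * r) with hx'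
    have p1 : p x' = e (((a₀ : K) - 1)⁻¹ * r) := hx _
    have e1 : ⁅v, u⁆ = ⁅v, ⁅y a₀, x'⁆⁆ := commutator_congr hc rfl (by rw [hu, hX])
    have e2 : ⁅y a₀, x (((a₀ : K) - 1)⁻¹ * (((a : K) - 1) * r))⁆ = ⁅y a₀, ⁅v, x'⁆⁆ := by
      refine commutator_congr hc rfl ?_
      rw [pcomm hv p1, hx]; congr 1; ring
    -- What remains is [v, [B, x']] = [B, [v, x']]. Here v and B commute up to a central element,
    -- which disappears in conjugation, and the conjugates of x' lie over the commuting elements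
    -- e(r). Both sides expand into the same four factors, in a different order.
    rw [e1]
    refine Eq.trans ?_ e2.symm
    have pc : ∀ {a : Kˣ} {r u v}, p u = d a → p v = e r → p (u * v * u⁻¹) = e (a * r) :=
      fun hu hv => by rw [map_mul, map_mul, map_inv, hu, hv, hde]
    have pinv : ∀ {r v}, p v = e r → p v⁻¹ = e (-r) := fun {r v} hv => by
      rw [map_inv, hv, inv_eq_iff_mul_eq_one, ← he, add_neg_cancel, e_zero]
    set B := y a₀
    have hB : p B = d a₀ := hy _
    obtain ⟨z, hz, hz'⟩ := exists_central_mul hc (x := v * B) (x' := B * v) (by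
      rw [map_mul, map_mul, hv, hB, ← map_mul, ← map_mul, mul_comm])
    have h1 : v * B * x' * (v * B)⁻¹ = B * v * x' * (B * v)⁻¹ := by
      rw [hz', mul_assoc z, mul_assoc z, mul_inv_rev, ← Subgroup.mem_center_iff.1 hz]
      group
    have l : ⁅v, ⁅B, x'⁆⁆ = (v * B * x' * (v * B)⁻¹) * (v * x'⁻¹ * v⁻¹) * x' * (B * x'⁻¹ * B⁻¹) := by
      simp only [commutatorElement_def]; group
    have r : ⁅B, ⁅v, x'⁆⁆ = (B * v * x' * (B * v)⁻¹) * (B * x'⁻¹ * B⁻¹) * x' * (v * x'⁻¹ * v⁻¹) := by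
      simp only [commutatorElement_def]; group
    have c1 : Commute (v * x'⁻¹ * v⁻¹) x' := comm (pc hv (pinv p1)) p1
    have c2 : Commute (v * x'⁻¹ * v⁻¹) (B * x'⁻¹ * B⁻¹) := comm (pc hv (pinv p1)) (pc hB (pinv p1))
    have c3 : Commute (B * x'⁻¹ * B⁻¹) x' := comm (pc hB (pinv p1)) p1
    have swap : ∀ q α β γ : D, Commute α β → Commute α γ → Commute γ β →
        q * α * β * γ = q * γ * β * α := fun q α β γ h1 h2 h3 => by
      rw [mul_assoc q, h1.eq, mul_assoc, mul_assoc, h2.eq, ← mul_assoc β, ← h3.eq]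
      simp only [mul_assoc]
    rw [l, r, h1]
    exact swap _ _ _ _ c1 c2 c3

end CentralLifts

end TwoDim
end

noncomputable section

namespace TwoDim

open scoped commutatorElement

/-! ### Central extensions of `GL₂(K)` -/

section GLTwo

variable {K : Type*} [Field K]

/-- The upper unipotent matrix with entry `r`. -/
def upperUni (r : K) : GL (Fin 2) K where
  val := !![1, r; 0, 1]
  inv := !![1, -r; 0, 1]
  val_inv := by ext i j; fin_cases i <;> fin_cases j <;> simp
  inv_val := by ext i j; fin_cases i <;> fin_cases j <;> simp

/-- The lower unipotent matrix with entry `r`. -/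
def lowerUni (r : K) : GL (Fin 2) K where
  val := !![1, 0; r, 1]
  inv := !![1, 0; -r, 1]
  val_inv := by ext i j; fin_cases i <;> fin_cases j <;> simp
  inv_val := by ext i j; fin_cases i <;> fin_cases j <;> simp

variable (K) in
/-- The embedding `a ↦ diag(1, a)`. -/
def lowerRight : Kˣ →* GL (Fin 2) K where
  toFun a := ⟨Matrix.diagonal ![1, (a : K)], Matrix.diagonal ![1, ((a⁻¹ : Kˣ) : K)],
    by rw [Matrix.diagonal_mul_diagonal]; ext i j; fin_cases i <;> fin_cases j <;> simp,
    by rw [Matrix.diagonal_mul_diagonal]; ext i j; fin_cases i <;> fin_cases j <;> simp⟩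
  map_one' := by ext i j; fin_cases i <;> fin_cases j <;> simp
  map_mul' a b := by ext i j; fin_cases i <;> fin_cases j <;> simp

variable (K) in
/-- The standard Weyl element of `SL₂`. -/
def weyl : GL (Fin 2) K where
  val := !![0, 1; -1, 0]
  inv := !![0, -1; 1, 0]
  val_inv := by ext i j; fin_cases i <;> fin_cases j <;> simp
  inv_val := by ext i j; fin_cases i <;> fin_cases j <;> simp

theorem coe_upperUni (r : K) : (upperUni r : Matrix (Fin 2) (Fin 2) K) = !![1, r; 0, 1] := rfl
theorem coe_lowerUni (r : K) : (lowerUni r : Matrix (Fin 2) (Fin 2) K) = !![1, 0; r, 1] := rfl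
theorem coe_weyl : (weyl K : Matrix (Fin 2) (Fin 2) K) = !![0, 1; -1, 0] := rfl

theorem coe_upperLeft (a : Kˣ) :
    (upperLeft K a : Matrix (Fin 2) (Fin 2) K) = !![(a : K), 0; 0, 1] := by
  ext i j; fin_cases i <;> fin_cases j <;> simp [upperLeft]

theorem coe_lowerRight (a : Kˣ) :
    (lowerRight K a : Matrix (Fin 2) (Fin 2) K) = !![1, 0; 0, (a : K)] := by
  ext i j; fin_cases i <;> fin_cases j <;> simp [lowerRight]

theorem upperUni_add (r s : K) : upperUni (r + s) = upperUni r * upperUni s := by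
  ext i j; fin_cases i <;> fin_cases j <;> simp [coe_upperUni, add_comm]

theorem lowerUni_add (r s : K) : lowerUni (r + s) = lowerUni r * lowerUni s := by
  ext i j; fin_cases i <;> fin_cases j <;> simp [coe_lowerUni]

theorem upperLeft_upperUni (a : Kˣ) (r : K) :
    upperLeft K a * upperUni r * (upperLeft K a)⁻¹ = upperUni (a * r) := by
  rw [mul_inv_eq_iff_eq_mul]
  ext i j; fin_cases i <;> fin_cases j <;> simp [coe_upperUni, coe_upperLeft]

theorem upperLeft_lowerUni (a : Kˣ) (r : K) :
    upperLeft K a⁻¹ * lowerUni r * (upperLeft K a⁻¹)⁻¹ = lowerUni (a * r) := by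
  obtain ⟨b, rfl⟩ : ∃ b, a = b⁻¹ := ⟨a⁻¹, (inv_inv a).symm⟩
  rw [mul_inv_eq_iff_eq_mul, inv_inv]
  ext i j; fin_cases i <;> fin_cases j <;>
    simp [coe_lowerUni, coe_upperLeft]
  rw [mul_right_comm, inv_mul_cancel₀ b.ne_zero, one_mul]

theorem weyl_eq : weyl K = upperUni 1 * lowerUni (-1) * upperUni 1 := by
  ext i j; fin_cases i <;> fin_cases j <;> simp [coe_upperUni, coe_lowerUni, coe_weyl]

theorem weyl_upperLeft (a : Kˣ) : weyl K * upperLeft K a * (weyl K)⁻¹ = lowerRight K a := by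
  rw [mul_inv_eq_iff_eq_mul]
  ext i j; fin_cases i <;> fin_cases j <;> simp [coe_weyl, coe_upperLeft, coe_lowerRight]

theorem weyl_lowerRight (a : Kˣ) : weyl K * lowerRight K a * (weyl K)⁻¹ = upperLeft K a := by
  rw [mul_inv_eq_iff_eq_mul]
  ext i j; fin_cases i <;> fin_cases j <;> simp [coe_weyl, coe_upperLeft, coe_lowerRight]

theorem weyl_upperUni (r : K) : weyl K * upperUni r * (weyl K)⁻¹ = lowerUni (-r) := by
  rw [mul_inv_eq_iff_eq_mul]
  ext i j; fin_cases i <;> fin_cases j <;> simp [coe_weyl, coe_upperUni, coe_lowerUni]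

theorem diag_comm (a b : Kˣ) : Commute (upperLeft K a) (lowerRight K b) := by
  ext i j; fin_cases i <;> fin_cases j <;> simp [coe_upperLeft, coe_lowerRight]

theorem scalar_mem_center (a : Kˣ) :
    upperLeft K a * lowerRight K a ∈ Subgroup.center (GL (Fin 2) K) := by
  rw [Subgroup.mem_center_iff]
  intro g
  ext i j; fin_cases i <;> fin_cases j <;>
    simp [coe_upperLeft, coe_lowerRight, Matrix.mul_apply, Fin.sum_univ_two, mul_comm]

variable {D : Type*} [Group D] {p : D →* GL (Fin 2) K}

/-- A central extension of `GL₂(K)` that splits over `K^*` and in which the lifts of diagonal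
matrices commute splits. -/
theorem exists_section_of_diag_commute [Infinite K] (hc : p.ker ≤ Subgroup.center D)
    (hp : Function.Surjective p) (t : Kˣ →* D) (ht : ∀ a, p (t a) = upperLeft K a)
    (hcomm : ∀ a b x y, p x = upperLeft K a → p y = lowerRight K b → x * y = y * x) :
    ∃ σ : GL (Fin 2) K →* D, ∀ g, p (σ g) = g := by
  obtain ⟨X, hX, Xadd, Xch⟩ := exists_root_lift hc upperUni upperUni_add (fun r => hp _)
    (upperLeft K) (fun a => hp _) upperLeft_upperUni
  -- The inverted torus is used so that a multiplies, and does not divide, the lower entry.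
  obtain ⟨Y, hY, Yadd, Ych⟩ := exists_root_lift hc lowerUni lowerUni_add (fun r => hp _)
    ((upperLeft K).comp (invMonoidHom)) (fun a => hp _) upperLeft_lowerUni
  simp only [MonoidHom.comp_apply, invMonoidHom_apply] at Ych
  have X0 : X 0 = 1 := by simpa using Xadd 0 0
  have tX : ∀ (a : Kˣ) r, t a * X r = X (a * r) * t a := fun a r => by
    have := Xch a r _ _ (ht a) (hX r)
    rw [commutatorElement_def, mul_inv_eq_iff_eq_mul, mul_inv_eq_iff_eq_mul, ← Xadd] at this
    rw [this]; congr 2; ring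
  have tY : ∀ (a : Kˣ) r, t a⁻¹ * Y r = Y (a * r) * t a⁻¹ := fun a r => by
    have := Ych a r _ _ (ht _) (hY r)
    rw [commutatorElement_def, mul_inv_eq_iff_eq_mul, mul_inv_eq_iff_eq_mul, ← Yadd] at this
    rw [this]; congr 2; ring
  obtain ⟨w, hw⟩ : ∃ w, w = X 1 * Y (-1) * X 1 := ⟨_, rfl⟩
  have pw : p w = weyl K := by rw [hw, map_mul, map_mul, hX, hY, weyl_eq]
  obtain ⟨t', ht'⟩ : ∃ t' : Kˣ →* D, t' = (MulAut.conj w).toMonoidHom.comp t := ⟨_, rfl⟩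
  have t'_def : ∀ a, t' a = w * t a * w⁻¹ := fun a => by rw [ht']; rfl
  have pt' : ∀ a, p (t' a) = lowerRight K a := fun a => by
    rw [t'_def, map_mul, map_mul, map_inv, pw, ht, weyl_upperLeft]
  have tt' : ∀ a b, t a * t' b = t' b * t a := fun a b => hcomm a b _ _ (ht a) (pt' b)
  obtain ⟨a₀, ha₀⟩ := exists_unit_ne_one (K := K)
  have ha₀' : (a₀ : K) - 1 ≠ 0 := sub_ne_zero.2 ha₀
  have X_comm : ∀ r, X r = ⁅t a₀, X (((a₀ : K) - 1)⁻¹ * r)⁆ := fun r => by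
    rw [Xch a₀ _ _ _ (ht _) (hX _), mul_inv_cancel_left₀ ha₀']
  have Y_comm : ∀ r, Y r = ⁅t a₀⁻¹, Y (((a₀ : K) - 1)⁻¹ * r)⁆ := fun r => by
    rw [Ych a₀ _ _ _ (ht _) (hY _), mul_inv_cancel_left₀ ha₀']
  -- The product t(a) t'(a) lies over a scalar matrix. Such an element commutes with every
  -- commutator, hence with X r and Y r, so that t' acts on the root subgroups as the inverse of t.
  have scal : ∀ a, p (t a * t' a) ∈ Subgroup.center (GL (Fin 2) K) := fun a => by
    rw [map_mul, ht, pt']; exact scalar_mem_center a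
  have scalX : ∀ a r, t a * t' a * X r = X r * (t a * t' a) := fun a r => by
    rw [X_comm r]
    exact mul_inv_eq_iff_eq_mul.1 (commute_commutator_of_central_image hc (scal a) _ _)
  have scalY : ∀ a r, t a * t' a * Y r = Y r * (t a * t' a) := fun a r => by
    rw [Y_comm r]
    exact mul_inv_eq_iff_eq_mul.1 (commute_commutator_of_central_image hc (scal a) _ _)
  have t'X : ∀ (a : Kˣ) r, t' a * X r = X ((a⁻¹ : Kˣ) * r) * t' a := fun a r => by
    have h1 : t' a = t a⁻¹ * (t a * t' a) := by rw [← mul_assoc, ← map_mul]; simp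
    rw [h1, mul_assoc, scalX, ← mul_assoc, tX, mul_assoc]
  have t'Y : ∀ (a : Kˣ) r, t' a * Y r = Y (a * r) * t' a := fun a r => by
    have h1 : t' a = t a⁻¹ * (t a * t' a) := by rw [← mul_assoc, ← map_mul]; simp
    rw [h1, mul_assoc, scalY, ← mul_assoc, tY, mul_assoc]
  have wX : ∀ r, w * X r * w⁻¹ = Y (-r) := fun r => by
    rw [X_comm r, conj_commutator, ← t'_def]
    set s := ((a₀ : K) - 1)⁻¹ * r with hs
    have : ⁅t' a₀, w * X s * w⁻¹⁆ = ⁅t' a₀, Y (-s)⁆ := commutator_congr hc rfl (by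
      rw [map_mul, map_mul, map_inv, pw, hX, weyl_upperUni, hY])
    have e : (a₀ : K) * -s = -r + -s := by rw [hs]; field_simp; ring
    rw [this, commutatorElement_def, t'Y, mul_inv_cancel_right, e, Yadd, mul_inv_cancel_right]
  -- Conjugation by t(u) rescales the three factors of w.
  have wu : ∀ u : Kˣ, t u * w * (t u)⁻¹ = X u * Y (-((u⁻¹ : Kˣ) : K)) * X u := fun u => by
    rw [mul_inv_eq_iff_eq_mul, hw]
    have e := tY u⁻¹ (-1)
    rw [inv_inv] at e
    rw [← mul_assoc, ← mul_assoc, tX, mul_assoc (X _) (t u), e, mul_assoc (X _), mul_assoc (Y _),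
      tX]
    simp only [mul_one, mul_neg, mul_assoc]
  have Xneg : ∀ r, X (-r) = (X r)⁻¹ := fun r => by
    rw [eq_inv_iff_mul_eq_one, ← Xadd, neg_add_cancel, X0]
  have Yneg : ∀ r, Y (-r) = (Y r)⁻¹ := fun r => by
    rw [eq_inv_iff_mul_eq_one, ← Yadd, neg_add_cancel]; simpa using Yadd 0 0
  have wneg : t (-1) * w * (t (-1))⁻¹ = w⁻¹ := by
    rw [wu]
    simp only [hw, _root_.mul_inv_rev, ← Xneg, ← Yneg, inv_neg, inv_one, Units.val_neg, Units.val_one, neg_neg, mul_assoc]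
  have tneg : t (-1) * t (-1) = 1 := by rw [← map_mul]; simp
  have tneg' : (t (-1))⁻¹ = t (-1) := inv_eq_of_mul_eq_one_left tneg
  rw [tneg'] at wneg
  -- By `wneg`, t(-1) t'(-1) = w⁻². The left side has square 1, hence w⁴ = 1 and w² = w⁻².
  have ww : w * w = t (-1) * t' (-1) := by
    have h1 : t (-1) * t' (-1) = w⁻¹ * w⁻¹ := by rw [t'_def, ← mul_assoc, ← mul_assoc, wneg]
    have h2 : (t (-1) * t' (-1)) * (t (-1) * t' (-1)) = 1 := by
      rw [mul_assoc, ← mul_assoc (t' _), ← tt', mul_assoc, ← map_mul t', ← mul_assoc, tneg]; simp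
    rw [h1] at h2 ⊢
    rw [mul_eq_one_iff_eq_inv] at h2
    rw [h2, _root_.mul_inv_rev, inv_inv]
  have wt : ∀ a, w * t a = t' a * w := fun a => by rw [t'_def]; group
  have wt' : ∀ a, w * t' a = t a * w := fun a => by
    have h1 : w * w * t a = t a * (w * w) := by
      rw [ww, mul_assoc, ← tt', ← mul_assoc, ← map_mul, mul_comm, map_mul, mul_assoc]
    rw [t'_def, ← mul_assoc, ← mul_assoc, h1]; group
  -- The rank one relation: `wu` for u⁻¹, with its middle factor Y(-u) replaced by w X(u) w⁻¹ and
  -- solved for w X(u).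
  have wXw : ∀ u : Kˣ, w * X u = X (-((u⁻¹ : Kˣ) : K)) * t u⁻¹ * w * t u * X (-((u⁻¹ : Kˣ) : K)) * w :=
    fun u => by
    have h1 := wu u⁻¹
    rw [inv_inv, ← wX u, ← map_inv, inv_inv] at h1
    rw [Xneg]
    have h2 : w * (X u) = (X ((u⁻¹ : Kˣ) : K))⁻¹ * (t u⁻¹ * w * t u) * (X ((u⁻¹ : Kˣ) : K))⁻¹ * w := by
      rw [h1]; group
    rw [h2]; simp only [mul_assoc]
  -- the set of Bruhat normal forms
  let N : Set D := {x | (∃ r a b, x = X r * t a * t' b) ∨ ∃ r a b s, x = X r * t a * t' b * w * X s}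
  have mX : ∀ r, ∀ x ∈ N, X r * x ∈ N := by
    rintro r x (⟨r', a, b, rfl⟩ | ⟨r', a, b, s, rfl⟩)
    · exact Or.inl ⟨r + r', a, b, by rw [Xadd]; simp only [mul_assoc]⟩
    · exact Or.inr ⟨r + r', a, b, s, by rw [Xadd]; simp only [mul_assoc]⟩
  have mt : ∀ a, ∀ x ∈ N, t a * x ∈ N := by
    rintro a x (⟨r', a', b, rfl⟩ | ⟨r', a', b, s, rfl⟩)
    · exact Or.inl ⟨a * r', a * a', b, by
        rw [← mul_assoc, ← mul_assoc, tX, map_mul]; simp only [mul_assoc]⟩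
    · exact Or.inr ⟨a * r', a * a', b, s, by
        rw [← mul_assoc, ← mul_assoc, ← mul_assoc, ← mul_assoc, tX, map_mul]
        simp only [mul_assoc]⟩
  have mt' : ∀ a, ∀ x ∈ N, t' a * x ∈ N := by
    rintro a x (⟨r', a', b, rfl⟩ | ⟨r', a', b, s, rfl⟩)
    · exact Or.inl ⟨(a⁻¹ : Kˣ) * r', a', a * b, by
        rw [← mul_assoc, ← mul_assoc, t'X, map_mul, mul_assoc (X _), ← tt']
        simp only [mul_assoc]⟩
    · exact Or.inr ⟨(a⁻¹ : Kˣ) * r', a', a * b, s, by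
        rw [← mul_assoc, ← mul_assoc, ← mul_assoc, ← mul_assoc, t'X, map_mul, mul_assoc (X _),
          ← tt']
        simp only [mul_assoc]⟩
  have mNX : ∀ x ∈ N, ∀ s, x * X s ∈ N := by
    rintro x (⟨r', a', b, rfl⟩ | ⟨r', a', b, s, rfl⟩) s'
    · exact Or.inl ⟨r' + a' * ((b⁻¹ : Kˣ) * s'), a', b, by
        rw [Xadd, mul_assoc, t'X, ← mul_assoc, mul_assoc (X _), tX]; simp only [mul_assoc]⟩
    · exact Or.inr ⟨r', a', b, s + s', by rw [Xadd]; simp only [mul_assoc]⟩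
  have mw_aux : ∀ a b, t a * t' b * w ∈ N := fun a b => Or.inr ⟨0, a, b, 0, by simp [X0]⟩
  have mone : (1 : D) ∈ N := Or.inl ⟨0, 1, 1, by simp [X0]⟩
  have mw : ∀ x ∈ N, w * x ∈ N := by
    have form : ∀ a b, w * t a * t' b = t' a * t b * w := fun a b => by
      rw [wt, mul_assoc, wt', ← mul_assoc]
    rintro x (⟨r, a, b, rfl⟩ | ⟨r, a, b, s, rfl⟩)
    · have e : w * (X r * t a * t' b)
          = t' a * (t b * (1 * w * X ((a⁻¹ : Kˣ) * (b * r)))) := by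
        have h1 : X r * t a = t a * X ((a⁻¹ : Kˣ) * r) := by rw [tX]; simp
        have h2 : ∀ r, X r * t' b = t' b * X (b * r) := fun r => by rw [t'X]; simp
        rw [h1, mul_assoc (t a), h2, ← mul_assoc, ← mul_assoc, form]
        simp only [mul_assoc, one_mul]
        congr 4; ring
      rw [e]
      refine mt' _ _ (mt _ _ (mNX _ ?_ _))
      simpa using mw_aux 1 1
    · rw [← mul_assoc]
      refine mNX _ ?_ _
      -- For r = 0 the two Weyl elements merge into the torus by `ww`. For r ≠ 0 the relation `wXw`
      -- produces a further w; the second and third ones merge into the torus, and a single w is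
      -- left.
      by_cases hr : r = 0
      · have e : w * (X r * t a * t' b * w) = t' a * (t b * (t (-1) * (t' (-1) * 1))) := by
          rw [hr, X0, one_mul, ← mul_assoc, ← mul_assoc, form, mul_assoc _ w w, ww]
          simp only [mul_assoc, mul_one]
        rw [e]
        exact mt' _ _ (mt _ _ (mt _ _ (mt' _ _ mone)))
      · lift r to Kˣ using isUnit_iff_ne_zero.2 hr
        have e : w * (X r * t a * t' b * w) = X (-((r⁻¹ : Kˣ) : K)) * (t r⁻¹ * (w * (t r *
            (X (-((r⁻¹ : Kˣ) : K)) * (t' a * (t b * (t (-1) * (t' (-1) * 1)))))))) := by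
          have h1 : w * (X r * t a * t' b * w) = (w * X r) * (t a * t' b) * w := by
            simp only [mul_assoc]
          rw [h1, wXw]
          have h2 : ∀ q : D, q * w * (t a * t' b) * w = q * (t' a * t b * (w * w)) := fun q => by
            rw [mul_assoc q, ← mul_assoc w, form]; simp only [mul_assoc]
          rw [h2, ww]
          simp only [mul_assoc, mul_one]
        rw [e]
        refine mX _ _ (mt _ _ ?_)
        obtain ⟨r', a', b', h'⟩ : ∃ r' a' b', t r * (X (-((r⁻¹ : Kˣ) : K)) * (t' a * (t b *
            (t (-1) * (t' (-1) * 1))))) = t a' * t' b' * X r' := by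
          have h3 : t' a * (t b * (t (-1) * (t' (-1) * 1))) = t (b * -1) * t' (a * -1) := by
            rw [map_mul, map_mul, mul_one, ← mul_assoc, ← tt', mul_assoc, ← mul_assoc (t' a), ← tt']
            simp only [mul_assoc]
          refine ⟨((a * -1 : Kˣ) : K) * (((b * -1)⁻¹ : Kˣ) * (-((r⁻¹ : Kˣ) : K))), r * (b * -1), a * -1, ?_⟩
          rw [h3]
          generalize b * -1 = β, a * -1 = α
          rw [mul_assoc (t (r * _)), t'X, ← mul_assoc (t (r * _)), tX, ← mul_assoc (t r), tX,
            map_mul t r]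
          simp only [Units.inv_mul_cancel_left, Units.mul_inv_cancel_left, Units.val_mul, mul_assoc]
        rw [h', ← mul_assoc]
        refine mNX _ ?_ _
        rw [← mul_assoc, form]
        rw [mul_assoc]
        exact mt' _ _ (by simpa using mw_aux b' 1)
  have winv : ∀ x ∈ N, w⁻¹ * x ∈ N := fun x hx => by
    rw [← wneg, mul_assoc, mul_assoc]
    exact mt _ _ (mw _ (mt _ _ hx))
  -- The normal forms are stable under left multiplication by these generators and their inverses,
  -- so they exhaust H. The matrix under a normal form of the first kind determines its parameters,
  -- and one of the second kind has a nonzero lower left entry; hence p is injective on H.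
  let H : Subgroup D := Subgroup.closure (Set.range X ∪ Set.range t ∪ {w})
  have hHN : ∀ x ∈ H, x ∈ N := fun x hx => by
    induction hx using Subgroup.closure_induction_left with
    | one => exact mone
    | mul_left g hg y _ ih =>
      rcases hg with (⟨r, rfl⟩ | ⟨a, rfl⟩) | hg
      · exact mX _ _ ih
      · exact mt _ _ ih
      · rw [Set.mem_singleton_iff.1 hg]; exact mw _ ih
    | inv_mul_cancel g hg y _ ih =>
      rcases hg with (⟨r, rfl⟩ | ⟨a, rfl⟩) | hg
      · rw [← Xneg]; exact mX _ _ ih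
      · rw [← map_inv]; exact mt _ _ ih
      · rw [Set.mem_singleton_iff.1 hg]; exact winv _ ih
  have HX : ∀ r, X r ∈ H := fun r => Subgroup.subset_closure (Or.inl (Or.inl ⟨r, rfl⟩))
  have Ht : ∀ a, t a ∈ H := fun a => Subgroup.subset_closure (Or.inl (Or.inr ⟨a, rfl⟩))
  have Hw : w ∈ H := Subgroup.subset_closure (Or.inr rfl)
  have Ht' : ∀ a, t' a ∈ H := fun a => by
    rw [t'_def]; exact H.mul_mem (H.mul_mem Hw (Ht a)) (H.inv_mem Hw)
  have inj : ∀ x ∈ H, p x = 1 → x = 1 := fun x hx h => by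
    rcases hHN x hx with ⟨r, a, b, rfl⟩ | ⟨r, a, b, s, rfl⟩
    · rw [map_mul, map_mul, hX, ht, pt'] at h
      have h00 := congrArg (fun g : GL (Fin 2) K => g 0 0) h
      have h01 := congrArg (fun g : GL (Fin 2) K => g 0 1) h
      have h11 := congrArg (fun g : GL (Fin 2) K => g 1 1) h
      simp [coe_upperUni, coe_upperLeft, coe_lowerRight] at h00 h01 h11
      subst h00 h11 h01
      simp [X0]
    · rw [map_mul, map_mul, map_mul, map_mul, hX, ht, pt', hX, pw] at h
      have h10 := congrArg (fun g : GL (Fin 2) K => g 1 0) h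
      simp [coe_upperUni, coe_upperLeft, coe_lowerRight, coe_weyl] at h10
  have surj : ∀ g, ∃ x ∈ H, p x = g := fun g => by
    have hdet : g 0 0 * g 1 1 - g 0 1 * g 1 0 ≠ 0 := by
      have := g.det.ne_zero
      rwa [Matrix.GeneralLinearGroup.val_det_apply, Matrix.det_fin_two] at this
    by_cases hg : g 1 0 = 0
    · have h0 : g 0 0 ≠ 0 := fun h => hdet (by simp [h, hg])
      have h1 : g 1 1 ≠ 0 := fun h => hdet (by simp [h, hg])
      refine ⟨X (g 0 1 / g 1 1) * t (Units.mk0 _ h0) * t' (Units.mk0 _ h1),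
        H.mul_mem (H.mul_mem (HX _) (Ht _)) (Ht' _), ?_⟩
      rw [map_mul, map_mul, hX, ht, pt']
      ext i j
      fin_cases i <;> fin_cases j <;>
        simp [coe_upperUni, coe_upperLeft, coe_lowerRight, hg, h1]
    -- The Bruhat decomposition of the big cell: with rows (a, b) and (c, d), c ≠ 0, the unipotent
    -- entries are a/c and d/c, and the torus is diag(-det/c, -c).
    · have h1 : -(g 0 0 * g 1 1 - g 0 1 * g 1 0) / g 1 0 ≠ 0 := div_ne_zero (neg_ne_zero.2 hdet) hg
      refine ⟨X (g 0 0 / g 1 0) * t (Units.mk0 _ h1) * t' (Units.mk0 _ (neg_ne_zero.2 hg)) * w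
        * X (g 1 1 / g 1 0), H.mul_mem (H.mul_mem (H.mul_mem (H.mul_mem (HX _) (Ht _)) (Ht' _)) Hw)
          (HX _), ?_⟩
      rw [map_mul, map_mul, map_mul, map_mul, hX, ht, pt', hX, pw]
      ext i j
      fin_cases i <;> fin_cases j <;>
        simp [coe_upperUni, coe_upperLeft, coe_lowerRight, coe_weyl, hg] <;> field_simp <;> ring
  let e : H ≃* GL (Fin 2) K := MulEquiv.ofBijective (p.comp H.subtype) ⟨by
    rw [injective_iff_map_eq_one]
    exact fun x hx => Subtype.ext (inj x.1 x.2 hx), fun g => by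
      obtain ⟨x, hx, h⟩ := surj g
      exact ⟨⟨x, hx⟩, h⟩⟩
  exact ⟨H.subtype.comp e.symm.toMonoidHom, fun g => e.apply_symm_apply g⟩

end GLTwo

end TwoDim
end

noncomputable section

namespace TwoDim

open scoped commutatorElement

/-! ### Comparison of two central extensions through diagonal commutators -/

section Comparison

variable {K : Type*} [Field K]

theorem IsCentral.ker_le {A E G : Type*} [Group A] [Group E] [Group G] {S : GroupExtension A E G}
    (h : IsCentral S) : S.rightHom.ker ≤ Subgroup.center E :=
  S.range_inl_eq_ker_rightHom ▸ h

theorem exists_inl_of_rightHom {A E G : Type*} [Group A] [Group E] [Group G]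
    {S : GroupExtension A E G} {x : E} (h : S.rightHom x = 1) : ∃ k, S.inl k = x := by
  have : x ∈ S.inl.range := by rw [S.range_inl_eq_ker_rightHom]; exact h
  exact this

theorem SplitsOver.exists_upperLeft {A E : Type*} [Group A] [Group E]
    {S : GroupExtension A E (GL (Fin 2) K)} (h : SplitsOver S (upperLeft K).range) :
    ∃ t : Kˣ →* E, ∀ a, S.rightHom (t a) = upperLeft K a := by
  obtain ⟨s, hs⟩ := h
  exact ⟨s.comp (upperLeft K).rangeRestrict, fun a => hs _⟩

/-- A central extension of `GL₂(K)` that splits over `K^*` is determined by the commutators of the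
lifts of diagonal matrices. -/
theorem obtainedBy_of_diag_commutator [Infinite K] {A₀ E₀ A E : Type*} [Group A₀] [Group E₀]
    [Group A] [Group E] {S₀ : GroupExtension A₀ E₀ (GL (Fin 2) K)}
    {S : GroupExtension A E (GL (Fin 2) K)} (h₀ : IsCentral S₀) (h : IsCentral S) (φ : A₀ →* A)
    (hs₀ : SplitsOver S₀ (upperLeft K).range) (hs : SplitsOver S (upperLeft K).range)
    (hsym : ∀ a b : Kˣ, ∃ x y x' y' k, S₀.rightHom x = upperLeft K a ∧
      S₀.rightHom y = lowerRight K b ∧ S.rightHom x' = upperLeft K a ∧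
      S.rightHom y' = lowerRight K b ∧ ⁅x, y⁆ = S₀.inl k ∧ ⁅x', y'⁆ = S.inl (φ k)) :
    ObtainedBy S₀ φ S := by
  obtain ⟨t₀, ht₀⟩ := hs₀.exists_upperLeft
  obtain ⟨t, ht⟩ := hs.exists_upperLeft
  -- The fibre product of the two extensions is an extension of GL₂(K) by A₀ × A. Dividing by the
  -- graph of φ leaves a central extension, and a section of it is the same as a morphism of
  -- extensions that is φ on the kernels.
  let FP : Subgroup (E₀ × E) :=
    (S₀.rightHom.comp (MonoidHom.fst E₀ E)).eqLocus (S.rightHom.comp (MonoidHom.snd E₀ E))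
  have hFP : ∀ x : FP, S₀.rightHom x.1.1 = S.rightHom x.1.2 := fun x => x.2
  let ι : A₀ →* FP := (S₀.inl.prod (S.inl.comp φ)).codRestrict FP fun k => by
    change S₀.rightHom (S₀.inl k) = S.rightHom (S.inl (φ k))
    rw [S₀.rightHom_inl, S.rightHom_inl]
  have hι : ∀ k, (ι k).1 = (S₀.inl k, S.inl (φ k)) := fun k => rfl
  have cen : ∀ x : FP, S₀.rightHom x.1.1 = 1 → x ∈ Subgroup.center FP := fun x hx => by
    rw [Subgroup.mem_center_iff]
    intro g
    apply Subtype.ext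
    refine Prod.ext ?_ ?_
    · exact ker_comm h₀.ker_le hx g.1.1
    · exact ker_comm h.ker_le ((hFP x).symm.trans hx) g.1.2
  have hΔc : ι.range ≤ Subgroup.center FP := by
    rintro _ ⟨k, rfl⟩
    exact cen _ (by rw [hι]; exact S₀.rightHom_inl k)
  have : ι.range.Normal := ⟨fun n hn g => by
    rw [Subgroup.mem_center_iff.1 (hΔc hn), mul_inv_cancel_right]; exact hn⟩
  let q : FP →* FP ⧸ ι.range := QuotientGroup.mk' _
  have q_eq : ∀ x y : FP, q x = q y ↔ ∃ k, x * ι k = y := fun x y => by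
    rw [QuotientGroup.mk'_apply, QuotientGroup.mk'_apply, QuotientGroup.eq]
    constructor
    · rintro ⟨k, hk⟩; exact ⟨k, by rw [hk]; group⟩
    · rintro ⟨k, rfl⟩; exact ⟨k, by group⟩
  let p : FP ⧸ ι.range →* GL (Fin 2) K := QuotientGroup.lift _
    ((S₀.rightHom.comp (MonoidHom.fst E₀ E)).comp FP.subtype) (by
      rintro _ ⟨k, rfl⟩
      exact S₀.rightHom_inl k)
  have hp : ∀ x : FP, p (q x) = S₀.rightHom x.1.1 := fun x => rfl
  have q_surj : Function.Surjective q := QuotientGroup.mk'_surjective _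
  have pc : p.ker ≤ Subgroup.center _ := by
    intro y hy
    obtain ⟨x, rfl⟩ := q_surj y
    rw [MonoidHom.mem_ker, hp] at hy
    rw [Subgroup.mem_center_iff]
    intro g
    obtain ⟨g, rfl⟩ := q_surj g
    rw [← map_mul, ← map_mul, Subgroup.mem_center_iff.1 (cen x hy)]
  have psurj : Function.Surjective p := fun g => by
    obtain ⟨x, hx⟩ := S₀.rightHom_surjective g
    obtain ⟨y, hy⟩ := S.rightHom_surjective g
    exact ⟨q ⟨(x, y), hx.trans hy.symm⟩, hx⟩
  let T : Kˣ →* FP := (t₀.prod t).codRestrict FP fun a => (ht₀ a).trans (ht a).symm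
  -- The commutator of the chosen lifts of diag(a, 1) and diag(1, b) is a point of the graph, so it
  -- dies in the quotient.
  obtain ⟨σ, hσ⟩ := exists_section_of_diag_commute pc psurj (q.comp T) (fun a => ht₀ a) (by
    intro a b X Y hX hY
    obtain ⟨x, y, x', y', k, hx, hy, hx', hy', e, e'⟩ := hsym a b
    let u : FP := ⟨(x, x'), hx.trans hx'.symm⟩
    let v : FP := ⟨(y, y'), hy.trans hy'.symm⟩
    rw [← commutatorElement_eq_one_iff_mul_comm,
      commutator_congr pc (x' := q u) (y' := q v) (hX.trans hx.symm) (hY.trans hy.symm),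
      ← map_commutatorElement]
    have : ⁅u, v⁆ = ι k := Subtype.ext (Prod.ext e e')
    rw [this]
    exact ((q_eq 1 (ι k)).2 ⟨k, one_mul _⟩).symm)
  -- A class of the quotient over g contains, for each x over g, a pair with first coordinate x. By
  -- `uniq` it is the only one, since a point of the graph with trivial first coordinate is trivial.
  -- The second coordinate of the pair in the class σ(g) is the value of the morphism at x.
  have ex : ∀ x : E₀, ∃ y : E, ∃ hy : S₀.rightHom x = S.rightHom y,
      q ⟨(x, y), hy⟩ = σ (S₀.rightHom x) := fun x => by
    obtain ⟨z, hz⟩ := q_surj (σ (S₀.rightHom x))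
    have h1 : S₀.rightHom z.1.1 = S₀.rightHom x := by rw [← hp, hz, hσ]
    obtain ⟨k, hk⟩ := exists_inl_of_rightHom (S := S₀) (x := z.1.1⁻¹ * x) (by
      rw [map_mul, map_inv, h1, inv_mul_cancel])
    have h2 : (z * ι k).1.1 = x := by
      change z.1.1 * S₀.inl k = x
      rw [hk, mul_inv_cancel_left]
    refine ⟨(z * ι k).1.2, by rw [← hFP, h2], ?_⟩
    rw [← hz, eq_comm, q_eq]
    exact ⟨k, Subtype.ext (Prod.ext h2 rfl)⟩
  have uniq : ∀ (x : E₀) (y y' : E) (hy : S₀.rightHom x = S.rightHom y)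
      (hy' : S₀.rightHom x = S.rightHom y'), q ⟨(x, y), hy⟩ = q ⟨(x, y'), hy'⟩ → y = y' := by
    intro x y y' hy hy' e
    obtain ⟨k, hk⟩ := (q_eq _ _).1 e
    have h1 := congrArg (fun z : FP => z.1.1) hk
    have h2 := congrArg (fun z : FP => z.1.2) hk
    change x * S₀.inl k = x at h1
    change y * S.inl (φ k) = y' at h2
    rw [mul_eq_left, map_eq_one_iff _ S₀.inl_injective] at h1
    rw [h1, map_one, map_one, mul_one] at h2
    exact h2
  choose F hF hF' using ex
  refine ⟨MonoidHom.mk' F fun x x' => ?_, fun k => ?_, fun x => (hF x).symm⟩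
  · refine uniq (x * x') _ _ (hF _) (by rw [map_mul, map_mul, hF, hF]) ((hF' _).trans ?_)
    have e : σ (S₀.rightHom (x * x')) = q ⟨(x, F x), hF x⟩ * q ⟨(x', F x'), hF x'⟩ := by
      rw [hF', hF', ← map_mul, ← map_mul]
    exact e
  · refine uniq (S₀.inl k) _ _ (hF _) (by rw [S₀.rightHom_inl, S.rightHom_inl])
      (((hF' _).trans (by rw [S₀.rightHom_inl, map_one] : σ _ = 1)).trans ?_)
    exact (q_eq 1 _).2 ⟨k, Subtype.ext (Prod.ext (one_mul _) (one_mul _))⟩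

end Comparison

/-! ### Calculations with w and h in the Steinberg group -/

section SymbolInK2

variable {K : Type*} [Field K]

theorem St.x_commute {i j k l : ℕ} (hij : i ≠ j) (hkl : k ≠ l) (hjk : j ≠ k) (hil : i ≠ l)
    (r s : K) : Commute (St.x i j hij r) (St.x k l hkl s) :=
  commutatorElement_eq_one_iff_mul_comm.1 (St.x_comm_one i j k l hij hkl hjk hil r s)

theorem St.x_zero {i j : ℕ} (h : i ≠ j) : St.x i j h (0 : K) = 1 := by
  simpa using St.x_add i j h (0 : K) 0

theorem St.x_neg {i j : ℕ} (h : i ≠ j) (r : K) : St.x i j h (-r) = (St.x i j h r)⁻¹ := by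
  rw [eq_inv_iff_mul_eq_one, ← St.x_add, neg_add_cancel, St.x_zero]

theorem St.x_mul_x {i j k : ℕ} (hij : i ≠ j) (hjk : j ≠ k) (hik : i ≠ k) (r s : K) :
    St.x i j hij r * St.x j k hjk s
      = St.x i k hik (r * s) * St.x j k hjk s * St.x i j hij r := by
  rw [← St.x_comm i j k hij hjk hik, commutatorElement_def]; group

theorem St.x_mul_x' {i j k : ℕ} (hij : i ≠ j) (hjk : j ≠ k) (hik : i ≠ k) (r s : K) :
    St.x j k hjk s * St.x i j hij r
      = St.x i k hik (-(r * s)) * St.x i j hij r * St.x j k hjk s := by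
  rw [St.x_neg, mul_assoc, St.x_mul_x hij hjk hik]; group

theorem St.w_inv {i j : ℕ} (h : i ≠ j) (u : Kˣ) : (St.w i j h u)⁻¹ = St.w i j h (-u) := by
  simp only [St.w, _root_.mul_inv_rev, ← St.x_neg, mul_assoc, inv_neg, Units.val_neg, neg_neg]

/-- `w_{ik}(u) x_{ij}(r) = x_{kj}(-u⁻¹ r) w_{ik}(u)`. -/
theorem St.w_mul_x_left {i j k : ℕ} (hij : i ≠ j) (hik : i ≠ k) (hkj : k ≠ j) (u : Kˣ) (r : K) :
    St.w i k hik u * St.x i j hij r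
      = St.x k j hkj (-((u⁻¹ : Kˣ) : K) * r) * St.w i k hik u := by
  have c1 := St.x_commute hik hij hik.symm hij (u : K) r
  have c2 := St.x_commute hkj hij hij.symm hkj (-((u⁻¹ : Kˣ) : K) * r) r
  have e1 := St.x_mul_x hik.symm hij hkj (-((u⁻¹ : Kˣ) : K)) r
  have e2 := St.x_mul_x hik hkj hij (u : K) (-((u⁻¹ : Kˣ) : K) * r)
  have e3 : (u : K) * (-((u⁻¹ : Kˣ) : K) * r) = -r := by simp
  rw [e3, St.x_neg] at e2
  unfold St.w
  set A := St.x i k hik (u : K)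
  set B := St.x k i hik.symm (-((u⁻¹ : Kˣ) : K))
  set C := St.x k j hkj (-((u⁻¹ : Kˣ) : K) * r)
  set Xr := St.x i j hij r
  calc A * B * A * Xr = A * (B * Xr) * A := by rw [mul_assoc _ A, c1.eq]; simp only [mul_assoc]
    _ = (A * C) * Xr * B * A := by rw [e1]; simp only [mul_assoc]
    _ = Xr⁻¹ * C * (A * Xr) * B * A := by rw [e2]; simp only [mul_assoc]
    _ = Xr⁻¹ * (C * Xr) * (A * B * A) := by rw [c1.eq]; simp only [mul_assoc]
    _ = C * (A * B * A) := by rw [c2.eq]; group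

/-- `w_{ik}(u) x_{ji}(r) = x_{jk}(-r u) w_{ik}(u)`. -/
theorem St.w_mul_x_right {i j k : ℕ} (hji : j ≠ i) (hik : i ≠ k) (hjk : j ≠ k) (u : Kˣ) (r : K) :
    St.w i k hik u * St.x j i hji r
      = St.x j k hjk (-(r * u)) * St.w i k hik u := by
  have e1 := St.x_mul_x' hji hik hjk r (u : K)
  have e2 := St.x_mul_x' hjk hik.symm hji (-(r * u)) (-((u⁻¹ : Kˣ) : K))
  have e3 : -(-(r * u) * -((u⁻¹ : Kˣ) : K)) = -r := by
    rw [neg_mul_neg, mul_assoc, Units.mul_inv, mul_one]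
  rw [e3, St.x_neg hji] at e2
  have c1 := St.x_commute hik.symm hji hji.symm hik.symm (-((u⁻¹ : Kˣ) : K)) r
  have c2 := St.x_commute hik hjk hjk.symm hik (u : K) (-(r * u))
  have c3 := St.x_commute hji hjk hji.symm hjk r (-(r * u))
  have c3' := c3.inv_left
  unfold St.w
  set A := St.x i k hik (u : K)
  set B := St.x k i hik.symm (-((u⁻¹ : Kˣ) : K))
  set C := St.x j k hjk (-(r * u))
  set Xr := St.x j i hji r
  calc A * B * A * Xr = A * (B * C) * Xr * A := by rw [mul_assoc _ A, e1]; simp only [mul_assoc]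
    _ = A * Xr⁻¹ * C * (B * Xr) * A := by rw [e2]; simp only [mul_assoc]
    _ = A * (Xr⁻¹ * C) * Xr * B * A := by rw [c1.eq]; simp only [mul_assoc]
    _ = A * C * (B * A) := by rw [c3'.eq]; group
    _ = C * (A * B * A) := by rw [c2.eq]; simp only [mul_assoc]

/-- In h(u) = w(u) w(-1), the factor w(-1) moves the root ij to kj, and w(u) moves it back with the
factor u. -/
theorem St.h_mul_x_left {i j k : ℕ} (hij : i ≠ j) (hik : i ≠ k) (hkj : k ≠ j) (u : Kˣ) (r : K) :
    St.h i k hik u * St.x i j hij r = St.x i j hij (u * r) * St.h i k hik u := by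
  -- The inverse of `St.w_mul_x_left` at -u, because w(u)⁻¹ = w(-u).
  have key : St.w i k hik u * St.x k j hkj r = St.x i j hij (u * r) * St.w i k hik u := by
    have := St.w_mul_x_left hij hik hkj (-u) (u * r)
    have e : -(((-u)⁻¹ : Kˣ) : K) * (u * r) = r := by simp
    rw [e, ← St.w_inv, inv_mul_eq_iff_eq_mul, ← mul_assoc, eq_mul_inv_iff_mul_eq] at this
    exact this.symm
  have e : -(((-1 : Kˣ)⁻¹ : Kˣ) : K) * r = r := by simp
  rw [St.h, mul_assoc, St.w_mul_x_left hij hik hkj, e, ← mul_assoc, key, mul_assoc]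

theorem St.h_mul_x_right {i j k : ℕ} (hji : j ≠ i) (hik : i ≠ k) (hjk : j ≠ k) (u : Kˣ) (r : K) :
    St.h i k hik u * St.x j i hji r = St.x j i hji (r * (u⁻¹ : Kˣ)) * St.h i k hik u := by
  have key : St.w i k hik u * St.x j k hjk r
      = St.x j i hji (r * (u⁻¹ : Kˣ)) * St.w i k hik u := by
    have := St.w_mul_x_right hji hik hjk (-u) (r * (u⁻¹ : Kˣ))
    have e : -(r * ((u⁻¹ : Kˣ) : K) * ((-u : Kˣ) : K)) = r := by simp
    rw [e, ← St.w_inv, inv_mul_eq_iff_eq_mul, ← mul_assoc, eq_mul_inv_iff_mul_eq] at this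
    exact this.symm
  have e : -(r * ((-1 : Kˣ) : K)) = r := by simp
  rw [St.h, mul_assoc, St.w_mul_x_right hji hik hjk, e, ← mul_assoc, key, mul_assoc]

/-- Conjugation by `h₀₂(g)` acts on the subgroup of the roots `01`, `10` as the torus does. -/
theorem St.conj_h (f g : Kˣ) :
    St.h 0 2 (by decide) g * St.h 0 1 (by decide) f * (St.h 0 2 (by decide) g)⁻¹
      = torusHom g (St.h 0 1 (by decide) f) := by
  have hx : ∀ r : K, St.h 0 2 (by decide) g * St.x 0 1 (by decide) r * (St.h 0 2 (by decide) g)⁻¹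
      = torusHom g (St.x 0 1 (by decide) r) := fun r => by
    rw [St.h_mul_x_left (by decide) (by decide) (by decide), mul_inv_cancel_right, torusHom_x]
    simp [torusEntry]
  have hy : ∀ r : K, St.h 0 2 (by decide) g * St.x 1 0 (by decide) r * (St.h 0 2 (by decide) g)⁻¹
      = torusHom g (St.x 1 0 (by decide) r) := fun r => by
    rw [St.h_mul_x_right (by decide) (by decide) (by decide), mul_inv_cancel_right, torusHom_x]
    simp [torusEntry]
  have hm : ∀ z x y : St K, z * (x * y) * z⁻¹ = (z * x * z⁻¹) * (z * y * z⁻¹) := by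
    intro z x y; group
  simp only [St.h, St.w] at *
  simp only [hm _ (_ * _) _, hm _ (St.x _ _ _ _) _, hx, hy, map_mul]

/-- Conjugation by h₀₂(g) can be replaced by the torus action of g. In this form the symbol appears
as a commutator in the semidirect product with K^*. -/
theorem coe_symbol (f g : Kˣ) :
    ((symbol f g : K2 K) : St K) = St.h 0 1 (by decide) f * (torusHom g (St.h 0 1 (by decide) f))⁻¹ := by
  rw [← St.conj_h, symbol]
  simp only [commutatorElement_def]
  group

end SymbolInK2

/-! ### Centrality of K₂(K) in the Steinberg group -/

section KTwoCentral

variable {K : Type*} [Field K]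

variable (K) in
/-- The subgroup of `St(K)` generated by the `x_{in}(r)` for a fixed `n`. -/
def St.column (n : ℕ) : Subgroup (St K) :=
  Subgroup.closure {y | ∃ (i : ℕ) (h : i ≠ n) (r : K), y = St.x i n h r}

theorem St.column_comm (n : ℕ) : ∀ y ∈ {y | ∃ (i : ℕ) (h : i ≠ n) (r : K), y = St.x i n h r},
    ∀ z ∈ {y | ∃ (i : ℕ) (h : i ≠ n) (r : K), y = St.x i n h r}, y * z = z * y := by
  rintro _ ⟨i, hi, r, rfl⟩ _ ⟨j, hj, s, rfl⟩
  exact St.x_commute hi hj hj.symm hi r s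

instance (n : ℕ) : CommGroup (St.column K n) :=
  { (inferInstance : Group (St.column K n)) with
    mul_comm := (Subgroup.isMulCommutative_closure (St.column_comm n)).is_comm.comm }

open Classical in
/-- The homomorphism `r ↦ x_{in}(r)` to the column subgroup (trivial for `i = n`). -/
def St.colFun (n i : ℕ) : K →+ Additive (St.column K n) :=
  if h : i ≠ n then
    { toFun := fun r => Additive.ofMul ⟨St.x i n h r, Subgroup.subset_closure ⟨i, h, r, rfl⟩⟩
      map_zero' := by
        rw [ofMul_eq_zero]
        exact Subtype.ext (St.x_zero h)
      map_add' := fun r s => by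
        rw [← ofMul_mul]
        exact congrArg Additive.ofMul (Subtype.ext (St.x_add i n h r s)) } else 0

/-- The element of the column subgroup with given entries (the `n`-th entry is ignored). -/
def St.col (n : ℕ) (v : ℕ →₀ K) : St K :=
  ((Finsupp.liftAddHom (St.colFun n) v).toMul : St.column K n)

theorem St.col_add (n : ℕ) (v v' : ℕ →₀ K) :
    St.col n (v + v') = St.col n v * St.col n v' := by
  rw [St.col, map_add, toMul_add]; rfl

theorem St.col_zero (n : ℕ) : St.col n (0 : ℕ →₀ K) = 1 := by
  rw [St.col, map_zero]; rfl

theorem St.col_single {i n : ℕ} (h : i ≠ n) (r : K) :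
    St.col n (Finsupp.single i r) = St.x i n h r := by
  rw [St.col, Finsupp.liftAddHom_apply_single, St.colFun, dif_pos h]; rfl

theorem St.col_single_self (n : ℕ) (r : K) : St.col n (Finsupp.single n r) = 1 := by
  rw [St.col, Finsupp.liftAddHom_apply_single, St.colFun, dif_neg (by simp)]; rfl

theorem elemMat_single (k l i : ℕ) (h : k ≠ l) (s r : K) :
    (elemMat k l h s : MatInf K) (Finsupp.single i r)
      = Finsupp.single i r + if l = i then Finsupp.single k (s * r) else 0 := by
  simp only [elemMat, entry, LinearMap.add_apply, Module.End.one_apply, LinearMap.comp_apply,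
    LinearMap.smul_apply, Finsupp.lapply_apply, Finsupp.lsingle_apply, Finsupp.single_apply]
  split_ifs with h1 h2 h2
  · simp
  · exact absurd h1.symm h2
  · exact absurd h2.symm h1
  · simp

/-- An element built from generators that avoid the index n normalizes the column subgroup and acts
on it through its matrix alone. An element with trivial matrix therefore centralizes the column. -/
theorem St.conj_col {n : ℕ} {x : St K}
    (hx : x ∈ Subgroup.closure {y : St K | ∃ (k l : ℕ) (h : k ≠ l) (r : K), k ≠ n ∧ l ≠ n ∧
      y = St.x k l h r}) (v : ℕ →₀ K) :
    x * St.col n v * x⁻¹ = St.col n ((St.toSL x : MatInf K) v) := by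
  induction hx using Subgroup.closure_induction generalizing v with
  | one => simp
  | mul x y _ _ hx hy =>
    have : x * y * St.col n v * (x * y)⁻¹ = x * (y * St.col n v * y⁻¹) * x⁻¹ := by group
    rw [this, hy, hx, map_mul, Units.val_mul, Module.End.mul_apply]
  | inv x _ hx =>
    have h1 := hx ((((St.toSL x)⁻¹ : (MatInf K)ˣ) : MatInf K) v)
    rw [← Module.End.mul_apply, Units.mul_inv, Module.End.one_apply] at h1
    rw [← h1, map_inv]; group
  | mem y hy =>
    obtain ⟨k, l, h, s, hk, hl, rfl⟩ := hy
    rw [St.toSL_x]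
    induction v using Finsupp.induction_linear with
    | zero => simp [St.col_zero]
    | add v v' h1 h2 =>
      rw [map_add, St.col_add, St.col_add, ← h1, ← h2]; group
    | single i r =>
      rw [elemMat_single]
      by_cases hin : i = n
      · subst hin
        rw [if_neg hl, add_zero, St.col_single_self]; simp
      by_cases hil : l = i
      · subst hil
        rw [if_pos rfl, St.col_add, St.col_single hin, St.col_single hk, St.x_mul_x h hin hk,
          mul_inv_cancel_right]
        exact St.x_commute hk hin (Ne.symm hin) hk _ _
      · rw [if_neg hil, add_zero, St.col_single hin, (St.x_commute h hin hil hk _ _).eq,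
          mul_inv_cancel_right]

theorem St.closure_generators :
    Subgroup.closure {y : St K | ∃ (k l : ℕ) (h : k ≠ l) (r : K), y = St.x k l h r} = ⊤ := by
  rw [eq_top_iff, ← PresentedGroup.closure_range_of {w : FreeGroup (StGen K) | StRel K w}]
  refine Subgroup.closure_mono ?_
  rintro _ ⟨⟨k, l, h, r⟩, rfl⟩
  exact ⟨k, l, h, r, rfl⟩

/-- A word involves finitely many indices, and any larger n avoids all of them. -/
theorem St.exists_bound (x : St K) : ∃ N : ℕ, ∀ n ≥ N,
    x ∈ Subgroup.closure {y : St K | ∃ (k l : ℕ) (h : k ≠ l) (r : K), k ≠ n ∧ l ≠ n ∧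
      y = St.x k l h r} := by
  have hx : x ∈ Subgroup.closure {y : St K | ∃ (k l : ℕ) (h : k ≠ l) (r : K), y = St.x k l h r} :=
    by rw [St.closure_generators]; trivial
  induction hx using Subgroup.closure_induction with
  | one => exact ⟨0, fun n _ => one_mem _⟩
  | mul x y _ _ hx hy =>
    obtain ⟨N, hN⟩ := hx
    obtain ⟨N', hN'⟩ := hy
    exact ⟨max N N', fun n hn => mul_mem (hN n (le_trans (le_max_left _ _) hn))
      (hN' n (le_trans (le_max_right _ _) hn))⟩
  | inv x _ hx =>
    obtain ⟨N, hN⟩ := hx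
    exact ⟨N, fun n hn => inv_mem (hN n hn)⟩
  | mem y hy =>
    obtain ⟨k, l, h, r, rfl⟩ := hy
    refine ⟨k + l + 1, fun n hn => Subgroup.subset_closure ⟨k, l, h, r, ?_, ?_, rfl⟩⟩ <;> omega

variable (K) in
/-- The automorphism `x_{ij}(r) ↦ x_{ji}(-r)` of the Steinberg group. -/
def St.transposeInv : St K →* St K :=
  St.lift (fun i j h r => St.x j i h.symm (-r))
    (fun i j h r s => by rw [← St.x_add, neg_add])
    (fun i j k l hij hkl hjk hil r s => St.x_comm_one j i l k hij.symm hkl.symm hil hjk (-r) (-s))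
    (fun i j k hij hjk hik r s => by
      rw [← inv_inj, commutatorElement_inv, St.x_comm k j i hjk.symm hij.symm hik.symm, ← St.x_neg]
      congr 1; ring)

theorem St.transposeInv_x (i j : ℕ) (h : i ≠ j) (r : K) :
    St.transposeInv K (St.x i j h r) = St.x j i h.symm (-r) := St.lift_x ..

theorem St.transposeInv_transposeInv (x : St K) :
    St.transposeInv K (St.transposeInv K x) = x := by
  have : (St.transposeInv K).comp (St.transposeInv K) = MonoidHom.id _ :=
    St.hom_ext fun i j h r => by
      rw [MonoidHom.comp_apply, St.transposeInv_x, St.transposeInv_x, neg_neg]; rfl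
  exact DFunLike.congr_fun this x

variable (K) in
/-- The standard bilinear form on finitely supported vectors. -/
def finsuppDot : (ℕ →₀ K) →ₗ[K] (ℕ →₀ K) →ₗ[K] K :=
  Finsupp.lsum K fun i => LinearMap.smulRight LinearMap.id (Finsupp.lapply i)

theorem finsuppDot_single_left (i : ℕ) (a : K) (w : ℕ →₀ K) :
    finsuppDot K (Finsupp.single i a) w = a * w i := by
  simp [finsuppDot]

theorem finsuppDot_single_right (i : ℕ) (a : K) (v : ℕ →₀ K) :
    finsuppDot K v (Finsupp.single i a) = v i * a := by
  induction v using Finsupp.induction_linear with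
  | zero => simp
  | add v v' h h' => simp [h, h', add_mul]
  | single j b =>
    rw [finsuppDot_single_left, Finsupp.single_apply, Finsupp.single_apply]
    by_cases h : i = j
    · subst h; simp
    · simp [h, Ne.symm h]

theorem elemMat_apply (k l : ℕ) (h : k ≠ l) (s : K) (w : ℕ →₀ K) :
    (elemMat k l h s : MatInf K) w = w + Finsupp.single k (s * w l) := by
  simp [elemMat, entry]

/-- The automorphism x_{ij}(r) ↦ x_{ji}(-r) induces the contragredient action on matrices. It serves
to deduce statements on rows from statements on columns. -/
theorem St.finsuppDot_transposeInv (x : St K) (v w : ℕ →₀ K) :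
    finsuppDot K ((St.toSL (St.transposeInv K x) : MatInf K) v) ((St.toSL x : MatInf K) w)
      = finsuppDot K v w := by
  have hx : x ∈ Subgroup.closure {y : St K | ∃ (k l : ℕ) (h : k ≠ l) (r : K), y = St.x k l h r} :=
    by rw [St.closure_generators]; trivial
  induction hx using Subgroup.closure_induction generalizing v w with
  | one => simp
  | mul x y _ _ hx hy =>
    simp only [map_mul, Units.val_mul, Module.End.mul_apply]
    rw [hx, hy]
  | inv x _ hx =>
    rw [map_inv, map_inv, map_inv, ← hx, ← Module.End.mul_apply, ← Module.End.mul_apply,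
      Units.mul_inv, Units.mul_inv]
    rfl
  | mem y hy =>
    obtain ⟨k, l, h, s, rfl⟩ := hy
    rw [St.transposeInv_x, St.toSL_x, St.toSL_x, elemMat_apply, elemMat_apply]
    simp only [map_add, LinearMap.add_apply, finsuppDot_single_left, finsuppDot_single_right,
      Finsupp.single_apply, Finsupp.add_apply, if_neg h, if_neg (Ne.symm h)]
    ring

theorem St.transposeInv_mem_K2 {x : St K} (hx : x ∈ K2 K) : St.transposeInv K x ∈ K2 K := by
  rw [K2, MonoidHom.mem_ker] at *
  ext1
  refine LinearMap.ext fun v => Finsupp.ext fun i => ?_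
  have := St.finsuppDot_transposeInv x v (Finsupp.single i 1)
  rw [hx, Units.val_one, Module.End.one_apply, finsuppDot_single_right, finsuppDot_single_right,
    mul_one, mul_one] at this
  exact this

/-- Steinberg's argument: for large n, an element of K₂(K) acts on the n-th column by the identity
matrix, so it commutes with all x_{in}(r). Its image under the contragredient automorphism also lies
in K₂(K), so it commutes with all x_{ni}(r) as well. These elements generate St(K). -/
theorem K2_le_center : K2 K ≤ Subgroup.center (St K) := by
  have key : ∀ x ∈ K2 K, ∃ N : ℕ, ∀ n ≥ N, ∀ i (h : i ≠ n) r, Commute x (St.x i n h r) := by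
    intro x hx
    obtain ⟨N, hN⟩ := St.exists_bound x
    refine ⟨N, fun n hn i h r => ?_⟩
    have := St.conj_col (hN n hn) (Finsupp.single i r)
    rw [(MonoidHom.mem_ker).1 hx, Units.val_one, Module.End.one_apply, St.col_single h,
      mul_inv_eq_iff_eq_mul] at this
    exact this
  intro x hx
  obtain ⟨N, hN⟩ := key x hx
  obtain ⟨N', hN'⟩ := key _ (St.transposeInv_mem_K2 hx)
  set n := max N N'
  have c1 : ∀ i (h : i ≠ n) r, Commute x (St.x i n h r) := hN n (le_max_left _ _)
  have c2 : ∀ i (h : n ≠ i) r, Commute x (St.x n i h r) := fun i h r => by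
    have := (hN' n (le_max_right _ _) i h.symm (-r)).map (St.transposeInv K)
    rwa [St.transposeInv_transposeInv, St.transposeInv_x, neg_neg] at this
  have c3 : ∀ i j (h : i ≠ j) r, Commute x (St.x i j h r) := fun i j h r => by
    by_cases hj : j = n
    · subst hj; exact c1 i h r
    by_cases hi : i = n
    · subst hi; exact c2 j h r
    have e := St.x_comm i n j hi (Ne.symm hj) h r 1
    rw [mul_one] at e
    rw [← e, commutatorElement_def]
    exact (((c1 i hi r).mul_right (c2 j _ 1)).mul_right (c1 i hi r).inv_right).mul_right
      (c2 j _ 1).inv_right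
  have : (MulAut.conj x).toMonoidHom = MonoidHom.id (St K) := St.hom_ext fun i j h r => by
    change x * _ * x⁻¹ = _
    rw [(c3 i j h r).eq, mul_inv_cancel_right]; rfl
  rw [Subgroup.mem_center_iff]
  intro g
  have := DFunLike.congr_fun this g
  exact (mul_inv_eq_iff_eq_mul.1 this).symm

end KTwoCentral

/-! ### Centrality and diagonal commutators of the extension by K₂(K) -/

section HatCommutator

variable {K : Type*} [Field K]

/-- The torus acts on St(K) by outer data, but on elements avoiding the index n it agrees with the
inner automorphism of h_{0n}(a): the additional entry a⁻¹ at n is not seen. Central elements are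
therefore fixed by the torus. -/
theorem torusHom_eq_conj {n : ℕ} (hn : 0 ≠ n) (a : Kˣ) {x : St K}
    (hx : x ∈ Subgroup.closure {y : St K | ∃ (k l : ℕ) (h : k ≠ l) (r : K), k ≠ n ∧ l ≠ n ∧
      y = St.x k l h r}) : torusHom a x = St.h 0 n hn a * x * (St.h 0 n hn a)⁻¹ := by
  induction hx using Subgroup.closure_induction with
  | one => simp
  | mul x y _ _ hx hy => rw [map_mul, hx, hy]; group
  | inv x _ hx => rw [map_inv, hx]; group
  | mem y hy =>
    obtain ⟨k, l, h, r, hk, hl, rfl⟩ := hy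
    rw [torusHom_x, eq_mul_inv_iff_mul_eq, eq_comm]
    by_cases hk0 : k = 0
    · subst hk0
      rw [St.h_mul_x_left h hn (Ne.symm hl)]
      simp [torusEntry, Ne.symm h]
    by_cases hl0 : l = 0
    · subst hl0
      rw [St.h_mul_x_right h hn hk]
      simp [torusEntry, h]
    · have c1 : ∀ s, Commute (St.x 0 n hn s) (St.x k l h r) := fun s =>
        St.x_commute hn h (Ne.symm hk) (Ne.symm hl0) s r
      have c2 : ∀ s, Commute (St.x n 0 hn.symm s) (St.x k l h r) := fun s =>
        St.x_commute hn.symm h (Ne.symm hk0) (Ne.symm hl) s r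
      have c3 : Commute (St.h 0 n hn a) (St.x k l h r) :=
        (((c1 _).mul_left (c2 _)).mul_left (c1 _)).mul_left
          (((c1 _).mul_left (c2 _)).mul_left (c1 _))
      rw [c3.eq]
      simp [torusEntry, hk0, hl0]

theorem torusHom_of_mem_K2 (a : Kˣ) {x : St K} (hx : x ∈ K2 K) : torusHom a x = x := by
  obtain ⟨N, hN⟩ := St.exists_bound x
  rw [torusHom_eq_conj (Nat.succ_ne_zero N).symm a (hN _ (Nat.le_succ N)),
    Subgroup.mem_center_iff.1 (K2_le_center hx), mul_inv_cancel_right]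

theorem GL2hat.isCentral : IsCentral (GL2hat.extension K) := by
  rintro _ ⟨k, rfl⟩
  rw [Subgroup.mem_center_iff]
  intro g
  refine SemidirectProduct.ext (Subtype.ext (Prod.ext ?_ ?_)) ?_
  · change g.left.1.1 * torusHom g.right k.1 = k.1 * torusHom 1 g.left.1.1
    rw [torusHom_of_mem_K2 _ k.2, torusHom_one]
    exact Subgroup.mem_center_iff.1 (K2_le_center k.2) _
  · change g.left.1.2 * (upperLeft K g.right * 1 * (upperLeft K g.right)⁻¹)
      = 1 * (upperLeft K 1 * g.left.1.2 * (upperLeft K 1)⁻¹)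
    simp
  · change g.right * 1 = 1 * g.right
    rw [one_mul, mul_one]

theorem GL2hat.splitsOver_upperLeft : SplitsOver (GL2hat.extension K) (upperLeft K).range := by
  have inj : Function.Injective (upperLeft K) := fun a b h => by
    rw [← det_upperLeft a, h, det_upperLeft]
  refine ⟨(SemidirectProduct.inr : Kˣ →* GL2hat K).comp
    (MonoidHom.ofInjective inj).symm.toMonoidHom, ?_⟩
  rintro ⟨_, a, rfl⟩
  have : (MonoidHom.ofInjective inj).symm ⟨upperLeft K a, a, rfl⟩ = a := by
    rw [MulEquiv.symm_apply_eq]; rfl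
  change GL2hat.proj K (SemidirectProduct.inr ((MonoidHom.ofInjective inj).symm _)) = _
  rw [this, GL2hat.proj_apply]
  simp

/-- The lift of `diag(v, v⁻¹)` to the pullback given by `h₀₁(v)`. -/
def hTilde (v : Kˣ) : SL2tilde K :=
  ⟨(St.h 0 1 (by decide) v, upperLeft K v * (lowerRight K v)⁻¹), by
    constructor
    · ext
      simp [coe_upperLeft, coe_lowerRight]
    · ext1
      have : ((upperLeft K v * (lowerRight K v)⁻¹ : GL (Fin 2) K) : Matrix (Fin 2) (Fin 2) K)
          = !![(v : K), 0; 0, ((v⁻¹ : Kˣ) : K)] := by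
        rw [← map_inv, Units.val_mul, coe_upperLeft, coe_lowerRight]
        ext i j; fin_cases i <;> fin_cases j <;> simp
      rw [St.toSL_h]
      change _ = stabMat K ((upperLeft K v * (lowerRight K v)⁻¹ : GL (Fin 2) K) :
        Matrix (Fin 2) (Fin 2) K)
      rw [this]
      simp [stabMat, corner, Fin.sum_univ_two, sub_eq_add_neg, entry_add, entry_neg]
      abel⟩

/-- The lift of diag(1, v) is taken to be h₀₁(v)⁻¹ times the lift of diag(v, 1). The torus lifts
commute with each other, so only the action of u on h₀₁(v) contributes, and this is the symbol (v,
u), with the arguments exchanged. -/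
theorem GL2hat.diag_commutator (u v : Kˣ) : ∃ x y : GL2hat K,
    (GL2hat.extension K).rightHom x = upperLeft K u ∧
    (GL2hat.extension K).rightHom y = lowerRight K v ∧
    ⁅x, y⁆ = (GL2hat.extension K).inl (symbol v u) := by
  refine ⟨SemidirectProduct.inr u,
    (SemidirectProduct.inl (hTilde v))⁻¹ * SemidirectProduct.inr v, ?_, ?_, ?_⟩
  · change GL2hat.proj K _ = _
    rw [GL2hat.proj_apply]; simp
  · change GL2hat.proj K _ = _
    rw [map_mul, map_inv, GL2hat.proj_apply, GL2hat.proj_apply]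
    simp [hTilde]
  · have e : ⁅(SemidirectProduct.inr u : GL2hat K),
        ((SemidirectProduct.inl (hTilde v))⁻¹ * SemidirectProduct.inr v : GL2hat K)⁆
        = SemidirectProduct.inl ((tildeAct K u (hTilde v))⁻¹ * hTilde v) := by
      have h1 : (SemidirectProduct.inr v : GL2hat K) * (SemidirectProduct.inr u)⁻¹
          = (SemidirectProduct.inr u)⁻¹ * SemidirectProduct.inr v := by
        rw [← map_inv, ← map_mul, ← map_mul, mul_comm]
      rw [commutatorElement_def, map_mul, map_inv, SemidirectProduct.inl_aut, _root_.mul_inv_rev,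
        inv_inv]
      simp only [mul_assoc, _root_.mul_inv_rev, inv_inv]
      rw [← mul_assoc (SemidirectProduct.inr v) (SemidirectProduct.inr u)⁻¹, h1]
      simp [mul_assoc]
    rw [e]
    change _ = SemidirectProduct.inl _
    congr 1
    refine Subtype.ext (Prod.ext ?_ ?_)
    · change (torusHom u (St.h 0 1 _ v))⁻¹ * St.h 0 1 _ v = (symbol v u : K2 K).1
      have h2 := Subgroup.mem_center_iff.1 (K2_le_center (symbol v u).2) (St.h 0 1 (by decide) v)⁻¹
      rw [coe_symbol, inv_mul_cancel_left] at h2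
      rw [h2, coe_symbol]
      group
    · change (upperLeft K u * (upperLeft K v * (lowerRight K v)⁻¹) * (upperLeft K u)⁻¹)⁻¹
        * (upperLeft K v * (lowerRight K v)⁻¹) = 1
      rw [inv_mul_eq_one, mul_inv_eq_iff_eq_mul, ← mul_assoc, ← map_mul, mul_comm, map_mul,
        mul_assoc, mul_assoc, (diag_comm u v).inv_right.eq]

end HatCommutator

end TwoDim
end

noncomputable section

namespace TwoDim

open scoped Pointwise

/-! ### Relative indices -/

section LogIndex

variable {V : Type*} [AddCommGroup V]

open AddSubgroup

/-- The logarithm of the generalized index `[A : A']` of two subgroups. -/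
def logIndex (A A' : AddSubgroup V) : ℝ := Real.log (A'.relIndex A) - Real.log (A.relIndex A')

theorem logIndex_self (A : AddSubgroup V) : logIndex A A = 0 := sub_self _

theorem log_relIndex_mul {C B A : AddSubgroup V} (h : C ≤ B) (h' : B ≤ A) (h0 : C.relIndex A ≠ 0) :
    Real.log (C.relIndex A) = Real.log (C.relIndex B) + Real.log (B.relIndex A) := by
  have h1 := relIndex_mul_relIndex C B A h h'
  have h2 : C.relIndex B ≠ 0 ∧ B.relIndex A ≠ 0 := by
    rw [← h1] at h0; exact mul_ne_zero_iff.1 h0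
  rw [← h1, Nat.cast_mul, Real.log_mul (by exact_mod_cast h2.1) (by exact_mod_cast h2.2)]

/-- Any common subgroup of finite index may replace A ⊓ A': the index of C in A ⊓ A' cancels. -/
theorem logIndex_eq {A A' C : AddSubgroup V} (hA : C ≤ A) (hA' : C ≤ A') (h : C.relIndex A ≠ 0)
    (h' : C.relIndex A' ≠ 0) :
    logIndex A A' = Real.log (C.relIndex A) - Real.log (C.relIndex A') := by
  have e1 := log_relIndex_mul (le_inf hA hA') (inf_le_left : A ⊓ A' ≤ A) h
  have e2 := log_relIndex_mul (le_inf hA hA') (inf_le_right : A ⊓ A' ≤ A') h'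
  rw [inf_relIndex_left] at e1
  rw [inf_relIndex_right] at e2
  rw [logIndex, e1, e2]; ring

theorem logIndex_of_le {A C : AddSubgroup V} (hA : C ≤ A) :
    logIndex A C = Real.log (C.relIndex A) := by
  rw [logIndex, relIndex_eq_one.2 hA]; simp

theorem logIndex_symm (A A' : AddSubgroup V) : logIndex A' A = -logIndex A A' := by
  rw [logIndex, logIndex]; ring

theorem logIndex_trans {A A' A'' : AddSubgroup V} (h : Commensurable A A')
    (h' : Commensurable A' A'') : logIndex A A'' = logIndex A A' + logIndex A' A'' := by
  have h'' := h.trans h'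
  set C := A ⊓ A' ⊓ A''
  have c1 : C ≤ A := inf_le_left.trans inf_le_left
  have c2 : C ≤ A' := inf_le_left.trans inf_le_right
  have c3 : C ≤ A'' := inf_le_right
  have i1 : C.relIndex A ≠ 0 :=
    relIndex_inf_ne_zero (relIndex_inf_ne_zero (by rw [relIndex_self]; exact one_ne_zero) h.2) h''.2
  have i2 : C.relIndex A' ≠ 0 :=
    relIndex_inf_ne_zero (relIndex_inf_ne_zero h.1 (by rw [relIndex_self]; exact one_ne_zero)) h'.2
  have i3 : C.relIndex A'' ≠ 0 :=
    relIndex_inf_ne_zero (relIndex_inf_ne_zero h''.1 h'.1) (by rw [relIndex_self]; exact one_ne_zero)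
  rw [logIndex_eq c1 c3 i1 i3, logIndex_eq c1 c2 i1 i2, logIndex_eq c2 c3 i2 i3]; ring

/-- Between C and A lies A ⊓ (C ⊔ L). By the modular law, the upper step is the index modulo L and
the lower step is the index inside L. -/
theorem relIndex_split {A C : AddSubgroup V} (h : C ≤ A) (L : AddSubgroup V) :
    C.relIndex A = (C ⊔ L).relIndex (A ⊔ L) * (C ⊓ L).relIndex (A ⊓ L) := by
  have e1 : (C ⊔ L).relIndex (A ⊔ L) = (A ⊓ (C ⊔ L)).relIndex A := by
    have : A ⊔ L = A ⊔ (C ⊔ L) := by rw [← sup_assoc, sup_eq_left.2 h]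
    rw [this, relIndex_sup_right, inf_relIndex_left]
  have e2 : (C ⊓ L).relIndex (A ⊓ L) = C.relIndex (A ⊓ (C ⊔ L)) := by
    have h1 : A ⊓ (C ⊔ L) = A ⊓ L ⊔ C := by
      rw [inf_comm, sup_inf_assoc_of_le _ h, inf_comm L, sup_comm]
    have h2 : C ⊓ L = C ⊓ (A ⊓ L) := by rw [← inf_assoc, inf_eq_left.2 h]
    rw [h1, relIndex_sup_right, h2, inf_relIndex_right]
  rw [e1, e2, mul_comm, relIndex_mul_relIndex _ _ _ (le_inf h le_sup_left) inf_le_left]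

theorem commensurable_of_le {A C : AddSubgroup V} (h : C ≤ A) (h' : C.relIndex A ≠ 0) :
    Commensurable A C := ⟨by rw [relIndex_eq_one.2 h]; exact one_ne_zero, h'⟩

theorem logIndex_split_of_le {A C : AddSubgroup V} (h : C ≤ A) (h' : C.relIndex A ≠ 0)
    (L : AddSubgroup V) :
    logIndex A C = logIndex (A ⊔ L) (C ⊔ L) + logIndex (A ⊓ L) (C ⊓ L) ∧
    Commensurable (A ⊔ L) (C ⊔ L) ∧ Commensurable (A ⊓ L) (C ⊓ L) := by
  have e := relIndex_split h L
  have h2 : (C ⊔ L).relIndex (A ⊔ L) ≠ 0 ∧ (C ⊓ L).relIndex (A ⊓ L) ≠ 0 := by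
    rw [e] at h'; exact mul_ne_zero_iff.1 h'
  refine ⟨?_, commensurable_of_le (sup_le_sup_right h _) h2.1,
    commensurable_of_le (inf_le_inf_right _ h) h2.2⟩
  rw [logIndex_of_le h, logIndex_of_le (sup_le_sup_right h L), logIndex_of_le (inf_le_inf_right L h),
    e, Nat.cast_mul, Real.log_mul (by exact_mod_cast h2.1) (by exact_mod_cast h2.2)]

/-- The case of an inclusion is applied twice, through A ⊓ A'. -/
theorem logIndex_split {A A' : AddSubgroup V} (h : Commensurable A A') (L : AddSubgroup V) :
    logIndex A A' = logIndex (A ⊔ L) (A' ⊔ L) + logIndex (A ⊓ L) (A' ⊓ L) ∧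
    Commensurable (A ⊔ L) (A' ⊔ L) ∧ Commensurable (A ⊓ L) (A' ⊓ L) := by
  have h1 : (A ⊓ A').relIndex A ≠ 0 := by rw [inf_relIndex_left]; exact h.2
  have h2 : (A ⊓ A').relIndex A' ≠ 0 := by rw [inf_relIndex_right]; exact h.1
  obtain ⟨e1, s1, t1⟩ := logIndex_split_of_le inf_le_left h1 L
  obtain ⟨e2, s2, t2⟩ := logIndex_split_of_le inf_le_right h2 L
  refine ⟨?_, s1.trans s2.symm, t1.trans t2.symm⟩
  rw [logIndex_trans s1 s2.symm, logIndex_trans t1 t2.symm,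
    logIndex_trans (commensurable_of_le inf_le_left h1) (commensurable_of_le inf_le_right h2).symm,
    e1, logIndex_symm A', logIndex_symm (A' ⊔ L), logIndex_symm (A' ⊓ L), e2]
  ring

variable {G : Type*} [Group G] [DistribMulAction G V]

theorem logIndex_smul (g : G) (A A' : AddSubgroup V) : logIndex (g • A) (g • A') = logIndex A A' := by
  rw [logIndex, relIndex_pointwise_smul, relIndex_pointwise_smul]; rfl

theorem commensurable_smul (g : G) {A A' : AddSubgroup V} (h : Commensurable A A') :
    Commensurable (g • A) (g • A') := by
  rwa [Commensurable, relIndex_pointwise_smul, relIndex_pointwise_smul]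

theorem addSubgroup_smul_sup (g : G) (S T : AddSubgroup V) : g • (S ⊔ T) = g • S ⊔ g • T :=
  map_sup _ _ _

theorem addSubgroup_smul_inf (g : G) (S T : AddSubgroup V) : g • (S ⊓ T) = g • S ⊓ g • T := by
  ext x; simp [mem_pointwise_smul_iff_inv_smul_mem]

end LogIndex

/-! ### The index pairing -/

section IndexPairing

variable {V : Type*} [AddCommGroup V]

open AddSubgroup

/-- The trace of `W` on `L`, modulo `M`. -/
def latticeTrace (L M W : AddSubgroup V) : AddSubgroup V := L ⊓ W ⊔ M

theorem latticeTrace_sup {L M N : AddSubgroup V} (h : N ≤ M) (W : AddSubgroup V) :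
    latticeTrace L N W ⊔ M = latticeTrace L M W := by
  rw [latticeTrace, latticeTrace, sup_assoc, sup_eq_right.2 h]

theorem latticeTrace_inf {L M N : AddSubgroup V} (h : N ≤ M) (h' : M ≤ L) (W : AddSubgroup V) :
    latticeTrace L N W ⊓ M = latticeTrace M N W := by
  rw [latticeTrace, latticeTrace, sup_comm, sup_inf_assoc_of_le _ h, sup_comm, inf_right_comm,
    inf_eq_right.2 h']

/-- The subgroups `W`, `W'` are commensurable modulo the lattices in the class `Λ`. -/
def LatticeEquiv (Λ : AddSubgroup V → Prop) (W W' : AddSubgroup V) : Prop :=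
  ∀ L M, Λ L → Λ M → M ≤ L → Commensurable (latticeTrace L M W) (latticeTrace L M W')

theorem LatticeEquiv.symm {Λ : AddSubgroup V → Prop} {W W' : AddSubgroup V}
    (h : LatticeEquiv Λ W W') : LatticeEquiv Λ W' W := fun L M hL hM hLM => (h L M hL hM hLM).symm

theorem LatticeEquiv.trans {Λ : AddSubgroup V → Prop} {W W' W'' : AddSubgroup V}
    (h : LatticeEquiv Λ W W') (h' : LatticeEquiv Λ W' W'') : LatticeEquiv Λ W W'' :=
  fun L M hL hM hLM => (h L M hL hM hLM).trans (h' L M hL hM hLM)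

/-- The index of `W` relative to `W'` on the pair of lattices `M ≤ L`. -/
def latticeIndex (L M W W' : AddSubgroup V) : ℝ :=
  logIndex (latticeTrace L M W) (latticeTrace L M W')

/-- This is `logIndex_split` along M: the joins with M compute the index on L/M, and the meets with
M the index on M/N. -/
theorem latticeIndex_add {Λ : AddSubgroup V → Prop} {L M N W W' : AddSubgroup V}
    (hW : LatticeEquiv Λ W W') (hL : Λ L) (hN : Λ N) (h : N ≤ M) (h' : M ≤ L) :
    latticeIndex L N W W' = latticeIndex L M W W' + latticeIndex M N W W' := by
  have := (logIndex_split (hW L N hL hN (h.trans h')) M).1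
  rwa [latticeTrace_sup h, latticeTrace_sup h, latticeTrace_inf h h', latticeTrace_inf h h'] at this

/-- The pairing of two pairs `(L, L')`, `(W, W')`. -/
def indexPairing (L L' W W' : AddSubgroup V) : ℝ :=
  latticeIndex L (L ⊓ L') W W' - latticeIndex L' (L ⊓ L') W W'

variable {Λ : AddSubgroup V → Prop} {L L' L'' W W' W'' : AddSubgroup V}

/-- The meet of the two lattices in the definition may be replaced by any smaller lattice, because
its own contribution over N cancels in the difference. -/
theorem indexPairing_eq {N : AddSubgroup V} (hW : LatticeEquiv Λ W W') (hL : Λ L) (hL' : Λ L')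
    (hN : Λ N) (h : N ≤ L) (h' : N ≤ L') :
    indexPairing L L' W W' = latticeIndex L N W W' - latticeIndex L' N W W' := by
  rw [indexPairing, latticeIndex_add hW hL hN (le_inf h h') inf_le_left,
    latticeIndex_add hW hL' hN (le_inf h h') inf_le_right]
  ring

theorem indexPairing_trans_left (hΛ : ∀ L L', Λ L → Λ L' → Λ (L ⊓ L'))
    (hW : LatticeEquiv Λ W W') (hL : Λ L) (hL' : Λ L')
    (hL'' : Λ L'') :
    indexPairing L L'' W W' = indexPairing L L' W W' + indexPairing L' L'' W W' := by
  have hN := hΛ _ _ (hΛ _ _ hL hL') hL''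
  have h1 : L ⊓ L' ⊓ L'' ≤ L := inf_le_left.trans inf_le_left
  have h2 : L ⊓ L' ⊓ L'' ≤ L' := inf_le_left.trans inf_le_right
  have h3 : L ⊓ L' ⊓ L'' ≤ L'' := inf_le_right
  rw [indexPairing_eq hW hL hL'' hN h1 h3, indexPairing_eq hW hL hL' hN h1 h2,
    indexPairing_eq hW hL' hL'' hN h2 h3]
  ring

theorem indexPairing_trans_right (hΛ : ∀ L L', Λ L → Λ L' → Λ (L ⊓ L'))
    (hW : LatticeEquiv Λ W W') (hW' : LatticeEquiv Λ W' W'')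
    (hL : Λ L) (hL' : Λ L') :
    indexPairing L L' W W'' = indexPairing L L' W W' + indexPairing L L' W' W'' := by
  have hN := hΛ _ _ hL hL'
  simp only [indexPairing, latticeIndex]
  rw [logIndex_trans (hW _ _ hL hN inf_le_left) (hW' _ _ hL hN inf_le_left),
    logIndex_trans (hW _ _ hL' hN inf_le_right) (hW' _ _ hL' hN inf_le_right)]
  ring

theorem indexPairing_self_left (L W W' : AddSubgroup V) : indexPairing L L W W' = 0 := sub_self _

theorem indexPairing_self_right (L L' W : AddSubgroup V) : indexPairing L L' W W = 0 := by
  simp [indexPairing, latticeIndex, logIndex_self]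

variable {G : Type*} [Group G] [DistribMulAction G V]

theorem latticeTrace_smul (g : G) (L M W : AddSubgroup V) :
    latticeTrace (g • L) (g • M) (g • W) = g • latticeTrace L M W := by
  rw [latticeTrace, latticeTrace, addSubgroup_smul_sup, addSubgroup_smul_inf]

theorem indexPairing_smul (g : G) (L L' W W' : AddSubgroup V) :
    indexPairing (g • L) (g • L') (g • W) (g • W') = indexPairing L L' W W' := by
  simp only [indexPairing, latticeIndex, ← addSubgroup_smul_inf, latticeTrace_smul, logIndex_smul]

/-- An automorphism that is trivial modulo `M` does not change traces. -/
theorem latticeTrace_smul_of_trivial (s : G) {L M : AddSubgroup V} (hML : M ≤ L)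
    (h : ∀ v ∈ L, s • v - v ∈ M) (h' : ∀ v ∈ L, s⁻¹ • v - v ∈ M) (W : AddSubgroup V) :
    latticeTrace L M (s • W) = latticeTrace L M W := by
  have key : ∀ (s : G) (W : AddSubgroup V), (∀ v ∈ L, s⁻¹ • v - v ∈ M) →
      L ⊓ s • W ≤ latticeTrace L M W := by
    intro s W h' v hv
    have h1 : s⁻¹ • v ∈ W := mem_pointwise_smul_iff_inv_smul_mem.1 hv.2
    have h2 := h' v hv.1
    have h3 : s⁻¹ • v ∈ L := by
      have := L.add_mem (hML h2) hv.1
      rwa [sub_add_cancel] at this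
    rw [latticeTrace, mem_sup]
    exact ⟨s⁻¹ • v, ⟨h3, h1⟩, -(s⁻¹ • v - v), M.neg_mem h2, by abel⟩
  refine le_antisymm (sup_le (key s W h') le_sup_right) (sup_le ?_ le_sup_right)
  have := key s⁻¹ (s • W) (by rwa [inv_inv])
  rwa [inv_smul_smul] at this

end IndexPairing

/-! ### Central extensions by `ℝ` defined by normalized cocycles -/

section CocycleExtension

open scoped commutatorElement

/-- A normalized `2`-cocycle with values in the trivial module `ℝ`. -/
structure NormCocycle (G : Type*) [Group G] where
  toFun : G → G → ℝ
  cocycle : ∀ g h k, toFun (g * h) k + toFun g h = toFun g (h * k) + toFun h k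
  one_left : ∀ g, toFun 1 g = 0
  one_right : ∀ g, toFun g 1 = 0

namespace NormCocycle

variable {G H : Type*} [Group G] [Group H]

instance : CoeFun (NormCocycle G) fun _ => G → G → ℝ := ⟨toFun⟩

/-- The pullback of a cocycle. -/
def comap (c : NormCocycle G) (f : H →* G) : NormCocycle H where
  toFun g h := c (f g) (f h)
  cocycle g h k := by rw [map_mul, map_mul, c.cocycle]
  one_left g := by rw [map_one, c.one_left]
  one_right g := by rw [map_one, c.one_right]

/-- The difference of two cocycles. -/
def diff (c c' : NormCocycle G) : NormCocycle G where
  toFun g h := c g h - c' g h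
  cocycle g h k := by linarith [c.cocycle g h k, c'.cocycle g h k]
  one_left g := by rw [c.one_left, c'.one_left, sub_self]
  one_right g := by rw [c.one_right, c'.one_right, sub_self]

/-- The central extension defined by a cocycle. -/
@[ext] structure Ext (c : NormCocycle G) where
  base : G
  fib : ℝ

variable (c : NormCocycle G)

instance : Mul c.Ext := ⟨fun x y => ⟨x.base * y.base, x.fib + y.fib + c x.base y.base⟩⟩
instance : One c.Ext := ⟨⟨1, 0⟩⟩
instance : Inv c.Ext := ⟨fun x => ⟨x.base⁻¹, -x.fib - c x.base⁻¹ x.base⟩⟩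

variable {c}

@[simp] theorem mul_base (x y : c.Ext) : (x * y).base = x.base * y.base := rfl
@[simp] theorem mul_fib (x y : c.Ext) : (x * y).fib = x.fib + y.fib + c x.base y.base := rfl
@[simp] theorem one_base : (1 : c.Ext).base = 1 := rfl
@[simp] theorem one_fib : (1 : c.Ext).fib = 0 := rfl
@[simp] theorem inv_base (x : c.Ext) : (x⁻¹).base = x.base⁻¹ := rfl
@[simp] theorem inv_fib (x : c.Ext) : (x⁻¹).fib = -x.fib - c x.base⁻¹ x.base := rfl

instance : Group c.Ext := Group.ofLeftAxioms
  (fun x y z => Ext.ext (mul_assoc _ _ _) (by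
    simp only [mul_fib, mul_base]; linarith [c.cocycle x.base y.base z.base]))
  (fun x => Ext.ext (one_mul _) (by simp [c.one_left]))
  (fun x => Ext.ext (inv_mul_cancel _) (by simp only [mul_fib, inv_fib, inv_base, one_fib]; ring))

variable (c)

/-- The projection of the extension to the base. -/
def proj : c.Ext →* G where
  toFun := Ext.base
  map_one' := rfl
  map_mul' _ _ := rfl

/-- The inclusion of the kernel. -/
def incl : Multiplicative ℝ →* c.Ext where
  toFun z := ⟨1, z.toAdd⟩
  map_one' := rfl
  map_mul' z w := Ext.ext (by simp) (by simp [c.one_left])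

@[simp] theorem proj_apply (x : c.Ext) : c.proj x = x.base := rfl

theorem proj_surjective : Function.Surjective c.proj := fun g => ⟨⟨g, 0⟩, rfl⟩

theorem mem_range_incl {x : c.Ext} : x ∈ c.incl.range ↔ x.base = 1 := by
  constructor
  · rintro ⟨z, rfl⟩; rfl
  · intro h
    exact ⟨Multiplicative.ofAdd x.fib, Ext.ext h.symm rfl⟩

theorem ker_proj_le : c.proj.ker ≤ Subgroup.center c.Ext := by
  intro x hx
  have hx : x.base = 1 := hx
  rw [Subgroup.mem_center_iff]
  intro g
  ext
  · simp [hx]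
  · simp [hx, c.one_left, c.one_right, add_comm]

/-- The group extension defined by a cocycle. -/
def extension : GroupExtension (Multiplicative ℝ) c.Ext G where
  inl := c.incl
  rightHom := c.proj
  inl_injective z w h := congrArg Ext.fib h
  range_inl_eq_ker_rightHom := by
    ext x; rw [mem_range_incl]; rfl
  rightHom_surjective := c.proj_surjective

theorem isCentral_extension : IsCentral c.extension := by
  rintro _ ⟨z, rfl⟩
  exact c.ker_proj_le rfl

theorem commutator_eq {x y : c.Ext} (h : Commute x.base y.base) :
    ⁅x, y⁆ = c.incl (Multiplicative.ofAdd (c x.base y.base - c y.base x.base)) := by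
  rw [commutatorElement_def, mul_inv_eq_iff_eq_mul, mul_inv_eq_iff_eq_mul]
  ext
  · simp [incl, h.eq]
  · simp [incl, c.one_left]; ring

theorem splitsOver_extension {U : Subgroup G} (hU : ∀ g ∈ U, ∀ h ∈ U, c g h = 0) :
    SplitsOver c.extension U :=
  ⟨{ toFun := fun g => ⟨g.1, 0⟩
     map_one' := rfl
     map_mul' := fun g h => Ext.ext rfl (by simp [hU g.1 g.2 h.1 h.2]) }, fun g => rfl⟩

end NormCocycle

end CocycleExtension

end TwoDim
end

noncomputable section

namespace TwoDim

open scoped Pointwise commutatorElement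
open AddSubgroup

/-! ### Two-dimensional local fields, axiomatically -/

/-- The properties of a two-dimensional local field `K` with ring of integers `O`, subring `B`,
number `q` of elements of the last residue field and pairing `ν` that are used below: `t`, `u` are
local parameters. -/
structure LocalDatum {K : Type*} [Field K] (O B : Subring K) (q : ℕ) (ν : Kˣ → Kˣ → ℤ) where
  t : Kˣ
  u : Kˣ
  t_mem : (t : K) ∈ O
  t_mem_B : (t : K) ∈ B
  t_inv_mem_B : ((t⁻¹ : Kˣ) : K) ∈ B
  u_mem : (u : K) ∈ O
  u_inv_mem : ((u⁻¹ : Kˣ) : K) ∈ O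
  u_mem_B : (u : K) ∈ B
  one_sub_u : ∃ y ∈ O, ((u : K) - 1) * y = 1
  one_add : ∀ x ∈ O, ∃ y ∈ O, (1 + t * x) * y = 1
  decomp : ∀ x : Kˣ, ∃ (i k : ℤ) (r m : Kˣ), ((r : K) ∈ O ∧ ((r⁻¹ : Kˣ) : K) ∈ O) ∧
    ((r : K) ∈ B ∧ ((r⁻¹ : Kˣ) : K) ∈ B) ∧ (∃ y ∈ O, (m : K) = 1 + t * y) ∧
    x = t ^ i * u ^ k * r * m
  nu_eq : ∀ (i k i' k' : ℤ) (r m r' m' : Kˣ), ((r : K) ∈ O ∧ ((r⁻¹ : Kˣ) : K) ∈ O) →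
    ((r : K) ∈ B ∧ ((r⁻¹ : Kˣ) : K) ∈ B) → ((r' : K) ∈ O ∧ ((r'⁻¹ : Kˣ) : K) ∈ O) →
    ((r' : K) ∈ B ∧ ((r'⁻¹ : Kˣ) : K) ∈ B) → (∃ y ∈ O, (m : K) = 1 + t * y) →
    (∃ y ∈ O, (m' : K) = 1 + t * y) →
    ν (t ^ i * u ^ k * r * m) (t ^ i' * u ^ k' * r' * m') = k * i' - i * k'
  one_lt_q : 1 < q
  relIndex_eq : ∀ J : AddSubgroup K, (∀ x, x ∈ J ↔ ∃ a ∈ O ⊓ B, ∃ b ∈ O ⊓ B, x = t * a + u * b) →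
    J.relIndex (O ⊓ B).toAddSubgroup = q

/-- The units of `K` that are units of the subring `R`. -/
def IsUnitOf {K : Type*} [Field K] (R : Subring K) (x : Kˣ) : Prop :=
  (x : K) ∈ R ∧ ((x⁻¹ : Kˣ) : K) ∈ R

namespace LocalDatum

variable {K : Type*} [Field K] {O B : Subring K} {q : ℕ} {ν : Kˣ → Kˣ → ℤ}

theorem isUnitOf_t (D : LocalDatum O B q ν) : IsUnitOf B D.t := ⟨D.t_mem_B, D.t_inv_mem_B⟩

theorem isUnitOf_u (D : LocalDatum O B q ν) : IsUnitOf O D.u := ⟨D.u_mem, D.u_inv_mem⟩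

theorem isUnitOf_one_add (D : LocalDatum O B q ν) {m : Kˣ} (hm : ∃ y ∈ O, (m : K) = 1 + D.t * y) :
    IsUnitOf O m := by
  obtain ⟨y, hy, h⟩ := hm
  refine ⟨by rw [h]; exact O.add_mem O.one_mem (O.mul_mem D.t_mem hy), ?_⟩
  obtain ⟨z, hz, h'⟩ := D.one_add y hy
  rw [← h] at h'
  rwa [Units.val_inv_eq_inv_val, ← eq_inv_of_mul_eq_one_right h']

theorem one_add_inv (D : LocalDatum O B q ν) {m : Kˣ} (hm : ∃ y ∈ O, (m : K) = 1 + D.t * y) :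
    ∃ y ∈ O, ((m⁻¹ : Kˣ) : K) = 1 + D.t * y := by
  have h1 := (D.isUnitOf_one_add hm).2
  obtain ⟨y, hy, h⟩ := hm
  refine ⟨-(y * (m⁻¹ : Kˣ)), O.neg_mem (O.mul_mem hy h1), ?_⟩
  have : (m : K) * (m⁻¹ : Kˣ) = 1 := Units.mul_inv m
  rw [h] at this
  linear_combination this

/-- The powers of t are distinct, since ν(tⁿ, u) = -n. -/
theorem infinite (D : LocalDatum O B q ν) : Infinite K := by
  have h1 : ν (D.t ^ (1 : ℤ) * D.u ^ (0 : ℤ) * 1 * 1) (D.t ^ (0 : ℤ) * D.u ^ (1 : ℤ) * 1 * 1) = _ :=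
    D.nu_eq 1 0 0 1 1 1 1 1 (by simp [O.one_mem]) (by simp [B.one_mem]) (by simp [O.one_mem])
      (by simp [B.one_mem]) ⟨0, O.zero_mem, by simp⟩ ⟨0, O.zero_mem, by simp⟩
  have hinj : Function.Injective fun n : ℤ => D.t ^ n := by
    intro n n' h
    have h1 := D.nu_eq n 0 0 1 1 1 1 1 (by simp [O.one_mem]) (by simp [B.one_mem])
      (by simp [O.one_mem]) (by simp [B.one_mem]) ⟨0, O.zero_mem, by simp⟩
      ⟨0, O.zero_mem, by simp⟩
    have h2 := D.nu_eq n' 0 0 1 1 1 1 1 (by simp [O.one_mem]) (by simp [B.one_mem])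
      (by simp [O.one_mem]) (by simp [B.one_mem]) ⟨0, O.zero_mem, by simp⟩
      ⟨0, O.zero_mem, by simp⟩
    simp only at h
    rw [h, h2] at h1
    linarith
  have : Infinite Kˣ := Infinite.of_injective _ hinj
  exact Infinite.of_injective (fun x : Kˣ => (x : K)) Units.val_injective

/-- A skew-symmetric bimultiplicative pairing that is trivial on `O^*`, on `B^*` and on
`(t, 1 + tO)` is a power of `ν`. -/
theorem pairing_eq {A : Type*} [CommGroup A] (D : LocalDatum O B q ν) {c : Kˣ → Kˣ → A}
    (hl : ∀ x x' y, c (x * x') y = c x y * c x' y) (hs : ∀ x y, c y x = (c x y)⁻¹)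
    (hO : ∀ x y, IsUnitOf O x → IsUnitOf O y → c x y = 1)
    (hB : ∀ x y, IsUnitOf B x → IsUnitOf B y → c x y = 1)
    (hm : ∀ m : Kˣ, (∃ y ∈ O, (m : K) = 1 + D.t * y) → c D.t m = 1) (x y : Kˣ) :
    c x y = c D.t D.u ^ (-ν x y) := by
  let cl : Kˣ → (Kˣ →* A) := fun y => MonoidHom.mk' (fun x => c x y) fun x x' => hl x x' y
  have hcl : ∀ x y, cl y x = c x y := fun _ _ => rfl
  have zl : ∀ (x y) (n : ℤ), c (x ^ n) y = c x y ^ n := fun x y n => by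
    rw [← hcl, map_zpow, hcl]
  have hr : ∀ x y y', c x (y * y') = c x y * c x y' := fun x y y' => by
    rw [hs (y * y') x, hl, mul_inv, ← hs y x, ← hs y' x]
  have zr : ∀ (x y) (n : ℤ), c x (y ^ n) = c x y ^ n := fun x y n => by
    rw [hs (y ^ n) x, zl, ← inv_zpow, ← hs y x]
  -- After expansion in the factors t, u, r, m, all terms except c(t, u) and c(u, t) are trivial:
  -- pairs of factors other than t lie in O^*, the pairs (t, t) and (t, r) lie in B^*, and (t, m) is
  -- excluded by the last hypothesis.
  obtain ⟨i, k, r, m, hr1, hr2, hm1, rfl⟩ := D.decomp x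
  obtain ⟨i', k', r', m', hr1', hr2', hm1', rfl⟩ := D.decomp y
  rw [D.nu_eq i k i' k' r m r' m' hr1 hr2 hr1' hr2' hm1 hm1']
  have hmO := D.isUnitOf_one_add hm1
  have hmO' := D.isUnitOf_one_add hm1'
  have ht := D.isUnitOf_t
  have hu := D.isUnitOf_u
  simp only [hl, hr, zl, zr]
  rw [hB D.t D.t ht ht, hm m' hm1', hB D.t r' ht hr2', hO D.u D.u hu hu, hO D.u r' hu hr1',
    hO D.u m' hu hmO', hB r D.t hr2 ht, hO r D.u hr1 hu, hO r r' hr1 hr1', hO r m' hr1 hmO',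
    hs D.t m, hm m hm1, hO m D.u hmO hu, hO m r' hmO hr1', hO m m' hmO hmO', hs D.t D.u]
  simp only [one_zpow, one_mul, mul_one, inv_one, inv_zpow, ← zpow_neg, ← zpow_mul, ← zpow_add]
  congr 1; ring

/-! ### Approximation and finiteness -/

variable (D : LocalDatum O B q ν)

theorem pow_t_mem (n : ℕ) : (D.t : K) ^ n ∈ O := O.pow_mem D.t_mem n
theorem pow_u_mem (n : ℕ) : (D.u : K) ^ n ∈ O := O.pow_mem D.u_mem n

theorem exists_pow_mul_mem (x : K) : ∃ n : ℕ, (D.t : K) ^ n * x ∈ O := by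
  by_cases hx : x = 0
  · exact ⟨0, by simp [hx, O.zero_mem]⟩
  obtain ⟨i, k, r, m, hr, -, hm, h⟩ := D.decomp (Units.mk0 x hx)
  have hu : ((D.u ^ k : Kˣ) : K) ∈ O := by
    rcases k with k | k
    · simpa using D.pow_u_mem k
    · rw [zpow_negSucc, ← inv_pow, Units.val_pow_eq_pow_val]
      exact O.pow_mem D.u_inv_mem _
  have h' : x = ((D.t ^ i : Kˣ) : K) * (((D.u ^ k : Kˣ) : K) * r * m) := by
    rw [← Units.val_mk0 hx, h]; push_cast; ring
  refine ⟨(-i).toNat, ?_⟩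
  rw [h', ← mul_assoc]
  refine O.mul_mem ?_ (O.mul_mem (O.mul_mem hu hr.1) (D.isUnitOf_one_add hm).1)
  rw [← zpow_natCast, Units.val_zpow_eq_zpow_val, ← zpow_add₀ (Units.ne_zero _)]
  have : ((-i).toNat : ℤ) + i = (((-i).toNat : ℤ) + i).toNat := by omega
  rw [this, zpow_natCast]
  exact D.pow_t_mem _

/-- Up to powers of u, the ring B is t-adically dense in O. In the remainder y = t^i u^k r m, the
leading part t^i u^k r lies in B once a power of u removes a negative k, and y differs from it by an
element of tO times y. Each application gains one power of t. -/
theorem approx_aux (n : ℕ) : ∀ x : K, x ∈ O → ∃ l : ℕ, ∃ b ∈ B, ∃ y ∈ O,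
    (D.u : K) ^ l * x = b + (D.t : K) ^ n * y := by
  induction n with
  | zero => exact fun x hx => ⟨0, 0, B.zero_mem, x, hx, by simp⟩
  | succ n ih =>
    intro x hx
    obtain ⟨l, b, hb, y, hy, h⟩ := ih x hx
    by_cases hy0 : y = 0
    · exact ⟨l, b, hb, 0, O.zero_mem, by rw [h, hy0]; simp⟩
    obtain ⟨i, k, r, m, hr, hrB, hm, h'⟩ := D.decomp (Units.mk0 y hy0)
    obtain ⟨z, hz, hmz⟩ := hm
    have e : y = ((D.t ^ i : Kˣ) : K) * ((D.u ^ k : Kˣ) : K) * r * m := by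
      rw [← Units.val_mk0 hy0, h']; push_cast; ring
    have htn : (D.t : K) ^ n ∈ B := B.pow_mem D.t_mem_B n
    have hun : ∀ n, (D.u : K) ^ n ∈ B := B.pow_mem D.u_mem_B
    have hti : ((D.t ^ i : Kˣ) : K) ∈ B := by
      rcases i with k | k
      · simpa using B.pow_mem D.t_mem_B k
      · rw [zpow_negSucc, ← inv_pow, Units.val_pow_eq_pow_val]
        exact B.pow_mem D.t_inv_mem_B _
    have huk : ∃ l : ℕ, (D.u : K) ^ l * ((D.u ^ k : Kˣ) : K) ∈ B := by
      refine ⟨(-k).toNat, ?_⟩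
      rw [← zpow_natCast, Units.val_zpow_eq_zpow_val, ← zpow_add₀ (Units.ne_zero _)]
      have : ((-k).toNat : ℤ) + k = (((-k).toNat : ℤ) + k).toNat := by omega
      rw [this, zpow_natCast]
      exact B.pow_mem D.u_mem_B _
    obtain ⟨l', hl'⟩ := huk
    have hmi : ((m⁻¹ : Kˣ) : K) ∈ O := (D.isUnitOf_one_add ⟨z, hz, hmz⟩).2
    -- `y = y₀ + t y z m⁻¹` with `y₀ = t^i u^k r`
    have e2 : y = ((D.t ^ i : Kˣ) : K) * ((D.u ^ k : Kˣ) : K) * r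
        + D.t * (y * z * (m⁻¹ : Kˣ)) := by
      have h1 : (m : K) * (m⁻¹ : Kˣ) = 1 := Units.mul_inv m
      have h2 : y * (m⁻¹ : Kˣ) = ((D.t ^ i : Kˣ) : K) * ((D.u ^ k : Kˣ) : K) * r := by
        rw [e]; linear_combination ((D.t ^ i : Kˣ) : K) * ((D.u ^ k : Kˣ) : K) * r * h1
      rw [← h2]
      rw [hmz] at h1
      linear_combination -y * h1
    refine ⟨l' + l, (D.u : K) ^ l' * b + (D.t : K) ^ n * (((D.t ^ i : Kˣ) : K)
      * ((D.u : K) ^ l' * ((D.u ^ k : Kˣ) : K)) * r), B.add_mem (B.mul_mem (hun _) hb)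
        (B.mul_mem htn (B.mul_mem (B.mul_mem hti hl') hrB.1)),
      (D.u : K) ^ l' * (y * z * (m⁻¹ : Kˣ)),
      O.mul_mem (D.pow_u_mem _) (O.mul_mem (O.mul_mem hy hz) hmi), ?_⟩
    rw [pow_add, mul_assoc, h]
    linear_combination (D.u : K) ^ l' * (D.t : K) ^ n * e2

theorem approx (n : ℕ) (x : K) : ∃ l : ℕ, ∃ b ∈ B, ∃ y ∈ O,
    (D.u : K) ^ l * x = b + (D.t : K) ^ n * y := by
  obtain ⟨k, hk⟩ := D.exists_pow_mul_mem x
  obtain ⟨l, b, hb, y, hy, h⟩ := D.approx_aux (n + k) _ hk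
  refine ⟨l, ((D.t⁻¹ : Kˣ) : K) ^ k * b, B.mul_mem (B.pow_mem D.t_inv_mem_B _) hb, y, hy, ?_⟩
  have e : ((D.t⁻¹ : Kˣ) : K) ^ k * (D.t : K) ^ k = 1 := by
    rw [← mul_pow, Units.inv_mul, one_pow]
  linear_combination ((D.t⁻¹ : Kˣ) : K) ^ k * h - (D.u : K) ^ l * x * e + (D.t : K) ^ n * y * e

/-- The subgroup `t^m R + u^l R`, where `R = O ∩ B`. -/
def paramIdeal (m l : ℕ) : AddSubgroup K where
  carrier := {x | ∃ a ∈ O ⊓ B, ∃ b ∈ O ⊓ B, x = (D.t : K) ^ m * a + (D.u : K) ^ l * b}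
  zero_mem' := ⟨0, zero_mem _, 0, zero_mem _, by simp⟩
  add_mem' := by
    rintro x y ⟨a, ha, b, hb, rfl⟩ ⟨a', ha', b', hb', rfl⟩
    exact ⟨a + a', add_mem ha ha', b + b', add_mem hb hb', by ring⟩
  neg_mem' := by
    rintro x ⟨a, ha, b, hb, rfl⟩
    exact ⟨-a, neg_mem ha, -b, neg_mem hb, by ring⟩

theorem paramIdeal_one_one : (D.paramIdeal 1 1).relIndex (O ⊓ B).toAddSubgroup = q :=
  D.relIndex_eq _ fun x => by
    change (∃ a ∈ O ⊓ B, ∃ b ∈ O ⊓ B, x = (D.t : K) ^ 1 * a + (D.u : K) ^ 1 * b) ↔ _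
    simp only [pow_one]

/-- The ideal (t, u) of R = O ∩ B has finite index q and is finitely generated, so all its powers
have finite index; and (t, u)^{m+l} lies in (t^m, u^l). -/
theorem paramIdeal_relIndex_ne_zero (m l : ℕ) :
    (D.paramIdeal m l).relIndex (O ⊓ B).toAddSubgroup ≠ 0 := by
  let R := ↥(O ⊓ B)
  let t' : R := ⟨D.t, D.t_mem, D.t_mem_B⟩
  let u' : R := ⟨D.u, D.u_mem, D.u_mem_B⟩
  have hI : ∀ (m l : ℕ), (Ideal.span {t' ^ m} ⊔ Ideal.span {u' ^ l}).toAddSubgroup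
      = (D.paramIdeal m l).addSubgroupOf (O ⊓ B).toAddSubgroup := by
    intro m l
    ext x
    rw [AddSubgroup.mem_addSubgroupOf]
    change x ∈ Ideal.span {t' ^ m} ⊔ Ideal.span {u' ^ l} ↔ _
    rw [Submodule.mem_sup]
    constructor
    · rintro ⟨a, ha, b, hb, rfl⟩
      rw [Ideal.mem_span_singleton'] at ha hb
      obtain ⟨a, rfl⟩ := ha
      obtain ⟨b, rfl⟩ := hb
      refine ⟨a.1, a.2, b.1, b.2, ?_⟩
      change a.1 * (D.t : K) ^ m + b.1 * (D.u : K) ^ l = _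
      ring
    · rintro ⟨a, ha, b, hb, h⟩
      exact ⟨t' ^ m * ⟨a, ha⟩, Ideal.mul_mem_right _ _ (Ideal.mem_span_singleton_self _),
        u' ^ l * ⟨b, hb⟩, Ideal.mul_mem_right _ _ (Ideal.mem_span_singleton_self _),
        Subtype.ext h.symm⟩
  have h1 : (Ideal.span {t'} ⊔ Ideal.span {u'}).toAddSubgroup.index ≠ 0 := by
    have := hI 1 1
    rw [pow_one, pow_one] at this
    rw [this]
    exact ne_of_eq_of_ne D.paramIdeal_one_one (by have := D.one_lt_q; omega)
  have hfin : Finite (R ⧸ (Ideal.span {t'} ⊔ Ideal.span {u'})) :=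
    haveI : (Ideal.span {t'} ⊔ Ideal.span {u'}).toAddSubgroup.FiniteIndex := ⟨h1⟩
    AddSubgroup.finite_quotient_of_finiteIndex
  have hfin2 := Ideal.finite_quotient_pow (I := Ideal.span {t'} ⊔ Ideal.span {u'})
    (Submodule.FG.sup (Submodule.fg_span_singleton _) (Submodule.fg_span_singleton _)) (m + l)
  have hle : (Ideal.span {t'} ⊔ Ideal.span {u'}) ^ (m + l)
      ≤ Ideal.span {t' ^ m} ⊔ Ideal.span {u' ^ l} := by
    rw [← Ideal.span_singleton_pow, ← Ideal.span_singleton_pow]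
    exact Ideal.sup_pow_add_le_pow_sup_pow
  have h2 : ((Ideal.span {t'} ⊔ Ideal.span {u'}) ^ (m + l)).toAddSubgroup.index ≠ 0 := by
    have : Finite (R ⧸ ((Ideal.span {t'} ⊔ Ideal.span {u'}) ^ (m + l)).toAddSubgroup) := hfin2
    exact AddSubgroup.index_ne_zero_of_finite
  intro h0
  rw [AddSubgroup.relIndex, ← hI] at h0
  have h3 := AddSubgroup.index_dvd_of_le
    (show ((Ideal.span {t'} ⊔ Ideal.span {u'}) ^ (m + l)).toAddSubgroup
      ≤ (Ideal.span {t' ^ m} ⊔ Ideal.span {u' ^ l}).toAddSubgroup from hle)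
  rw [h0, zero_dvd_iff] at h3
  exact h2 h3

end LocalDatum

end TwoDim
end

noncomputable section

namespace TwoDim

open scoped Pointwise
open AddSubgroup

/-! ### Lattices in `K^{(ℕ)}` -/

section StdLattice

variable {K : Type*} [Field K]

instance : SMul (MatInf K)ˣ (AddSubgroup (ℕ →₀ K)) := AddSubgroup.pointwiseMulAction.toSMul

instance : MulAction (MatInf K)ˣ (AddSubgroup (ℕ →₀ K)) := AddSubgroup.pointwiseMulAction

/-- The vectors with all coordinates in `R`. -/
def stdLattice (R : Subring K) : AddSubgroup (ℕ →₀ K) where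
  carrier := {v | ∀ i, v i ∈ R}
  zero_mem' _ := R.zero_mem
  add_mem' hv hw i := R.add_mem (hv i) (hw i)
  neg_mem' hv i := R.neg_mem (hv i)

theorem mem_stdLattice {R : Subring K} {v : ℕ →₀ K} : v ∈ stdLattice R ↔ ∀ i, v i ∈ R := Iff.rfl

theorem single_mem_stdLattice {R : Subring K} (i : ℕ) {r : K} (hr : r ∈ R) :
    Finsupp.single i r ∈ stdLattice R := fun k => by
  rw [Finsupp.single_apply]; split_ifs
  exacts [hr, R.zero_mem]

theorem smul_mem_stdLattice {R : Subring K} {r : K} (hr : r ∈ R) {v : ℕ →₀ K}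
    (hv : v ∈ stdLattice R) : r • v ∈ stdLattice R := fun i => R.mul_mem hr (hv i)

theorem unit_smul_comm (g : (MatInf K)ˣ) (r : K) (v : ℕ →₀ K) : g • (r • v) = r • (g • v) :=
  map_smul (g : MatInf K) r v

theorem diagonal_unit_aux (i : ℕ) (a b : K) :
    (1 + entry i i (a - 1) : MatInf K) * (1 + entry i i (b - 1)) = 1 + entry i i (a * b - 1) := by
  have e : a * b - 1 = (a - 1) + (b - 1) + (a - 1) * (b - 1) := by ring
  rw [e, entry_add, entry_add, ← entry_mul i i i]
  noncomm_ring

variable (K) in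
/-- The diagonal matrix with the entry `a` at the place `i`, and `1` elsewhere. -/
def diagUnit (i : ℕ) : Kˣ →* (MatInf K)ˣ where
  toFun a := ⟨1 + entry i i ((a : K) - 1), 1 + entry i i (((a⁻¹ : Kˣ) : K) - 1),
    by rw [diagonal_unit_aux]; simp, by rw [diagonal_unit_aux]; simp⟩
  map_one' := by ext1; simp
  map_mul' a b := by
    ext1
    change _ = (1 + entry i i ((a : K) - 1) : MatInf K) * (1 + entry i i ((b : K) - 1))
    exact (diagonal_unit_aux i _ _).symm

theorem diagUnit_smul (i : ℕ) (a : Kˣ) (v : ℕ →₀ K) :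
    diagUnit K i a • v = v + Finsupp.single i (((a : K) - 1) * v i) := by
  change (1 + entry i i ((a : K) - 1) : MatInf K) v = _
  simp [entry]

theorem diagUnit_smul_apply (i : ℕ) (a : Kˣ) (v : ℕ →₀ K) (k : ℕ) :
    (diagUnit K i a • v) k = if k = i then a * v k else v k := by
  rw [diagUnit_smul, Finsupp.add_apply, Finsupp.single_apply]
  split_ifs with h h' h'
  · subst h; ring
  · exact absurd h.symm h'
  · exact absurd h'.symm h
  · simp

theorem elemMat_smul (i j : ℕ) (h : i ≠ j) (r : K) (v : ℕ →₀ K) :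
    elemMat i j h r • v = v + Finsupp.single i (r * v j) :=
  elemMat_apply i j h r v

theorem elemMat_inv_smul (i j : ℕ) (h : i ≠ j) (r : K) (v : ℕ →₀ K) :
    (elemMat i j h r)⁻¹ • v = v + Finsupp.single i (-r * v j) := by
  rw [inv_smul_eq_iff, elemMat_smul, Finsupp.add_apply, Finsupp.single_eq_of_ne h.symm]
  simp [add_assoc]

theorem mem_smul_iff {g : (MatInf K)ˣ} {L : AddSubgroup (ℕ →₀ K)} {v : ℕ →₀ K} :
    v ∈ g • L ↔ g⁻¹ • v ∈ L := mem_pointwise_smul_iff_inv_smul_mem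

theorem diagUnit_mem_smul (i : ℕ) (a : Kˣ) (R : Subring K) (v : ℕ →₀ K) :
    v ∈ diagUnit K i a • stdLattice R ↔
      ∀ k, (if k = i then ((a⁻¹ : Kˣ) : K) * v k else v k) ∈ R := by
  rw [mem_smul_iff, ← map_inv, mem_stdLattice]
  simp only [diagUnit_smul_apply]

theorem diagUnit_smul_stdLattice (i : ℕ) {a : Kˣ} {R : Subring K} (ha : IsUnitOf R a) :
    diagUnit K i a • stdLattice R = stdLattice R := by
  ext v
  rw [diagUnit_mem_smul]
  refine forall_congr' fun k => ?_
  split_ifs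
  · refine ⟨fun h => ?_, fun h => R.mul_mem ha.2 h⟩
    have := R.mul_mem ha.1 h
    rwa [Units.mul_inv_cancel_left] at this
  · rfl

end StdLattice

namespace LocalDatum

variable {K : Type*} [Field K] {O B : Subring K} {q : ℕ} {ν : Kˣ → Kˣ → ℤ}
variable (D : LocalDatum O B q ν)

/-- The subgroups commensurable with the standard lattice `O^{(ℕ)}` up to powers of `t`. -/
def IsLat (L : AddSubgroup (ℕ →₀ K)) : Prop :=
  ∃ n : ℕ, (∀ v ∈ stdLattice O, (D.t : K) ^ n • v ∈ L) ∧
    ∀ v ∈ L, (D.t : K) ^ n • v ∈ stdLattice O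

variable {D}

theorem pow_smul_mem {L : AddSubgroup (ℕ →₀ K)} {n m : ℕ} (h : n ≤ m)
    (hL : ∀ v ∈ stdLattice O, (D.t : K) ^ n • v ∈ L) :
    ∀ v ∈ stdLattice O, (D.t : K) ^ m • v ∈ L := fun v hv => by
  obtain ⟨k, rfl⟩ := Nat.exists_eq_add_of_le h
  rw [pow_add, mul_smul]
  exact hL _ (smul_mem_stdLattice (D.pow_t_mem k) hv)

theorem pow_smul_mem_std {L : AddSubgroup (ℕ →₀ K)} {n m : ℕ} (h : n ≤ m)
    (hL : ∀ v ∈ L, (D.t : K) ^ n • v ∈ stdLattice O) :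
    ∀ v ∈ L, (D.t : K) ^ m • v ∈ stdLattice O := fun v hv => by
  obtain ⟨k, rfl⟩ := Nat.exists_eq_add_of_le h
  rw [add_comm, pow_add, mul_smul]
  exact smul_mem_stdLattice (D.pow_t_mem k) (hL v hv)

theorem IsLat.exists_of_le {L : AddSubgroup (ℕ →₀ K)} (hL : D.IsLat L) : ∃ n₀ : ℕ, ∀ n, n₀ ≤ n →
    (∀ v ∈ stdLattice O, (D.t : K) ^ n • v ∈ L) ∧
    ∀ v ∈ L, (D.t : K) ^ n • v ∈ stdLattice O :=
  hL.imp fun _ h _ hn => ⟨pow_smul_mem hn h.1, pow_smul_mem_std hn h.2⟩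

variable (D) in
theorem isLat_std : D.IsLat (stdLattice O) :=
  ⟨0, by simp, by simp⟩

theorem IsLat.inf {L L' : AddSubgroup (ℕ →₀ K)} (hL : D.IsLat L) (hL' : D.IsLat L') :
    D.IsLat (L ⊓ L') := by
  obtain ⟨n, hn⟩ := hL.exists_of_le
  obtain ⟨m, hm⟩ := hL'.exists_of_le
  refine ⟨max n m, fun v hv => ⟨(hn _ (le_max_left _ _)).1 v hv, (hm _ (le_max_right _ _)).1 v hv⟩,
    fun v hv => (hn _ (le_max_left _ _)).2 v hv.1⟩

theorem IsLat.smul {g : (MatInf K)ˣ} (hg : D.IsLat (g • stdLattice O))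
    {L : AddSubgroup (ℕ →₀ K)} (hL : D.IsLat L) : D.IsLat (g • L) := by
  obtain ⟨m, h1, h2⟩ := hg
  obtain ⟨n, h3, h4⟩ := hL
  refine ⟨n + m, fun v hv => ?_, fun v hv => ?_⟩
  · have := h1 v hv
    rw [mem_smul_iff] at this ⊢
    rw [pow_add, mul_smul, unit_smul_comm]
    exact h3 _ this
  · rw [mem_smul_iff] at hv
    have h5 := h4 _ hv
    rw [add_comm, pow_add, mul_smul]
    refine h2 _ ?_
    rwa [mem_smul_iff, unit_smul_comm]

theorem IsLat.inv {g : (MatInf K)ˣ} (hg : D.IsLat (g • stdLattice O)) :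
    D.IsLat (g⁻¹ • stdLattice O) := by
  obtain ⟨m, h1, h2⟩ := hg
  refine ⟨m, fun v hv => ?_, fun v hv => ?_⟩
  · rw [mem_smul_iff, inv_inv, unit_smul_comm]
    exact h2 _ (smul_mem_pointwise_smul _ _ _ hv)
  · rw [mem_smul_iff, inv_inv] at hv
    have := h1 _ hv
    rwa [mem_smul_iff, unit_smul_comm, inv_smul_smul] at this

theorem latticeEquiv_smul {g : (MatInf K)ˣ} (hg : D.IsLat (g • stdLattice O))
    {W W' : AddSubgroup (ℕ →₀ K)} (h : LatticeEquiv D.IsLat W W') :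
    LatticeEquiv D.IsLat (g • W) (g • W') := fun L M hL hM hLM => by
  have key : ∀ W, latticeTrace L M (g • W) = g • latticeTrace (g⁻¹ • L) (g⁻¹ • M) W := fun W => by
    rw [← latticeTrace_smul, smul_inv_smul, smul_inv_smul]
  rw [key, key]
  exact commensurable_smul g (h _ _ (hg.inv.smul hL) (hg.inv.smul hM)
    (pointwise_smul_le_pointwise_smul_iff.2 hLM))

variable (D) in
/-- The group of automorphisms of `K^{(ℕ)}` that preserve the class of lattices, and the class
of `B^{(ℕ)}` up to commensurability modulo lattices. -/
def bigGroup : Subgroup (MatInf K)ˣ where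
  carrier := {g | D.IsLat (g • stdLattice O) ∧
    LatticeEquiv D.IsLat (stdLattice B) (g • stdLattice B)}
  one_mem' := ⟨by rw [one_smul]; exact D.isLat_std, fun L M _ _ _ => by
    rw [one_smul]; exact Commensurable.refl _⟩
  mul_mem' {g h} hg hh := ⟨by rw [mul_smul]; exact hg.1.smul hh.1, by
    rw [mul_smul]; exact hg.2.trans (latticeEquiv_smul hg.1 hh.2)⟩
  inv_mem' {g} hg := ⟨hg.1.inv, by
    have := latticeEquiv_smul hg.1.inv hg.2
    rw [inv_smul_smul] at this
    exact this.symm⟩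

section Elementary

variable {g : (MatInf K)ˣ} {i j : ℕ} {c c' : K}

theorem isLat_elementary (hg : ∀ v : ℕ →₀ K, g • v = v + Finsupp.single i (c * v j))
    (hg' : ∀ v : ℕ →₀ K, g⁻¹ • v = v + Finsupp.single i (c' * v j)) :
    D.IsLat (g • stdLattice O) := by
  obtain ⟨n, hn⟩ := D.exists_pow_mul_mem c
  obtain ⟨n', hn'⟩ := D.exists_pow_mul_mem c'
  have key : ∀ (n k : ℕ) (c : K), (D.t : K) ^ n * c ∈ O → ∀ v ∈ stdLattice O,
      (D.t : K) ^ (n + k) • (v + Finsupp.single i (c * v j)) ∈ stdLattice O := by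
    intro n k c hn v hv
    rw [smul_add, Finsupp.smul_single, smul_eq_mul]
    refine add_mem (smul_mem_stdLattice (D.pow_t_mem _) hv) (single_mem_stdLattice _ ?_)
    have e : (D.t : K) ^ (n + k) * (c * v j) = (D.t : K) ^ k * ((D.t : K) ^ n * c) * v j := by ring
    rw [e]
    exact O.mul_mem (O.mul_mem (D.pow_t_mem _) hn) (hv j)
  refine ⟨n + n', fun v hv => ?_, fun v hv => ?_⟩
  · rw [mem_smul_iff, unit_smul_comm, hg', add_comm n]
    exact key _ _ _ hn' v hv
  · rw [mem_smul_iff] at hv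
    have := key n n' c hn _ hv
    rwa [← hg, smul_inv_smul] at this

/-- Half of the commensurability of B^{(ℕ)} and gB^{(ℕ)} modulo lattices. The matrix g changes the
i-th coordinate by a multiple of the j-th one, so a vector w of L ∩ B^{(ℕ)} lies in L ∩ gB^{(ℕ)} + M
under a condition on w_j alone. After scaling by tⁿ this condition is that tⁿw_j lies in the ideal
(t^{2n}, u^l) of O ∩ B, which has finite index. The case i = j is included, to cover diagonal
matrices. -/
theorem relIndex_elementary (hg : ∀ v : ℕ →₀ K, g • v = v + Finsupp.single i (c * v j))
    (hg' : ∀ v : ℕ →₀ K, g⁻¹ • v = v + Finsupp.single i (c' * v j))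
    {L M : AddSubgroup (ℕ →₀ K)} (hL : D.IsLat L)
    (hM : D.IsLat M) (hLM : M ≤ L) :
    (latticeTrace L M (g • stdLattice B)).relIndex (latticeTrace L M (stdLattice B)) ≠ 0 := by
  obtain ⟨n₁, h₁⟩ := hL.exists_of_le
  obtain ⟨n₂, h₂⟩ := hM.exists_of_le
  obtain ⟨n₃, h₃⟩ := D.exists_pow_mul_mem c
  -- One n for three purposes: tⁿL ⊆ O^{(ℕ)}, tⁿO^{(ℕ)} ⊆ M and tⁿc ∈ O.
  obtain ⟨n, hn⟩ : ∃ n, n = n₁ + n₂ + n₃ := ⟨_, rfl⟩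
  have hLn := (h₁ n (by omega)).2
  have hMn := (h₂ n (by omega)).1
  have hcn : (D.t : K) ^ n * c ∈ O := by
    have e : (D.t : K) ^ n * c = (D.t : K) ^ (n₁ + n₂) * ((D.t : K) ^ n₃ * c) := by
      rw [hn, pow_add]; ring
    rw [e]; exact O.mul_mem (D.pow_t_mem _) h₃
  -- The precision 3n covers the losses below: one n for division by tⁿ, one for multiplication by
  -- c, and tⁿ must remain in order to land in M.
  obtain ⟨l, β, hβ, y, hy, hc'⟩ := D.approx (3 * n) c'
  have ht0 : (D.t : K) ^ n * ((D.t⁻¹ : Kˣ) : K) ^ n = 1 := by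
    rw [← mul_pow, Units.mul_inv, one_pow]
  have htB : ((D.t⁻¹ : Kˣ) : K) ^ n ∈ B := B.pow_mem D.t_inv_mem_B n
  have htB' : (D.t : K) ^ n ∈ B := B.pow_mem D.t_mem_B n
  generalize ((D.t⁻¹ : Kˣ) : K) ^ n = s at ht0 htB
  let π : (ℕ →₀ K) →+ K := (AddMonoidHom.mulLeft ((D.t : K) ^ n)).comp (Finsupp.applyAddHom j)
  have hπ : ∀ w, π w = (D.t : K) ^ n * w j := fun _ => rfl
  rw [latticeTrace, latticeTrace, ← sup_of_le_right
    (show M ≤ L ⊓ g • stdLattice B ⊔ M from le_sup_right)]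
  have step : L ⊓ stdLattice B ⊔ (L ⊓ g • stdLattice B ⊔ M) = L ⊓ stdLattice B ⊔ M ⊔
    (L ⊓ g • stdLattice B ⊔ M) := by
      rw [sup_assoc (L ⊓ stdLattice B), sup_eq_right.2 (show M ≤ L ⊓ g • stdLattice B ⊔ M from le_sup_right)]
  rw [sup_eq_right.2 (show M ≤ L ⊓ g • stdLattice B ⊔ M from le_sup_right)]
  intro h0
  have h0' : (L ⊓ g • stdLattice B ⊔ M).relIndex (L ⊓ stdLattice B) = 0 := by
    rw [← relIndex_sup_right, step, relIndex_sup_right]; exact h0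
  -- Here w_j = tⁿa + t⁻ⁿu^l b. The part tⁿa is removed at the cost of an element of M. On the rest,
  -- c' times the coordinate is t⁻ⁿbβ ∈ B up to t^{2n}by, and applying g to this error gives a
  -- vector in tⁿO^{(ℕ)} ⊆ M.
  have hle : (D.paramIdeal (2 * n) l).comap π ⊓ (L ⊓ stdLattice B) ≤ L ⊓ g • stdLattice B ⊔ M := by
    rintro w ⟨⟨a, ha, b, hb, hw⟩, hwL, hwB⟩
    rw [hπ] at hw
    have hsM : ∀ k, ∀ r ∈ O, Finsupp.single k ((D.t : K) ^ n * r) ∈ M := fun k r hr => by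
      have := hMn _ (single_mem_stdLattice k hr)
      rwa [Finsupp.smul_single, smul_eq_mul] at this
    have hwj : w j = (D.t : K) ^ n * a + s * (D.u : K) ^ l * b := by
      have : w j = (D.t : K) ^ n * s * w j := by rw [ht0, one_mul]
      rw [this, mul_right_comm, hw]
      linear_combination a * (D.t : K) ^ n * ht0
    set w₁ := w - Finsupp.single j ((D.t : K) ^ n * a) with hw₁
    have hw₁j : w₁ j = s * (D.u : K) ^ l * b := by
      rw [hw₁, Finsupp.sub_apply, Finsupp.single_eq_same, hwj]; ring
    set w₂ := w₁ + Finsupp.single i (s * b * β) with hw₂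
    have hw₂B : w₂ ∈ stdLattice B :=
      add_mem (sub_mem hwB (single_mem_stdLattice _ (B.mul_mem htB' ha.2)))
        (single_mem_stdLattice _ (B.mul_mem (B.mul_mem htB hb.2) hβ))
    have hst : s * (D.t : K) ^ (3 * n) = (D.t : K) ^ (2 * n) := by
      linear_combination (D.t : K) ^ (2 * n) * ht0
    have e1 : g⁻¹ • w₁ = w₂ + Finsupp.single i ((D.t : K) ^ (2 * n) * (b * y)) := by
      rw [hg', hw₁j, hw₂, add_assoc, ← Finsupp.single_add]
      congr 2
      linear_combination s * b * hc' + y * b * hst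
    obtain ⟨e, he, hge⟩ : ∃ e ∈ O, g • Finsupp.single i ((D.t : K) ^ (2 * n) * (b * y))
        = Finsupp.single i ((D.t : K) ^ n * e) := by
      rw [hg, Finsupp.single_apply, ← Finsupp.single_add]
      split_ifs with hij
      · refine ⟨(D.t : K) ^ n * (b * y) + ((D.t : K) ^ n * c) * (b * y),
          O.add_mem (O.mul_mem (D.pow_t_mem _) (O.mul_mem hb.1 hy))
            (O.mul_mem hcn (O.mul_mem hb.1 hy)), ?_⟩
        congr 1; ring
      · refine ⟨(D.t : K) ^ n * (b * y), O.mul_mem (D.pow_t_mem _) (O.mul_mem hb.1 hy), ?_⟩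
        congr 1; ring
    have e2 : w = g • w₂ + (Finsupp.single i ((D.t : K) ^ n * e)
        + Finsupp.single j ((D.t : K) ^ n * a)) := by
      have : w₁ = g • w₂ + Finsupp.single i ((D.t : K) ^ n * e) := by
        rw [← hge, ← smul_add, ← e1, smul_inv_smul]
      rw [← add_assoc, ← this, hw₁]; abel
    have hm : Finsupp.single i ((D.t : K) ^ n * e) + Finsupp.single j ((D.t : K) ^ n * a) ∈ M :=
      add_mem (hsM _ _ he) (hsM _ _ ha.1)
    rw [e2, mem_sup]
    refine ⟨g • w₂, ⟨?_, smul_mem_pointwise_smul _ _ _ hw₂B⟩, _, hm, rfl⟩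
    have : g • w₂ = w - (Finsupp.single i ((D.t : K) ^ n * e)
        + Finsupp.single j ((D.t : K) ^ n * a)) := by rw [eq_sub_iff_add_eq]; exact e2.symm
    rw [this]
    exact L.sub_mem hwL (hLM hm)
  have h1 : ((D.paramIdeal (2 * n) l).comap π ⊓ (L ⊓ stdLattice B)).relIndex (L ⊓ stdLattice B) = 0 :=
    relIndex_eq_zero_of_le_left hle h0'
  rw [inf_relIndex_right, relIndex_comap] at h1
  refine D.paramIdeal_relIndex_ne_zero (2 * n) l (relIndex_eq_zero_of_le_right ?_ h1)
  rintro _ ⟨w, ⟨hwL, hwB⟩, rfl⟩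
  exact ⟨hLn w hwL j, B.mul_mem htB' (hwB j)⟩

/-- The other relative index is that of g⁻¹ on the lattices g⁻¹L and g⁻¹M, translated by g. -/
theorem mem_bigGroup_of_elementary (hg : ∀ v : ℕ →₀ K, g • v = v + Finsupp.single i (c * v j))
    (hg' : ∀ v : ℕ →₀ K, g⁻¹ • v = v + Finsupp.single i (c' * v j)) : g ∈ D.bigGroup := by
  have hlat := isLat_elementary (D := D) hg hg'
  refine ⟨hlat, fun L M hL hM hLM => ⟨?_, relIndex_elementary hg hg' hL hM hLM⟩⟩
  have := relIndex_elementary (D := D) hg' (by rwa [inv_inv]) (hlat.inv.smul hL)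
    (hlat.inv.smul hM) (pointwise_smul_le_pointwise_smul_iff.2 hLM)
  rw [latticeTrace_smul] at this
  rwa [← relIndex_pointwise_smul g⁻¹, ← latticeTrace_smul g⁻¹ L M (g • _), inv_smul_smul]

end Elementary

theorem elemMat_mem_bigGroup (i j : ℕ) (h : i ≠ j) (r : K) : elemMat i j h r ∈ D.bigGroup :=
  mem_bigGroup_of_elementary (elemMat_smul i j h r) (elemMat_inv_smul i j h r)

theorem diagUnit_mem_bigGroup (i : ℕ) (a : Kˣ) : diagUnit K i a ∈ D.bigGroup :=
  mem_bigGroup_of_elementary (diagUnit_smul i a) (by rw [← map_inv]; exact diagUnit_smul i a⁻¹)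

end LocalDatum

end TwoDim
end

noncomputable section

namespace TwoDim

open scoped Pointwise commutatorElement
open AddSubgroup

/-! ### The index cocycle -/

/-- When L/M is concentrated in the coordinate i, the trace depends only on the i-th coordinates of
the vectors of W. -/
theorem latticeTrace_congr_of_single {K : Type*} [Field K] (i : ℕ)
    {L M W W' : AddSubgroup (ℕ →₀ K)} (hML : M ≤ L)
    (h : ∀ v ∈ L, v - Finsupp.single i (v i) ∈ M)
    (hW : ∀ v ∈ W, Finsupp.single i (v i) ∈ W') (hW' : ∀ v ∈ W', Finsupp.single i (v i) ∈ W) :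
    latticeTrace L M W = latticeTrace L M W' := by
  have key : ∀ W W' : AddSubgroup (ℕ →₀ K), (∀ v ∈ W, Finsupp.single i (v i) ∈ W') →
      latticeTrace L M W ≤ latticeTrace L M W' := by
    intro W W' hW
    refine sup_le ?_ le_sup_right
    rintro v ⟨hvL, hvW⟩
    have h1 := h v hvL
    have h2 : Finsupp.single i (v i) ∈ L := by
      have := L.sub_mem hvL (hML h1)
      rwa [sub_sub_cancel] at this
    exact mem_sup.2 ⟨_, ⟨h2, hW v hvW⟩, _, h1, by abel⟩
  exact le_antisymm (key _ _ hW) (key _ _ hW')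

theorem latticeTrace_self {V : Type*} [AddCommGroup V] (M W : AddSubgroup V) :
    latticeTrace M M W = M := sup_eq_right.2 inf_le_left

namespace LocalDatum

variable {K : Type*} [Field K] {O B : Subring K} {q : ℕ} {ν : Kˣ → Kˣ → ℤ}
variable (D : LocalDatum O B q ν)

/-- The cocycle of the central extension of `bigGroup` defined by relative indices of lattices. -/
def indexCocycle : NormCocycle D.bigGroup where
  toFun g h := indexPairing (stdLattice O) (g.1 • stdLattice O) (g.1 • stdLattice B)
    (g.1 • h.1 • stdLattice B)
  cocycle g h k := by
    have hinf : ∀ L L', D.IsLat L → D.IsLat L' → D.IsLat (L ⊓ L') := fun _ _ h h' => h.inf h'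
    -- With ⟨L, L' | W, W'⟩ for the pairing, c(h, k) equals ⟨gL, ghL | ghW, ghkW⟩ by invariance. The
    -- cocycle identity is then additivity along L, gL, ghL on the left and along gW, ghW, ghkW on
    -- the right.
    have e1 : indexPairing (stdLattice O) (h.1 • stdLattice O) (h.1 • stdLattice B)
        (h.1 • k.1 • stdLattice B) = indexPairing (g.1 • stdLattice O) (g.1 • h.1 • stdLattice O)
          (g.1 • h.1 • stdLattice B) (g.1 • h.1 • k.1 • stdLattice B) :=
      (indexPairing_smul g.1 _ _ _ _).symm
    have w2 : LatticeEquiv D.IsLat (g.1 • h.1 • stdLattice B) (g.1 • h.1 • k.1 • stdLattice B) :=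
      latticeEquiv_smul g.2.1 (latticeEquiv_smul h.2.1 k.2.2)
    have e2 := indexPairing_trans_left hinf w2 D.isLat_std g.2.1 (g.2.1.smul h.2.1)
    have e3 := indexPairing_trans_right hinf (latticeEquiv_smul g.2.1 h.2.2) w2 D.isLat_std g.2.1
    simp only [Subgroup.coe_mul, mul_smul]
    rw [e1, e2, e3]
    ring
  one_left g := by
    simp only [Subgroup.coe_one, one_smul]
    exact indexPairing_self_left _ _ _
  one_right g := by
    simp only [Subgroup.coe_one, one_smul]
    exact indexPairing_self_right _ _ _

theorem indexCocycle_apply (g h : D.bigGroup) : D.indexCocycle g h =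
    indexPairing (stdLattice O) (g.1 • stdLattice O) (g.1 • stdLattice B)
      (g.1 • h.1 • stdLattice B) := rfl

theorem indexCocycle_of_integral {g : D.bigGroup} (hg : g.1 • stdLattice O = stdLattice O)
    (h : D.bigGroup) : D.indexCocycle g h = 0 := by
  rw [indexCocycle_apply, hg]; exact indexPairing_self_left _ _ _

theorem indexCocycle_of_B {h : D.bigGroup} (hh : h.1 • stdLattice B = stdLattice B)
    (g : D.bigGroup) : D.indexCocycle g h = 0 := by
  rw [indexCocycle_apply, hh]; exact indexPairing_self_right _ _ _

/-- The diagonal matrix with entry `a` at the place `i`, as an element of `bigGroup`. -/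
def torus (i : ℕ) : Kˣ →* D.bigGroup := (diagUnit K i).codRestrict _ fun a =>
  diagUnit_mem_bigGroup i a

@[simp] theorem coe_torus (i : ℕ) (a : Kˣ) : (D.torus i a).1 = diagUnit K i a := rfl

theorem torus_comm (i j : ℕ) (a b : Kˣ) : Commute (D.torus i a) (D.torus j b) := by
  by_cases hij : i = j
  · subst hij
    rw [Commute, SemiconjBy, ← map_mul, mul_comm, map_mul]
  refine Subtype.ext (Units.ext ?_)
  change (1 + entry i i ((a : K) - 1) : MatInf K) * (1 + entry j j ((b : K) - 1))
    = (1 + entry j j ((b : K) - 1)) * (1 + entry i i ((a : K) - 1))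
  simp only [mul_add, add_mul, mul_one, one_mul, entry_mul_of_ne _ _ _ _ hij,
    entry_mul_of_ne _ _ _ _ (Ne.symm hij)]
  abel

/-- The lattices differ only in the coordinate i and the groups commensurable with B^{(ℕ)} only in
the coordinate j, so the traces coincide. -/
theorem indexCocycle_torus_of_ne {i j : ℕ} (hij : i ≠ j) (a b : Kˣ) :
    D.indexCocycle (D.torus i a) (D.torus j b) = 0 := by
  have h1 : ∀ L, (L = stdLattice O ∨ L = diagUnit K i a • stdLattice O) →
      latticeTrace L (stdLattice O ⊓ diagUnit K i a • stdLattice O)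
        (diagUnit K i a • stdLattice B)
      = latticeTrace L (stdLattice O ⊓ diagUnit K i a • stdLattice O)
        (diagUnit K i a • diagUnit K j b • stdLattice B) := by
    intro L hL
    have hs : ∀ v ∈ diagUnit K i a • stdLattice B,
        Finsupp.single i (v i) ∈ diagUnit K i a • diagUnit K j b • stdLattice B := by
      intro v hv
      rw [mem_smul_iff, mem_smul_iff, ← map_inv, ← map_inv]
      rw [diagUnit_mem_smul] at hv
      have hi := hv i
      rw [if_pos rfl] at hi
      intro k
      rw [diagUnit_smul_apply, diagUnit_smul_apply, Finsupp.single_apply]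
      split_ifs with h1 h2 h3 h4 h5
      all_goals first
        | (exfalso; omega)
        | exact hi
        | (rw [mul_zero]; exact B.zero_mem)
        | exact B.zero_mem
    have hs' : ∀ v ∈ diagUnit K i a • diagUnit K j b • stdLattice B,
        Finsupp.single i (v i) ∈ diagUnit K i a • stdLattice B := by
      intro v hv
      rw [mem_smul_iff, mem_smul_iff, ← map_inv, ← map_inv] at hv
      have hi := hv i
      rw [diagUnit_smul_apply, if_neg hij, diagUnit_smul_apply, if_pos rfl] at hi
      rw [diagUnit_mem_smul]
      intro k
      rw [Finsupp.single_apply]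
      split_ifs with h1 h2 h2
      · exact hi
      · rw [mul_zero]; exact B.zero_mem
      · exact absurd h2.symm h1
      · exact B.zero_mem
    have hML : stdLattice O ⊓ diagUnit K i a • stdLattice O ≤ L := by
      rcases hL with rfl | rfl
      exacts [inf_le_left, inf_le_right]
    refine latticeTrace_congr_of_single i hML (fun v hv => ?_) hs hs'
    have hv' : ∀ k, k ≠ i → v k ∈ O := fun k hk => by
      rcases hL with rfl | rfl
      · exact hv k
      · have := (diagUnit_mem_smul i a O v).1 hv k
        rwa [if_neg hk] at this
    have hv0 : (v - Finsupp.single i (v i)) i = 0 := by simp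
    have hvk : ∀ k, k ≠ i → (v - Finsupp.single i (v i)) k ∈ O := fun k hk => by
      rw [Finsupp.sub_apply, Finsupp.single_eq_of_ne hk, sub_zero]; exact hv' k hk
    refine ⟨fun k => ?_, (diagUnit_mem_smul i a O _).2 fun k => ?_⟩
    · by_cases hk : k = i
      · rw [hk, hv0]; exact O.zero_mem
      · exact hvk k hk
    · split_ifs with hk
      · rw [hk, hv0, mul_zero]; exact O.zero_mem
      · exact hvk k hk
  rw [indexCocycle_apply, coe_torus, coe_torus, indexPairing, latticeIndex, latticeIndex,
    h1 _ (Or.inl rfl), h1 _ (Or.inr rfl), logIndex_self, logIndex_self, sub_self]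

theorem torus_t_le (i : ℕ) : diagUnit K i D.t • stdLattice O ≤ stdLattice O := fun v hv k => by
  have := (diagUnit_mem_smul i D.t O v).1 hv k
  split_ifs at this
  · have := O.mul_mem D.t_mem this
    rwa [Units.mul_inv_cancel_left] at this
  · exact this

theorem single_mem_torus_t (i : ℕ) {r : K} (hr : r ∈ O) :
    Finsupp.single i ((D.t : K) * r) ∈ diagUnit K i D.t • stdLattice O := by
  rw [diagUnit_mem_smul]
  intro k
  rw [Finsupp.single_apply]
  split_ifs with h1 h2 h2
  · rwa [Units.inv_mul_cancel_left]
  · rw [mul_zero]; exact O.zero_mem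
  · exact absurd h2.symm h1
  · exact O.zero_mem

/-- Multiplication of the i-th coordinate by m ∈ 1 + tO is trivial modulo the lattice scaled by t in
that coordinate, so it does not move any trace. -/
theorem indexCocycle_t_one_add (i : ℕ) {m : Kˣ} (hm : ∃ y ∈ O, (m : K) = 1 + D.t * y) :
    D.indexCocycle (D.torus i D.t) (D.torus i m) = 0 := by
  have key : ∀ m : Kˣ, (∃ y ∈ O, (m : K) = 1 + D.t * y) → ∀ v ∈ stdLattice O,
      diagUnit K i m • v - v ∈ diagUnit K i D.t • stdLattice O := by
    rintro m ⟨y, hy, h⟩ v hv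
    rw [diagUnit_smul, add_sub_cancel_left, h, add_sub_cancel_left, mul_assoc]
    exact D.single_mem_torus_t i (O.mul_mem hy (hv i))
  have e : diagUnit K i D.t • diagUnit K i m • stdLattice B
      = diagUnit K i m • diagUnit K i D.t • stdLattice B := by
    rw [← mul_smul, ← mul_smul, ← map_mul, ← map_mul, mul_comm]
  have := latticeTrace_smul_of_trivial (diagUnit K i m) (D.torus_t_le i) (key m hm)
    (by rw [← map_inv]; exact key _ (D.one_add_inv hm)) (diagUnit K i D.t • stdLattice B)
  rw [indexCocycle_apply, coe_torus, coe_torus, indexPairing, latticeIndex, latticeIndex,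
    inf_eq_right.2 (D.torus_t_le i), latticeTrace_self, latticeTrace_self, e, this, logIndex_self,
    logIndex_self, sub_self]

/-- The lattice quotient is O/tO in the coordinate i. The trace of B there is compared with that of
uB, and the index is that of (t, u) in O ∩ B, which is q. This is the only nontrivial value of the
cocycle that has to be computed. -/
theorem indexCocycle_t_u (i : ℕ) :
    D.indexCocycle (D.torus i D.t) (D.torus i D.u) = Real.log q := by
  have hle : diagUnit K i D.u • stdLattice B ≤ stdLattice B := fun v hv k => by
    have := (diagUnit_mem_smul i D.u B v).1 hv k
    split_ifs at this
    · have := B.mul_mem D.u_mem_B this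
      rwa [Units.mul_inv_cancel_left] at this
    · exact this
  have e : diagUnit K i D.t • diagUnit K i D.u • stdLattice B = diagUnit K i D.u • stdLattice B := by
    rw [← mul_smul, ← map_mul, mul_comm, map_mul, mul_smul,
      diagUnit_smul_stdLattice i D.isUnitOf_t]
  rw [indexCocycle_apply, coe_torus, coe_torus, indexPairing, latticeIndex, latticeIndex,
    inf_eq_right.2 (D.torus_t_le i), latticeTrace_self, latticeTrace_self, logIndex_self, sub_zero,
    e, diagUnit_smul_stdLattice i D.isUnitOf_t]
  set L := stdLattice O with hL
  set W := stdLattice B with hW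
  set N := diagUnit K i D.t • L with hN
  set W' := diagUnit K i D.u • W with hW'
  have h1 : latticeTrace L N W' ≤ latticeTrace L N W :=
    sup_le_sup_right (inf_le_inf_left _ hle) _
  rw [logIndex_of_le h1]
  congr 2
  have h2 : latticeTrace L N W = L ⊓ W ⊔ latticeTrace L N W' := by
    refine le_antisymm (sup_le_sup_left le_sup_right _) (sup_le le_sup_left h1)
  rw [h2, relIndex_sup_right]
  let π : (ℕ →₀ K) →+ K := Finsupp.applyAddHom i
  have h3 : latticeTrace L N W' ⊓ (L ⊓ W) = (D.paramIdeal 1 1).comap π ⊓ (L ⊓ W) := by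
    ext w
    refine and_congr_left ?_
    rintro ⟨hwL, hwW⟩
    change w ∈ L ⊓ W' ⊔ N ↔ ∃ a ∈ O ⊓ B, ∃ b ∈ O ⊓ B, w i = _
    constructor
    · intro h
      obtain ⟨w', ⟨hw1, hw2⟩, n, hn, rfl⟩ := mem_sup.1 h
      have hw3 := (diagUnit_mem_smul i D.u B w').1 hw2 i
      have hn1 := (diagUnit_mem_smul i D.t O n).1 hn i
      rw [if_pos rfl] at hw3 hn1
      have hnB : n i ∈ B := by
        have h1 := hwW i
        have h2 := hle hw2 i
        rw [Finsupp.add_apply] at h1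
        have := B.sub_mem h1 h2
        rwa [add_sub_cancel_left] at this
      refine ⟨_, ⟨hn1, B.mul_mem D.t_inv_mem_B hnB⟩, _, ⟨O.mul_mem D.u_inv_mem (hw1 i), hw3⟩, ?_⟩
      rw [Finsupp.add_apply, pow_one, pow_one, Units.mul_inv_cancel_left, Units.mul_inv_cancel_left,
        add_comm]
    · rintro ⟨a, ha, b, hb, h⟩
      rw [pow_one, pow_one] at h
      refine mem_sup.2 ⟨w - Finsupp.single i ((D.t : K) * a), ⟨?_, ?_⟩, _,
        D.single_mem_torus_t i ha.1, sub_add_cancel _ _⟩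
      · exact L.sub_mem hwL (single_mem_stdLattice i (O.mul_mem D.t_mem ha.1))
      · refine (diagUnit_mem_smul i D.u B _).2 fun k => ?_
        rw [Finsupp.sub_apply, Finsupp.single_apply]
        split_ifs with h1 h2 h2
        · rw [h1, h, add_sub_cancel_left, Units.inv_mul_cancel_left]; exact hb.2
        · exact absurd h1.symm h2
        · exact absurd h2.symm h1
        · rw [sub_zero]; exact hwW k
  rw [← inf_relIndex_right, h3, inf_relIndex_right, relIndex_comap]
  have h4 : (L ⊓ W).map π = (O ⊓ B).toAddSubgroup := by
    ext r
    constructor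
    · rintro ⟨w, hw, rfl⟩
      exact ⟨hw.1 i, hw.2 i⟩
    · intro hr
      exact ⟨Finsupp.single i r, ⟨single_mem_stdLattice i hr.1, single_mem_stdLattice i hr.2⟩,
        Finsupp.single_eq_same⟩
  rw [h4, D.paramIdeal_one_one]

/-- The commutator pairing of the index cocycle on the torus. -/
def torusPairing (x y : Kˣ) : ℝ :=
  D.indexCocycle (D.torus 0 x) (D.torus 0 y) - D.indexCocycle (D.torus 0 y) (D.torus 0 x)

theorem torusPairing_of_integral {x y : Kˣ} (hx : IsUnitOf O x) (hy : IsUnitOf O y) :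
    D.torusPairing x y = 0 := by
  rw [torusPairing, D.indexCocycle_of_integral (g := D.torus 0 x) (diagUnit_smul_stdLattice 0 hx),
    D.indexCocycle_of_integral (g := D.torus 0 y) (diagUnit_smul_stdLattice 0 hy), sub_self]

theorem torusPairing_of_B {x y : Kˣ} (hx : IsUnitOf B x) (hy : IsUnitOf B y) :
    D.torusPairing x y = 0 := by
  rw [torusPairing, D.indexCocycle_of_B (h := D.torus 0 y) (diagUnit_smul_stdLattice 0 hy),
    D.indexCocycle_of_B (h := D.torus 0 x) (diagUnit_smul_stdLattice 0 hx), sub_self]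

theorem torusPairing_t_one_add {m : Kˣ} (hm : ∃ y ∈ O, (m : K) = 1 + D.t * y) :
    D.torusPairing D.t m = 0 := by
  rw [torusPairing, D.indexCocycle_t_one_add 0 hm,
    D.indexCocycle_of_integral (g := D.torus 0 m)
      (diagUnit_smul_stdLattice 0 (D.isUnitOf_one_add hm)), sub_self]

theorem torusPairing_t_u : D.torusPairing D.t D.u = Real.log q := by
  rw [torusPairing, D.indexCocycle_t_u 0,
    D.indexCocycle_of_integral (g := D.torus 0 D.u)
      (diagUnit_smul_stdLattice 0 D.isUnitOf_u), sub_zero]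

theorem commutator_torus {x y : Kˣ} {X Y : D.indexCocycle.Ext} (hX : X.base = D.torus 0 x)
    (hY : Y.base = D.torus 0 y) :
    ⁅X, Y⁆ = D.indexCocycle.incl (Multiplicative.ofAdd (D.torusPairing x y)) := by
  rw [NormCocycle.commutator_eq _ (by rw [hX, hY]; exact D.torus_comm 0 0 x y), hX, hY, torusPairing]

/-- Additivity is not visible on the cocycle itself. It holds because the pairing is the commutator
of lifts in a central extension. -/
theorem torusPairing_mul (x x' y : Kˣ) :
    D.torusPairing (x * x') y = D.torusPairing x y + D.torusPairing x' y := by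
  let X : Kˣ → D.indexCocycle.Ext := fun x => ⟨D.torus 0 x, 0⟩
  have h1 := D.commutator_torus (x := x * x') (y := y) (X := X x * X x') (Y := X y)
    (by rw [NormCocycle.mul_base, map_mul]) rfl
  have h2 := D.commutator_torus (x := x) (y := y) (X := X x) (Y := X y) rfl rfl
  have h3 := D.commutator_torus (x := x') (y := y) (X := X x') (Y := X y) rfl rfl
  rw [commutator_mul_left_of_central
    (by rw [h3]; exact D.indexCocycle.isCentral_extension ⟨_, rfl⟩), h2, h3, ← map_mul] at h1
  exact (congrArg Multiplicative.toAdd (D.indexCocycle.extension.inl_injective h1)).symm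

theorem torusPairing_eq (x y : Kˣ) : D.torusPairing x y = -(ν x y : ℝ) * Real.log q := by
  have h := D.pairing_eq (c := fun x y => Multiplicative.ofAdd (D.torusPairing x y))
    (fun x x' y => congrArg Multiplicative.ofAdd (D.torusPairing_mul x x' y))
    (fun x y => congrArg Multiplicative.ofAdd (neg_sub _ _).symm)
    (fun x y hx hy => congrArg Multiplicative.ofAdd (D.torusPairing_of_integral hx hy))
    (fun x y hx hy => congrArg Multiplicative.ofAdd (D.torusPairing_of_B hx hy))
    (fun m hm => congrArg Multiplicative.ofAdd (D.torusPairing_t_one_add hm)) x y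
  have h' := congrArg Multiplicative.toAdd h
  rw [toAdd_zpow, toAdd_ofAdd, toAdd_ofAdd, torusPairing_t_u] at h'
  rw [h']
  simp

end LocalDatum

end TwoDim
end

noncomputable section

namespace TwoDim

open scoped Pointwise commutatorElement

/-! ### Lifting the Steinberg group to central extensions -/

section SteinbergLift

variable {K : Type*} [Field K] {G D : Type*} [Group G] [Group D] {p : D →* G}

/-- An additive `K`-invariant family of central elements is trivial. -/
theorem eq_one_of_scale_of_add [Infinite K] {C : K → D}
    (hadd : ∀ r r', C (r + r') = C r * C r') (hs : ∀ (a : Kˣ) r, C (a * r) = C r) (r : K) :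
    C r = 1 := by
  obtain ⟨a, ha⟩ := exists_unit_ne_one (K := K)
  have ha' : (a : K) - 1 ≠ 0 := sub_ne_zero.2 ha
  have h1 := hs a (((a : K) - 1)⁻¹ * r)
  have e : (a : K) * (((a : K) - 1)⁻¹ * r) = r + ((a : K) - 1)⁻¹ * r := by field_simp; ring
  rw [e, hadd] at h1
  exact mul_eq_right.1 h1

/-- A homomorphism from the Steinberg group to `G`, together with a compatible torus in `G`, lifts
to any central extension of `G`. -/
theorem St.exists_lift [Infinite K] (hc : p.ker ≤ Subgroup.center D) (hp : Function.Surjective p)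
    (E : St K →* G) (d : ℕ → Kˣ →* G) (hdd : ∀ i j a b, Commute (d i a) (d j b))
    (hd1 : ∀ i j (h : i ≠ j) (a : Kˣ) r,
      d i a * E (St.x i j h r) * (d i a)⁻¹ = E (St.x i j h (a * r)))
    (hd2 : ∀ i j (h : i ≠ j) (a : Kˣ) r,
      d j a * E (St.x i j h r) * (d j a)⁻¹ = E (St.x i j h (((a⁻¹ : Kˣ) : K) * r)))
    (hd3 : ∀ i j (h : i ≠ j) k, k ≠ i → k ≠ j → ∀ (a : Kˣ) r,
      d k a * E (St.x i j h r) * (d k a)⁻¹ = E (St.x i j h r)) :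
    ∃ Φ : St K →* D, ∀ s, p (Φ s) = E s := by
  have H : ∀ i j (h : i ≠ j), ∃ X : K → D, (∀ r, p (X r) = E (St.x i j h r)) ∧
      (∀ r s, X (r + s) = X r * X s) ∧
      ∀ (y : D) (b : K), (∀ a, Commute (p y) (d i a)) →
        (∀ r, p y * E (St.x i j h r) * (p y)⁻¹ = E (St.x i j h (b * r))) →
        ∀ r, y * X r * y⁻¹ = X (b * r) := by
    intro i j h
    obtain ⟨X, hX, Xadd, Xch⟩ := exists_root_lift hc (fun r => E (St.x i j h r))
      (fun r s => by rw [St.x_add, map_mul]) (fun r => hp _) (d i) (fun a => hp _) (hd1 i j h)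
    refine ⟨X, hX, Xadd, fun y b hy hb r => ?_⟩
    obtain ⟨a₀, ha₀⟩ := exists_unit_ne_one (K := K)
    have ha₀' : (a₀ : K) - 1 ≠ 0 := sub_ne_zero.2 ha₀
    obtain ⟨z, hz⟩ := hp (d i a₀)
    -- As a commutator with a lift of d_i(a₀), X(r) does not depend on lifts. Conjugation by y keeps
    -- the image d_i(a₀) and scales the root by b.
    have X_comm : ∀ r, X r = ⁅z, X (((a₀ : K) - 1)⁻¹ * r)⁆ := fun r => by
      rw [Xch a₀ _ _ _ hz (hX _), mul_inv_cancel_left₀ ha₀']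
    rw [X_comm r, conj_commutator, X_comm (b * r)]
    refine commutator_congr hc ?_ ?_
    · rw [map_mul, map_mul, map_inv, hz, (hy a₀).eq, mul_inv_cancel_right]
    · rw [map_mul, map_mul, map_inv, hX, hb, hX, mul_left_comm]
  choose X hX Xadd Xconj using H
  choose y hy using fun i a => hp (d i a)
  have X1 : ∀ i j (h : i ≠ j) (a : Kˣ) r, y i a * X i j h r * (y i a)⁻¹ = X i j h (a * r) :=
    fun i j h a r => Xconj i j h _ _ (fun b => by rw [hy]; exact hdd _ _ _ _)
      (fun r => by rw [hy]; exact hd1 i j h a r) r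
  have X2 : ∀ i j (h : i ≠ j) (a : Kˣ) r,
      y j a * X i j h r * (y j a)⁻¹ = X i j h (((a⁻¹ : Kˣ) : K) * r) :=
    fun i j h a r => Xconj i j h _ _ (fun b => by rw [hy]; exact hdd _ _ _ _)
      (fun r => by rw [hy]; exact hd2 i j h a r) r
  have X3 : ∀ i j (h : i ≠ j) k, k ≠ i → k ≠ j → ∀ (a : Kˣ) r,
      y k a * X i j h r * (y k a)⁻¹ = X i j h r := fun i j h k hi hj a r => by
    have := Xconj i j h (y k a) 1 (fun b => by rw [hy]; exact hdd _ _ _ _)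
      (fun r => by rw [hy, one_mul]; exact hd3 i j h k hi hj a r) r
    rwa [one_mul] at this
  have hone : ∀ i j k l (hij : i ≠ j) (hkl : k ≠ l), j ≠ k → i ≠ l → ∀ r s,
      ⁅X i j hij r, X k l hkl s⁆ = 1 := by
    intro i j k l hij hkl hjk hil r s
    have hcen : ∀ r, ⁅X i j hij r, X k l hkl s⁆ ∈ Subgroup.center D := fun r => hc (by
      rw [MonoidHom.mem_ker, map_commutatorElement, hX, hX, ← map_commutatorElement,
        St.x_comm_one i j k l hij hkl hjk hil, map_one])
    have hadd : ∀ r r', ⁅X i j hij (r + r'), X k l hkl s⁆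
        = ⁅X i j hij r, X k l hkl s⁆ * ⁅X i j hij r', X k l hkl s⁆ := fun r r' => by
      rw [Xadd, commutator_mul_left_of_central (hcen _)]
    -- A torus element is needed that scales one root and fixes the other: d_i if i ≠ k, and the
    -- inverse of d_j if i = k, j ≠ l. If the two roots coincide, commutativity follows from
    -- additivity.
    by_cases hik : i = k
    · by_cases hjl : j = l
      · subst hik hjl
        rw [commutatorElement_eq_one_iff_mul_comm, ← Xadd, ← Xadd, add_comm]
      · refine eq_one_of_scale_of_add (C := fun r => ⁅X i j hij r, X k l hkl s⁆) hadd
          (fun a r => ?_) r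
        have := conj_eq_of_central (hcen r) (y j a⁻¹)
        rwa [conj_commutator, X2, X3 _ _ _ _ hjk hjl, inv_inv] at this
    · refine eq_one_of_scale_of_add (C := fun r => ⁅X i j hij r, X k l hkl s⁆) hadd
        (fun a r => ?_) r
      have := conj_eq_of_central (hcen r) (y i a)
      rwa [conj_commutator, X1, X3 _ _ _ _ hik hil] at this
  refine ⟨St.lift X Xadd hone ?_, ?_⟩
  · intro i j k hij hjk hik r s
    have hcen : ∀ r, ⁅X i j hij r, X j k hjk s⁆ * (X i k hik (r * s))⁻¹ ∈ Subgroup.center D :=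
      fun r => hc (by
        rw [MonoidHom.mem_ker, map_mul, map_inv, map_commutatorElement, hX, hX, hX,
          ← map_commutatorElement, St.x_comm i j k hij hjk hik, mul_inv_cancel])
    rw [← mul_inv_eq_one]
    -- The defect of the relation is central and additive in r. It is invariant under r ↦ ar,
    -- because d_i(a) scales both x_{ij}(r) and x_{ik}(rs) and fixes x_{jk}(s).
    refine eq_one_of_scale_of_add
      (C := fun r => ⁅X i j hij r, X j k hjk s⁆ * (X i k hik (r * s))⁻¹) (fun r r' => ?_)
      (fun a r => ?_) r
    · have e1 : ⁅X i j hij (r + r'), X j k hjk s⁆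
          = X i j hij r * ⁅X i j hij r', X j k hjk s⁆ * (X i j hij r)⁻¹
            * ⁅X i j hij r, X j k hjk s⁆ := by
        rw [Xadd]; simp only [commutatorElement_def]; group
      obtain ⟨z, hz⟩ : ∃ z, z = ⁅X i j hij r, X j k hjk s⁆ * (X i k hik (r * s))⁻¹ := ⟨_, rfl⟩
      obtain ⟨z', hz'⟩ : ∃ z, z = ⁅X i j hij r', X j k hjk s⁆ * (X i k hik (r' * s))⁻¹ := ⟨_, rfl⟩
      have cz := hcen r
      have cz' := hcen r'
      rw [← hz] at cz
      rw [← hz'] at cz'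
      have f1 : ⁅X i j hij r, X j k hjk s⁆ = z * X i k hik (r * s) := by rw [hz]; group
      have f2 : ⁅X i j hij r', X j k hjk s⁆ = z' * X i k hik (r' * s) := by rw [hz']; group
      have cc : X i j hij r * X i k hik (r' * s) = X i k hik (r' * s) * X i j hij r :=
        commutatorElement_eq_one_iff_mul_comm.1 (hone i j i k hij hik hij.symm hik _ _)
      rw [e1, f1, f2, add_mul, Xadd, mul_inv_cancel_right, mul_inv_cancel_right,
        ← mul_assoc (X i j hij r), Subgroup.mem_center_iff.1 cz', mul_assoc z' _ (X i k hik _), cc,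
        ← mul_assoc z', mul_inv_cancel_right, mul_assoc z', ← mul_assoc _ z,
        Subgroup.mem_center_iff.1 cz, mul_assoc z, ← Xadd, add_comm (r' * s), Xadd,
        ← mul_assoc z', mul_inv_cancel_right]
      exact Subgroup.mem_center_iff.1 cz z'
    · have := conj_eq_of_central (hcen r) (y i a)
      have e : ∀ u v : D, y i a * (u * v⁻¹) * (y i a)⁻¹
          = (y i a * u * (y i a)⁻¹) * (y i a * v * (y i a)⁻¹)⁻¹ := fun u v => by group
      rw [e, conj_commutator, X1, X1, X3 j k hjk i hij hik] at this
      rw [← this, mul_assoc]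
  · intro s
    refine DFunLike.congr_fun (f := p.comp (St.lift X Xadd hone _)) (g := E)
      (St.hom_ext fun i j h r => ?_) s
    rw [MonoidHom.comp_apply, St.lift_x, hX]

end SteinbergLift

/-! ### The index extension of `bigGroup` and the Steinberg group -/

theorem stabGL_smul {K : Type*} [Field K] (g : GL (Fin 2) K) (v : ℕ →₀ K) :
    stabGL K g • v = v + Finsupp.single 0 ((g 0 0 - 1) * v 0 + g 0 1 * v 1)
      + Finsupp.single 1 (g 1 0 * v 0 + (g 1 1 - 1) * v 1) := by
  change (1 + corner ((g : Matrix (Fin 2) (Fin 2) K) - 1) : MatInf K) v = _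
  simp [corner, entry, Fin.sum_univ_two, add_assoc]

theorem stabGL_upperLeft {K : Type*} [Field K] (a : Kˣ) :
    stabGL K (upperLeft K a) = diagUnit K 0 a := by
  ext1
  refine LinearMap.ext fun v => ?_
  refine (stabGL_smul (upperLeft K a) v).trans (Eq.trans ?_ (diagUnit_smul 0 a v).symm)
  simp [coe_upperLeft]

theorem stabGL_lowerRight {K : Type*} [Field K] (a : Kˣ) :
    stabGL K (lowerRight K a) = diagUnit K 1 a := by
  ext1
  refine LinearMap.ext fun v => ?_
  refine (stabGL_smul (lowerRight K a) v).trans (Eq.trans ?_ (diagUnit_smul 1 a v).symm)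
  simp [coe_lowerRight]

theorem stabGL_smul_stdLattice {K : Type*} [Field K] {R : Subring K} {g : GL (Fin 2) K}
    (hg : g ∈ GL2sub R) : stabGL K g • stdLattice R = stdLattice R := by
  have key : ∀ g ∈ GL2sub R, stabGL K g • stdLattice R ≤ stdLattice R := by
    rintro _ ⟨γ, rfl⟩ _ ⟨v, hv, rfl⟩
    have hR : ∀ i j, (Matrix.GeneralLinearGroup.map R.subtype γ) i j ∈ R := fun i j => by
      simp
    change stabGL K _ • v ∈ _
    rw [stabGL_smul]
    refine add_mem (add_mem hv (single_mem_stdLattice _ ?_)) (single_mem_stdLattice _ ?_)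
    · exact R.add_mem (R.mul_mem (R.sub_mem (hR _ _) R.one_mem) (hv _)) (R.mul_mem (hR _ _) (hv _))
    · exact R.add_mem (R.mul_mem (hR _ _) (hv _)) (R.mul_mem (R.sub_mem (hR _ _) R.one_mem) (hv _))
  refine le_antisymm (key g hg) ?_
  have := key g⁻¹ (inv_mem hg)
  rw [map_inv] at this
  intro v hv
  rw [mem_smul_iff]
  exact this (AddSubgroup.smul_mem_pointwise_smul _ _ _ hv)

theorem diagUnit_conj_elemMat {K : Type*} [Field K] (k i j : ℕ) (h : i ≠ j) (a : Kˣ) (r s : K)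
    (hs : s = (if k = i then (a : K) else 1) * r * (if k = j then ((a⁻¹ : Kˣ) : K) else 1)) :
    diagUnit K k a * elemMat i j h r * (diagUnit K k a)⁻¹ = elemMat i j h s := by
  rw [mul_inv_eq_iff_eq_mul]
  ext1
  refine LinearMap.ext fun v => ?_
  change diagUnit K k a • elemMat i j h r • v = elemMat i j h s • diagUnit K k a • v
  rw [elemMat_smul, elemMat_smul]
  ext l
  rw [Finsupp.add_apply, diagUnit_smul_apply, diagUnit_smul_apply, diagUnit_smul_apply,
    Finsupp.add_apply, Finsupp.single_apply, Finsupp.single_apply, hs]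
  have ha := a.ne_zero
  split_ifs
  all_goals first
    | (exfalso; omega)
    | (simp only [Units.val_inv_eq_inv_val]; field_simp)
    | skip
  all_goals try ring

theorem toSL_h_eq {K : Type*} [Field K] (i j : ℕ) (h : i ≠ j) (a : Kˣ) :
    St.toSL (St.h i j h a) = diagUnit K i a * diagUnit K j a⁻¹ := by
  ext1
  rw [St.toSL_h]
  change _ = (1 + entry i i ((a : K) - 1) : MatInf K) * (1 + entry j j (((a⁻¹ : Kˣ) : K) - 1))
  simp only [mul_add, add_mul, mul_one, one_mul, entry_mul_of_ne _ _ _ _ h]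
  simp only [sub_eq_add_neg, entry_add, entry_neg]
  abel

namespace LocalDatum

variable {K : Type*} [Field K] {O B : Subring K} {q : ℕ} {ν : Kˣ → Kˣ → ℤ}
variable (D : LocalDatum O B q ν)

theorem toSL_mem_bigGroup (s : St K) : St.toSL s ∈ D.bigGroup := by
  have : (⊤ : Subgroup (St K)) ≤ D.bigGroup.comap St.toSL := by
    rw [← St.closure_generators, Subgroup.closure_le]
    rintro _ ⟨i, j, h, r, rfl⟩
    rw [SetLike.mem_coe, Subgroup.mem_comap, St.toSL_x]
    exact elemMat_mem_bigGroup i j h r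
  exact this (Subgroup.mem_top s)

/-- The homomorphism `St(K) → bigGroup`. -/
def ofSt : St K →* D.bigGroup := St.toSL.codRestrict _ D.toSL_mem_bigGroup

theorem torus_conj_ofSt (k i j : ℕ) (h : i ≠ j) (a : Kˣ) (r s : K)
    (hs : s = (if k = i then (a : K) else 1) * r * (if k = j then ((a⁻¹ : Kˣ) : K) else 1)) :
    (D.torus k a * D.ofSt (St.x i j h r) * (D.torus k a)⁻¹).1 = (D.ofSt (St.x i j h s)).1 := by
  change diagUnit K k a * St.toSL (St.x i j h r) * (diagUnit K k a)⁻¹ = St.toSL (St.x i j h s)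
  rw [St.toSL_x, St.toSL_x]
  exact diagUnit_conj_elemMat k i j h a r s hs

theorem exists_steinberg_lift : ∃ Φ : St K →* D.indexCocycle.Ext, ∀ s, (Φ s).base = D.ofSt s := by
  have := D.infinite
  refine St.exists_lift (p := D.indexCocycle.proj) D.indexCocycle.ker_proj_le
    D.indexCocycle.proj_surjective D.ofSt D.torus D.torus_comm ?_ ?_ ?_
  · intro i j h a r
    exact Subtype.ext (D.torus_conj_ofSt i i j h a r _ (by simp [h]))
  · intro i j h a r
    exact Subtype.ext (D.torus_conj_ofSt j i j h a r _ (by simp [h.symm, mul_comm]))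
  · intro i j h k hi hj a r
    exact Subtype.ext (D.torus_conj_ofSt k i j h a r _ (by simp [hi, hj]))

/-- The commutator of two elements over the torus, in terms of the index cocycle. -/
theorem commutator_torus_of_ne {i j : ℕ} (hij : i ≠ j) {a b : Kˣ} {X Y : D.indexCocycle.Ext}
    (hX : X.base = D.torus i a) (hY : Y.base = D.torus j b) : ⁅X, Y⁆ = 1 := by
  rw [NormCocycle.commutator_eq _ (by rw [hX, hY]; exact D.torus_comm i j a b), hX, hY,
    D.indexCocycle_torus_of_ne hij, D.indexCocycle_torus_of_ne hij.symm, sub_self, ofAdd_zero,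
    map_one]

/-- The homomorphism of `K₂(K)` defined by the index extension. -/
theorem exists_K2_hom (D : LocalDatum O B q ν) : ∃ φ : K2 K →* Multiplicative ℝ, ∀ f g : Kˣ,
    φ (symbol f g) = Multiplicative.ofAdd (-(ν f g : ℝ) * Real.log q) := by
  obtain ⟨Φ, hΦ⟩ := D.exists_steinberg_lift
  have hbase : ∀ k : K2 K, (Φ k.1).base = 1 := fun k => by
    rw [hΦ]; exact Subtype.ext k.2
  have hmem : ∀ k : K2 K, Φ k.1 = D.indexCocycle.incl (Multiplicative.ofAdd (Φ k.1).fib) :=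
    fun k => NormCocycle.Ext.ext (hbase k) rfl
  refine ⟨MonoidHom.mk' (fun k => Multiplicative.ofAdd (Φ k.1).fib) fun k l =>
    D.indexCocycle.extension.inl_injective ?_, fun f g => ?_⟩
  · change D.indexCocycle.incl _ = D.indexCocycle.incl _
    rw [map_mul, ← hmem, ← hmem, ← hmem, Subgroup.coe_mul, map_mul]
  · refine D.indexCocycle.extension.inl_injective ?_
    change D.indexCocycle.incl (Multiplicative.ofAdd _) = D.indexCocycle.incl _
    rw [← hmem]
    change Φ ⁅St.h 0 1 (by decide) f, St.h 0 2 (by decide) g⁆ = _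
    rw [map_commutatorElement]
    have hc := D.indexCocycle.ker_proj_le
    let L : ℕ → Kˣ → D.indexCocycle.Ext := fun i a => ⟨D.torus i a, 0⟩
    -- The images of h₀₁(f) and h₀₂(g) are d₀(f) d₁(f⁻¹) and d₀(g) d₂(g⁻¹). Lifts of torus elements
    -- at different places commute, so only the commutator at the place 0 survives.
    have h1 : ⁅Φ (St.h 0 1 (by decide) f), Φ (St.h 0 2 (by decide) g)⁆
        = ⁅L 1 f⁻¹ * L 0 f, L 2 g⁻¹ * L 0 g⁆ := by
      refine commutator_congr hc ?_ ?_
      · change (Φ _).base = D.torus 1 f⁻¹ * D.torus 0 f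
        rw [hΦ, (D.torus_comm 1 0 _ _).eq]
        exact Subtype.ext (toSL_h_eq 0 1 _ f)
      · change (Φ _).base = D.torus 2 g⁻¹ * D.torus 0 g
        rw [hΦ, (D.torus_comm 2 0 _ _).eq]
        exact Subtype.ext (toSL_h_eq 0 2 _ g)
    have c10 : ∀ a b, ⁅L 1 a, L 0 b⁆ = 1 := fun a b =>
      D.commutator_torus_of_ne (by decide) rfl rfl
    have c12 : ∀ a b, ⁅L 1 a, L 2 b⁆ = 1 := fun a b =>
      D.commutator_torus_of_ne (by decide) rfl rfl
    have c02 : ∀ a b, ⁅L 0 a, L 2 b⁆ = 1 := fun a b =>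
      D.commutator_torus_of_ne (by decide) rfl rfl
    have c00 : ⁅L 0 f, L 0 g⁆ = D.indexCocycle.incl (Multiplicative.ofAdd (D.torusPairing f g)) :=
      D.commutator_torus rfl rfl
    have cen : ⁅L 0 f, L 0 g⁆ ∈ Subgroup.center D.indexCocycle.Ext := by
      rw [c00]; exact D.indexCocycle.isCentral_extension ⟨_, rfl⟩
    have h2 : ⁅L 0 f, L 2 g⁻¹ * L 0 g⁆ = ⁅L 0 f, L 0 g⁆ := by
      rw [commutator_mul_right_of_central cen, c02, one_mul]
    have h3 : ⁅L 1 f⁻¹, L 2 g⁻¹ * L 0 g⁆ = 1 := by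
      rw [commutator_mul_right_of_central (by rw [c10]; exact one_mem _), c12, c10, one_mul]
    rw [h1, commutator_mul_left_of_central (by rw [h2]; exact cen), h2, h3, one_mul, c00,
      torusPairing_eq]

theorem stabGL_mem_bigGroup (g : GL (Fin 2) K) : stabGL K g ∈ D.bigGroup := by
  have hd : (g * (upperLeft K g.det)⁻¹).det = 1 := by
    rw [map_mul, map_inv, det_upperLeft, mul_inv_cancel]
  obtain ⟨s, hs⟩ := exists_lift_SL2 _ hd
  have : stabGL K g = St.toSL s * diagUnit K 0 g.det := by
    rw [hs, ← stabGL_upperLeft, ← map_mul, inv_mul_cancel_right]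
  rw [this]
  exact mul_mem (D.toSL_mem_bigGroup s) (diagUnit_mem_bigGroup 0 _)

/-- The homomorphism `GL₂(K) → bigGroup`. -/
def ofGL2 : GL (Fin 2) K →* D.bigGroup := (stabGL K).codRestrict _ D.stabGL_mem_bigGroup

/-- The cocycle on `GL₂(K)` defined by the index cocycle, trivialized on `K^*`. -/
def GL2cocycle : NormCocycle (GL (Fin 2) K) :=
  (D.indexCocycle.comap D.ofGL2).diff
    (D.indexCocycle.comap ((D.torus 0).comp Matrix.GeneralLinearGroup.det))

theorem GL2cocycle_apply (g h : GL (Fin 2) K) : D.GL2cocycle g h =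
    D.indexCocycle (D.ofGL2 g) (D.ofGL2 h) - D.indexCocycle (D.torus 0 g.det) (D.torus 0 h.det) :=
  rfl

theorem isUnitOf_det {R : Subring K} {g : GL (Fin 2) K} (hg : g ∈ GL2sub R) :
    IsUnitOf R g.det := by
  have key : ∀ g ∈ GL2sub R, ((g.det : Kˣ) : K) ∈ R := by
    rintro _ ⟨γ, rfl⟩
    rw [Matrix.GeneralLinearGroup.map_det]
    simp
  exact ⟨key g hg, by rw [← map_inv]; exact key _ (inv_mem hg)⟩

theorem GL2cocycle_splits_integral : SplitsOver D.GL2cocycle.extension (GL2sub O) :=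
  NormCocycle.splitsOver_extension _ fun g hg h hh => by
    rw [GL2cocycle_apply,
      D.indexCocycle_of_integral (g := D.ofGL2 g) (stabGL_smul_stdLattice hg),
      D.indexCocycle_of_integral (g := D.torus 0 g.det)
        (diagUnit_smul_stdLattice 0 (isUnitOf_det hg)), sub_self]

theorem GL2cocycle_splits_B : SplitsOver D.GL2cocycle.extension (GL2sub B) :=
  NormCocycle.splitsOver_extension _ fun g hg h hh => by
    rw [GL2cocycle_apply,
      D.indexCocycle_of_B (h := D.ofGL2 h) (stabGL_smul_stdLattice hh),
      D.indexCocycle_of_B (h := D.torus 0 h.det)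
        (diagUnit_smul_stdLattice 0 (isUnitOf_det hh)), sub_self]

theorem ofGL2_upperLeft (a : Kˣ) : D.ofGL2 (upperLeft K a) = D.torus 0 a :=
  Subtype.ext (stabGL_upperLeft a)

theorem ofGL2_lowerRight (a : Kˣ) : D.ofGL2 (lowerRight K a) = D.torus 1 a :=
  Subtype.ext (stabGL_lowerRight a)

theorem det_lowerRight (a : Kˣ) : (lowerRight K a).det = a := by
  ext; simp [coe_lowerRight]

theorem GL2cocycle_splits_upperLeft : SplitsOver D.GL2cocycle.extension (upperLeft K).range :=
  NormCocycle.splitsOver_extension _ fun g hg h hh => by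
    obtain ⟨a, rfl⟩ := hg
    obtain ⟨b, rfl⟩ := hh
    rw [GL2cocycle_apply, ofGL2_upperLeft, ofGL2_upperLeft, det_upperLeft, det_upperLeft, sub_self]

/-- The two diagonal matrices act on different coordinates, so the index cocycle contributes
nothing. The value comes from the subtracted pullback along the determinant, hence the sign opposite
to `torusPairing_eq`. -/
theorem GL2cocycle_diag_commutator (a b : Kˣ) : ∃ x y : D.GL2cocycle.Ext,
    D.GL2cocycle.extension.rightHom x = upperLeft K a ∧
    D.GL2cocycle.extension.rightHom y = lowerRight K b ∧
    ⁅x, y⁆ = D.GL2cocycle.extension.inl (Multiplicative.ofAdd ((ν a b : ℝ) * Real.log q)) := by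
  refine ⟨⟨upperLeft K a, 0⟩, ⟨lowerRight K b, 0⟩, rfl, rfl, ?_⟩
  rw [NormCocycle.commutator_eq _ (diag_comm a b), GL2cocycle_apply, GL2cocycle_apply,
    ofGL2_upperLeft, ofGL2_lowerRight, det_upperLeft, det_lowerRight,
    D.indexCocycle_torus_of_ne (i := 0) (j := 1) (by decide),
    D.indexCocycle_torus_of_ne (i := 1) (j := 0) (by decide)]
  have := D.torusPairing_eq a b
  rw [torusPairing] at this
  change D.GL2cocycle.incl _ = D.GL2cocycle.incl _
  congr 2
  linarith

end LocalDatum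

end TwoDim
end

noncomputable section

namespace TwoDim

open scoped commutatorElement

/-! ### Diagonal commutators in an extension with the three splittings -/

theorem mem_GL2sub {K : Type*} [Field K] {R : Subring K} {g : GL (Fin 2) K}
    (h : ∀ i j, g i j ∈ R) (h' : ∀ i j, g⁻¹ i j ∈ R) : g ∈ GL2sub R := by
  refine ⟨⟨Matrix.of fun i j => ⟨g i j, h i j⟩, Matrix.of fun i j => ⟨g⁻¹ i j, h' i j⟩, ?_, ?_⟩, ?_⟩
  · ext i j
    have := congrArg (fun M : GL (Fin 2) K => M i j) (mul_inv_cancel g)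
    simp only [Units.val_mul, Units.val_one, Matrix.mul_apply, Matrix.one_apply] at this
    simpa [Matrix.mul_apply, Matrix.one_apply, apply_ite] using this
  · ext i j
    have := congrArg (fun M : GL (Fin 2) K => M i j) (inv_mul_cancel g)
    simp only [Units.val_mul, Units.val_one, Matrix.mul_apply, Matrix.one_apply] at this
    simpa [Matrix.mul_apply, Matrix.one_apply, apply_ite] using this
  · ext i j; rfl

section Subring

variable {K : Type*} [Field K] {R : Subring K}

theorem upperLeft_mem {a : Kˣ} (ha : IsUnitOf R a) : upperLeft K a ∈ GL2sub R := by
  refine mem_GL2sub (fun i j => ?_) (fun i j => ?_)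
  · rw [coe_upperLeft]; fin_cases i <;> fin_cases j <;> simp [ha.1]
  · rw [← map_inv, coe_upperLeft]; fin_cases i <;> fin_cases j <;> simp
    simpa using ha.2

theorem lowerRight_mem {a : Kˣ} (ha : IsUnitOf R a) : lowerRight K a ∈ GL2sub R := by
  refine mem_GL2sub (fun i j => ?_) (fun i j => ?_)
  · rw [coe_lowerRight]; fin_cases i <;> fin_cases j <;> simp [ha.1]
  · rw [← map_inv, coe_lowerRight]; fin_cases i <;> fin_cases j <;> simp
    simpa using ha.2

theorem upperUni_inv (r : K) : (upperUni r)⁻¹ = upperUni (-r) := by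
  ext i j; rfl

theorem lowerUni_inv (r : K) : (lowerUni r)⁻¹ = lowerUni (-r) := by
  ext i j; rfl

theorem upperUni_mem {r : K} (hr : r ∈ R) : upperUni r ∈ GL2sub R := by
  refine mem_GL2sub (fun i j => ?_) (fun i j => ?_)
  · rw [coe_upperUni]; fin_cases i <;> fin_cases j <;> simp [hr]
  · rw [upperUni_inv, coe_upperUni]; fin_cases i <;> fin_cases j <;> simp [hr]

theorem lowerUni_mem {r : K} (hr : r ∈ R) : lowerUni r ∈ GL2sub R := by
  refine mem_GL2sub (fun i j => ?_) (fun i j => ?_)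
  · rw [coe_lowerUni]; fin_cases i <;> fin_cases j <;> simp [hr]
  · rw [lowerUni_inv, coe_lowerUni]; fin_cases i <;> fin_cases j <;> simp [hr]

/-- The Gauss decomposition of lower times upper as upper times diagonal times lower. The diagonal
part depends only on the product bc, so a factor t may be attached to either entry. -/
theorem lowerUni_mul_upperUni (m : Kˣ) (b c : K) (hm : (m : K) = 1 + b * c) :
    lowerUni c * upperUni b = upperUni (b * (m⁻¹ : Kˣ)) * (upperLeft K m⁻¹ * lowerRight K m)
      * lowerUni (c * (m⁻¹ : Kˣ)) := by
  have h0 := m.ne_zero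
  ext i j
  simp only [Units.val_mul, coe_lowerUni, coe_upperUni, coe_upperLeft, coe_lowerRight]
  fin_cases i <;> fin_cases j <;> simp <;> field_simp <;> rw [hm]
  all_goals ring

theorem upperLeft_commutator_upperUni (a : Kˣ) (r : K) :
    ⁅upperLeft K a, upperUni r⁆ = upperUni ((a - 1) * r) := by
  rw [commutatorElement_def, upperLeft_upperUni, upperUni_inv, ← upperUni_add]
  congr 1; ring

theorem upperLeft_commutator_lowerUni (a : Kˣ) (r : K) :
    ⁅upperLeft K a⁻¹, lowerUni r⁆ = lowerUni ((a - 1) * r) := by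
  rw [commutatorElement_def, upperLeft_lowerUni, lowerUni_inv, ← lowerUni_add]
  congr 1; ring

end Subring

section Pairing

variable {K : Type*} [Field K] {O B : Subring K} {q : ℕ} {ν : Kˣ → Kˣ → ℤ}
variable {A E : Type*} [CommGroup A] [Group E] {S : GroupExtension A E (GL (Fin 2) K)}

theorem SplitsOver.commute {A E G : Type*} [Group A] [Group E] [Group G]
    {S : GroupExtension A E G} (h : IsCentral S) {H : Subgroup G} (hs : SplitsOver S H) {x y : E}
    (hx : S.rightHom x ∈ H) (hy : S.rightHom y ∈ H)
    (hxy : Commute (S.rightHom x) (S.rightHom y)) : ⁅x, y⁆ = 1 := by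
  obtain ⟨s, hs⟩ := hs
  have : ⁅x, y⁆ = ⁅s ⟨_, hx⟩, s ⟨_, hy⟩⁆ := commutator_congr h.ker_le (hs ⟨_, hx⟩).symm (hs ⟨_, hy⟩).symm
  rw [this, ← map_commutatorElement]
  have e : ⁅(⟨_, hx⟩ : H), (⟨_, hy⟩ : H)⁆ = 1 := by
    rw [commutatorElement_eq_one_iff_mul_comm]
    exact Subtype.ext hxy
  rw [e, map_one]

theorem SplitsOver.map {A₀ E₀ A E G : Type*} [Group A₀] [Group E₀] [Group A] [Group E] [Group G]
    {S₀ : GroupExtension A₀ E₀ G} {φ : A₀ →* A} {S : GroupExtension A E G} {H : Subgroup G}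
    (hs : SplitsOver S₀ H) (h : ObtainedBy S₀ φ S) : SplitsOver S H := by
  obtain ⟨s, hs⟩ := hs
  obtain ⟨F, -, hF⟩ := h
  exact ⟨F.comp s, fun x => (hF _).trans (hs x)⟩

/-- Over `GL₂(O)`, the lifts of `diag(t, 1)` and `diag(1, m)` commute for `m ∈ 1 + tO`. -/
theorem commutator_t_one_add (D : LocalDatum O B q ν) (h : IsCentral S)
    (hO : SplitsOver S (GL2sub O)) (hK : SplitsOver S (upperLeft K).range) {m : Kˣ}
    (hm : ∃ y ∈ O, (m : K) = 1 + D.t * y) {x y : E} (hx : S.rightHom x = upperLeft K D.t)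
    (hy : S.rightHom y = lowerRight K m) : ⁅x, y⁆ = 1 := by
  have hc := h.ker_le
  have hmO := D.isUnitOf_one_add hm
  obtain ⟨c, hcO, hmc⟩ := hm
  obtain ⟨σ, hσ⟩ := hO
  obtain ⟨v, hv, huv⟩ := D.one_sub_u
  -- Although diag(t, 1) is not in GL₂(O), its lift x transports σ on unipotents. Since u - 1 is a
  -- unit of O, these are commutators with diag(u, 1) inside GL₂(O), and a commutator depends only
  -- on the images in GL₂(K).
  have cu : ∀ r (hr : r ∈ O), x * σ ⟨upperUni r, upperUni_mem hr⟩ * x⁻¹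
      = σ ⟨upperUni (D.t * r), upperUni_mem (O.mul_mem D.t_mem hr)⟩ := by
    intro r hr
    have hvr := O.mul_mem hv hr
    have e1 : (⟨upperUni r, upperUni_mem hr⟩ : GL2sub O)
        = ⁅(⟨upperLeft K D.u, upperLeft_mem D.isUnitOf_u⟩ : GL2sub O), ⟨upperUni (v * r), upperUni_mem hvr⟩⁆ := by
      refine Subtype.ext ?_
      refine Eq.trans ?_ (upperLeft_commutator_upperUni D.u (v * r)).symm
      rw [← mul_assoc, huv, one_mul]
    have e2 : (⟨upperUni (D.t * r), upperUni_mem (O.mul_mem D.t_mem hr)⟩ : GL2sub O)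
        = ⁅(⟨upperLeft K D.u, upperLeft_mem D.isUnitOf_u⟩ : GL2sub O),
          ⟨upperUni (D.t * (v * r)), upperUni_mem (O.mul_mem D.t_mem hvr)⟩⁆ := by
      refine Subtype.ext ?_
      refine Eq.trans ?_ (upperLeft_commutator_upperUni D.u (D.t * (v * r))).symm
      rw [mul_left_comm, ← mul_assoc ((D.u : K) - 1), huv, one_mul]
    rw [e1, e2, map_commutatorElement, map_commutatorElement, conj_commutator]
    refine commutator_congr hc ?_ ?_
    · rw [map_mul, map_mul, map_inv S.rightHom, hσ, hx, ← map_mul, mul_comm, map_mul,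
        mul_inv_cancel_right]
    · rw [map_mul, map_mul, map_inv, hσ, hσ, hx, upperLeft_upperUni]
  have cl : ∀ r (hr : r ∈ O), x * σ ⟨lowerUni (D.t * r), lowerUni_mem (O.mul_mem D.t_mem hr)⟩ * x⁻¹
      = σ ⟨lowerUni r, lowerUni_mem hr⟩ := by
    intro r hr
    have hvr := O.mul_mem hv hr
    have hu' : IsUnitOf O D.u⁻¹ := ⟨D.isUnitOf_u.2, by rw [inv_inv]; exact D.isUnitOf_u.1⟩
    have e1 : (⟨lowerUni r, lowerUni_mem hr⟩ : GL2sub O)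
        = ⁅(⟨upperLeft K D.u⁻¹, upperLeft_mem hu'⟩ : GL2sub O), ⟨lowerUni (v * r), lowerUni_mem hvr⟩⁆ := by
      refine Subtype.ext ?_
      refine Eq.trans ?_ (upperLeft_commutator_lowerUni D.u (v * r)).symm
      rw [← mul_assoc, huv, one_mul]
    have e2 : (⟨lowerUni (D.t * r), lowerUni_mem (O.mul_mem D.t_mem hr)⟩ : GL2sub O)
        = ⁅(⟨upperLeft K D.u⁻¹, upperLeft_mem hu'⟩ : GL2sub O),
          ⟨lowerUni (D.t * (v * r)), lowerUni_mem (O.mul_mem D.t_mem hvr)⟩⁆ := by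
      refine Subtype.ext ?_
      refine Eq.trans ?_ (upperLeft_commutator_lowerUni D.u (D.t * (v * r))).symm
      rw [mul_left_comm, ← mul_assoc ((D.u : K) - 1), huv, one_mul]
    rw [e1, e2, map_commutatorElement, map_commutatorElement, conj_commutator]
    refine commutator_congr hc ?_ ?_
    · rw [map_mul, map_mul, map_inv S.rightHom, hσ, hx, ← map_mul, mul_comm, map_mul,
        mul_inv_cancel_right]
    · have := upperLeft_lowerUni (D.t⁻¹) (D.t * (v * r))
      rw [inv_inv, Units.inv_mul_cancel_left] at this
      rw [map_mul, map_mul, map_inv, hσ, hσ, hx, this]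
  have hmi := hmO.2
  have hmO' : IsUnitOf O m⁻¹ := ⟨hmi, by rw [inv_inv]; exact hmO.1⟩
  -- the two factorizations
  have f1 : (⟨lowerUni (D.t * c), lowerUni_mem (O.mul_mem D.t_mem hcO)⟩ : GL2sub O)
      * ⟨upperUni 1, upperUni_mem O.one_mem⟩
      = ⟨upperUni (m⁻¹ : Kˣ), upperUni_mem hmi⟩
        * (⟨upperLeft K m⁻¹, upperLeft_mem hmO'⟩ * ⟨lowerRight K m, lowerRight_mem hmO⟩)
        * ⟨lowerUni (D.t * (c * (m⁻¹ : Kˣ))),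
          lowerUni_mem (O.mul_mem D.t_mem (O.mul_mem hcO hmi))⟩ := by
    refine Subtype.ext ?_
    refine (lowerUni_mul_upperUni m 1 (D.t * c) (by rw [hmc, one_mul])).trans ?_
    rw [one_mul, mul_assoc (D.t : K)]; rfl
  have f2 : (⟨lowerUni c, lowerUni_mem hcO⟩ : GL2sub O)
      * ⟨upperUni (D.t * 1), upperUni_mem (O.mul_mem D.t_mem O.one_mem)⟩
      = ⟨upperUni (D.t * (m⁻¹ : Kˣ)), upperUni_mem (O.mul_mem D.t_mem hmi)⟩
        * (⟨upperLeft K m⁻¹, upperLeft_mem hmO'⟩ * ⟨lowerRight K m, lowerRight_mem hmO⟩)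
        * ⟨lowerUni (c * (m⁻¹ : Kˣ)), lowerUni_mem (O.mul_mem hcO hmi)⟩ := by
    refine Subtype.ext ?_
    refine (lowerUni_mul_upperUni m (D.t * 1) c (by rw [hmc, mul_one])).trans ?_
    rw [mul_one]; rfl
  -- Conjugation by x turns the outer factors of the first identity into those of the second. After
  -- cancellation, x commutes with the lift of diag(m⁻¹, m); it commutes with the lift of diag(m⁻¹,
  -- 1) by the splitting over K^*, hence also with that of diag(1, m).
  have g1 := congrArg (fun z => x * σ z * x⁻¹) f1
  have g2 := congrArg σ f2
  have split : ∀ a b : E, x * (a * b) * x⁻¹ = (x * a * x⁻¹) * (x * b * x⁻¹) := fun a b => by group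
  simp only [map_mul, split] at g1
  simp only [map_mul] at g2
  rw [cl _ hcO, cu 1 O.one_mem, cu _ hmi, cl _ (O.mul_mem hcO hmi), ← split, g2, mul_left_inj,
    mul_right_inj, eq_comm, mul_inv_eq_iff_eq_mul, ← commutatorElement_eq_one_iff_mul_comm] at g1
  set X := σ ⟨upperLeft K m⁻¹, upperLeft_mem hmO'⟩ with hX
  set Y := σ ⟨lowerRight K m, lowerRight_mem hmO⟩ with hY
  have pX : S.rightHom X = upperLeft K m⁻¹ := hσ _
  have pY : S.rightHom Y = lowerRight K m := hσ _
  have c1 : ⁅x, X⁆ = 1 := hK.commute h ⟨_, hx.symm⟩ ⟨_, pX.symm⟩ (by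
    rw [hx, pX, Commute, SemiconjBy, ← map_mul, ← map_mul, mul_comm])
  have c2 : ⁅x, Y⁆ ∈ Subgroup.center E := hc (commutator_central_of_commute (by
    rw [hx, pY]; exact diag_comm _ _))
  have c3 : ⁅x, y⁆ = ⁅x, Y⁆ := commutator_congr hc rfl (hy.trans pY.symm)
  rw [commutator_mul_right_of_central c2, c1, one_mul] at g1
  rw [c3, g1]

/-- The commutators of the lifts of diagonal matrices, in a central extension that splits over
`GL₂(O)`, `GL₂(B)` and `K^*`. -/
theorem exists_diag_commutator_eq_zpow (D : LocalDatum O B q ν) (h : IsCentral S)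
    (hO : SplitsOver S (GL2sub O)) (hB : SplitsOver S (GL2sub B))
    (hK : SplitsOver S (upperLeft K).range) : ∃ z : A, ∀ a b x y, S.rightHom x = upperLeft K a →
      S.rightHom y = lowerRight K b → ⁅x, y⁆ = S.inl (z ^ (-ν a b)) := by
  have hc := h.ker_le
  choose X hX using fun a => S.rightHom_surjective (upperLeft K a)
  choose Y hY using fun a => S.rightHom_surjective (lowerRight K a)
  have hk : ∀ a b, ∃ k, S.inl k = ⁅X a, Y b⁆ := fun a b => exists_inl_of_rightHom
    (commutator_central_of_commute (by rw [hX, hY]; exact diag_comm a b))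
  choose c hcX using hk
  have hcc : ∀ a b x y, S.rightHom x = upperLeft K a → S.rightHom y = lowerRight K b →
      ⁅x, y⁆ = S.inl (c a b) := fun a b x y hx hy => by
    rw [hcX]; exact commutator_congr hc (by rw [hx, hX]) (by rw [hy, hY])
  have cen : ∀ k, S.inl k ∈ Subgroup.center E := fun k => h ⟨k, rfl⟩
  have inj := S.inl_injective
  refine ⟨c D.t D.u, fun a b x y hx hy => ?_⟩
  rw [hcc a b x y hx hy]
  congr 1
  refine D.pairing_eq (fun x x' y => ?_) (fun x y => ?_) (fun x y hx hy => ?_)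
    (fun x y hx hy => ?_) (fun m hm => ?_) a b
  · apply inj
    rw [map_mul, ← hcc (x * x') y (X x * X x') (Y y) (by rw [map_mul, hX, hX, map_mul]) (hY y),
      commutator_mul_left_of_central (by rw [← hcX]; exact cen _), hcX, hcX]
  · apply inj
    -- Conjugation by a lift of the Weyl element fixes the central commutator and exchanges diag(a,
    -- 1) with diag(1, a).
    obtain ⟨w, hw⟩ := S.rightHom_surjective (weyl K)
    have h1 := conj_eq_of_central (cen (c x y)) w
    rw [hcX, conj_commutator] at h1
    rw [map_inv, hcX x y, ← h1, commutatorElement_inv]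
    refine (hcc y x _ _ ?_ ?_).symm
    · rw [map_mul, map_mul, map_inv, hw, hY, weyl_lowerRight]
    · rw [map_mul, map_mul, map_inv, hw, hX, weyl_upperLeft]
  · apply inj
    rw [hcX, map_one]
    exact hO.commute h (by rw [hX]; exact upperLeft_mem hx) (by rw [hY]; exact lowerRight_mem hy)
      (by rw [hX, hY]; exact diag_comm _ _)
  · apply inj
    rw [hcX, map_one]
    exact hB.commute h (by rw [hX]; exact upperLeft_mem hx) (by rw [hY]; exact lowerRight_mem hy)
      (by rw [hX, hY]; exact diag_comm _ _)
  · apply inj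
    rw [hcX, map_one]
    exact commutator_t_one_add D h hO hK hm (hX _) (hY _)

end Pairing

/-! ### The criterion for extensions of GL₂(K) over a local datum -/

section Main

variable {K : Type*} [Field K] {O B : Subring K} {q : ℕ} {ν : Kˣ → Kˣ → ℤ}

/-- The homomorphism `x ↦ exp (a x)` from the additive group of `ℝ` to `ℂ^*`. -/
def expHom (a : ℂ) : Multiplicative ℝ →* ℂˣ :=
  MonoidHom.mk' (fun x => Units.mk0 (Complex.exp (a * (x.toAdd : ℝ))) (Complex.exp_ne_zero _))
    fun x y => by
      ext
      simp [mul_add, Complex.exp_add]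

theorem coe_expHom (a : ℂ) (x : ℝ) :
    (expHom a (Multiplicative.ofAdd x) : ℂ) = Complex.exp (a * x) := rfl

/-- Skew-symmetry is inherited from the commutator pairing, as log q ≠ 0. -/
theorem LocalDatum.nu_symm (D : LocalDatum O B q ν) (a b : Kˣ) : ν b a = -ν a b := by
  have h1 := D.torusPairing_eq a b
  have h2 := D.torusPairing_eq b a
  have h3 : D.torusPairing b a = -D.torusPairing a b := (neg_sub _ _).symm
  have hq : Real.log q ≠ 0 := (Real.log_pos (by exact_mod_cast D.one_lt_q)).ne'
  rw [h3, h1, ← neg_mul, mul_left_inj' hq, neg_neg] at h2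
  have : (ν b a : ℝ) = -(ν a b : ℝ) := by linarith
  exact_mod_cast this

/-- The characterization of the central extensions obtained from `\widehat{GL₂(K)}` by means of
powers of the pairing `ν`. -/
theorem LocalDatum.obtainedBy_iff (D : LocalDatum O B q ν) {E : Type*} [Group E]
    (S : GroupExtension ℂˣ E (GL (Fin 2) K)) (hS : IsCentral S) :
    (∃ (a : ℂ) (φ : K2 K →* ℂˣ),
        (∀ f g : Kˣ, ((φ (symbol f g) : ℂˣ) : ℂ) = (q : ℂ) ^ (-a * (ν f g : ℂ))) ∧
        ObtainedBy (GL2hat.extension K) φ S) ↔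
      SplitsOver S (GL2sub O) ∧ SplitsOver S (GL2sub B) ∧ SplitsOver S (upperLeft K).range := by
  have := D.infinite
  have hq0 : (q : ℂ) ≠ 0 := by have := D.one_lt_q; exact_mod_cast (by omega : q ≠ 0)
  have hlog : (Real.log q : ℂ) = Complex.log q := by
    rw [← Complex.natCast_log]
  have hlog0 : Complex.log q ≠ 0 := by
    rw [← hlog]
    exact_mod_cast (Real.log_pos (by exact_mod_cast D.one_lt_q)).ne'
  constructor
  · rintro ⟨a, φ, hφ, hob⟩
    have hK : SplitsOver S (upperLeft K).range := GL2hat.splitsOver_upperLeft.map hob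
    -- Both diagonal commutators at (u, v) are q^{aν(u, v)}: on one side exp(a · ν(u, v) log q), on
    -- the other the image q^{-aν(v, u)} of the symbol (v, u).
    have hob' : ObtainedBy D.GL2cocycle.extension (expHom a) S := by
      refine obtainedBy_of_diag_commutator D.GL2cocycle.isCentral_extension hS _
        D.GL2cocycle_splits_upperLeft hK fun u v => ?_
      obtain ⟨x, y, hx, hy, hxy⟩ := D.GL2cocycle_diag_commutator u v
      obtain ⟨x', y', hx', hy', hxy'⟩ := GL2hat.diag_commutator u v
      obtain ⟨F, hF, hF'⟩ := hob
      refine ⟨x, y, F x', F y', _, hx, hy, by rw [hF', hx'], by rw [hF', hy'], hxy, ?_⟩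
      rw [← map_commutatorElement, hxy', hF]
      congr 1
      ext
      rw [hφ, coe_expHom, D.nu_symm u v, Complex.cpow_def_of_ne_zero hq0, ← hlog]
      congr 1
      push_cast; ring
    exact ⟨D.GL2cocycle_splits_integral.map hob', D.GL2cocycle_splits_B.map hob', hK⟩
  · rintro ⟨hO, hB, hK⟩
    obtain ⟨z, hz⟩ := exists_diag_commutator_eq_zpow D hS hO hB hK
    obtain ⟨φ₀, hφ₀⟩ := D.exists_K2_hom
    -- Solves q^{-a} = z, where z is the commutator for (t, u).
    obtain ⟨a, ha⟩ : ∃ a : ℂ, Complex.exp (-a * Complex.log q) = z :=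
      ⟨-(Complex.log z / Complex.log q), by
        rw [neg_neg, div_mul_cancel₀ _ hlog0, Complex.exp_log z.ne_zero]⟩
    have hφ : ∀ f g : Kˣ, (((expHom a).comp φ₀ (symbol f g) : ℂˣ) : ℂ)
        = Complex.exp (-a * Complex.log q * ν f g) := fun f g => by
      rw [MonoidHom.comp_apply, hφ₀, coe_expHom, ← hlog]
      congr 1
      push_cast; ring
    refine ⟨a, (expHom a).comp φ₀, fun f g => ?_, ?_⟩
    · rw [hφ, Complex.cpow_def_of_ne_zero hq0]
      congr 1; ring
    · refine obtainedBy_of_diag_commutator GL2hat.isCentral hS _ GL2hat.splitsOver_upperLeft hK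
        fun u v => ?_
      obtain ⟨x, y, hx, hy, hxy⟩ := GL2hat.diag_commutator u v
      obtain ⟨x', hx'⟩ := S.rightHom_surjective (upperLeft K u)
      obtain ⟨y', hy'⟩ := S.rightHom_surjective (lowerRight K v)
      refine ⟨x, y, x', y', _, hx, hy, hx', hy', hxy, ?_⟩
      -- The symbol (v, u) goes to q^{-aν(v, u)} = z^{ν(v, u)} = z^{-ν(u, v)}.
      rw [hz u v x' y' hx' hy']
      congr 1
      ext
      rw [hφ, D.nu_symm u v, Units.val_zpow_eq_zpow_val, ← ha, ← Complex.exp_int_mul]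
      congr 1
      push_cast; ring

end Main

end TwoDim
end

noncomputable section

namespace TwoDim

/-! ### Two-dimensional local fields from residue data -/

/-- The subring `A` is the valuation ring of the discrete valuation `v`, with uniformizer `ϖ`. -/
structure Uniformized {κ : Type*} [Field κ] (A : Subring κ) (v : κ → ℤ) (ϖ : κˣ) : Prop where
  map_mul : ∀ x y, x ≠ 0 → y ≠ 0 → v (x * y) = v x + v y
  map_uniformizer : v ϖ = 1
  mem_iff : ∀ x, x ≠ 0 → (x ∈ A ↔ 0 ≤ v x)

namespace Uniformized

variable {κ : Type*} [Field κ] {A : Subring κ} {v : κ → ℤ} {ϖ : κˣ}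

/-- The valuation as a homomorphism. -/
def hom (h : Uniformized A v ϖ) : κˣ →* Multiplicative ℤ :=
  MonoidHom.mk' (fun x => Multiplicative.ofAdd (v x)) fun x y => by
    rw [Units.val_mul, h.map_mul _ _ x.ne_zero y.ne_zero, ofAdd_add]

theorem map_one (h : Uniformized A v ϖ) : v 1 = 0 := congrArg Multiplicative.toAdd (_root_.map_one h.hom)

theorem map_inv (h : Uniformized A v ϖ) (x : κˣ) : v (x⁻¹ : κˣ) = -v x :=
  congrArg Multiplicative.toAdd (_root_.map_inv h.hom x)

theorem map_zpow (h : Uniformized A v ϖ) (x : κˣ) (n : ℤ) : v ((x ^ n : κˣ) : κ) = n * v x := by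
  have := congrArg Multiplicative.toAdd (_root_.map_zpow h.hom x n)
  rw [toAdd_zpow, smul_eq_mul] at this
  exact this

theorem isUnitOf_iff (h : Uniformized A v ϖ) (x : κˣ) : IsUnitOf A x ↔ v x = 0 := by
  rw [IsUnitOf, h.mem_iff _ x.ne_zero, h.mem_iff _ (x⁻¹).ne_zero, h.map_inv]
  omega

theorem uniformizer_mem (h : Uniformized A v ϖ) : (ϖ : κ) ∈ A := by
  rw [h.mem_iff _ ϖ.ne_zero, h.map_uniformizer]; exact zero_le_one

/-- A nonunit of `A` is a multiple of the uniformizer. -/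
theorem exists_eq_mul (h : Uniformized A v ϖ) {x : κ} (hx : x ∈ A) (hv : v x ≠ 0) : ∃ y ∈ A, x = ϖ * y := by
  by_cases h0 : x = 0
  · exact ⟨0, A.zero_mem, by rw [h0, mul_zero]⟩
  refine ⟨(ϖ⁻¹ : κˣ) * x, ?_, (Units.mul_inv_cancel_left _ _).symm⟩
  have h1 := (h.mem_iff x h0).1 hx
  rw [h.mem_iff _ (mul_ne_zero (Units.ne_zero _) h0), h.map_mul _ _ (Units.ne_zero _) h0, h.map_inv,
    h.map_uniformizer]
  omega

theorem uniformizer_mul_ne_one (h : Uniformized A v ϖ) {y : κ} (hy : y ∈ A) : (ϖ : κ) * y ≠ 1 := fun e => by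
  have h0 : y ≠ 0 := fun h0 => by rw [h0, mul_zero] at e; exact zero_ne_one e
  have h1 := congrArg v e
  rw [h.map_mul _ _ ϖ.ne_zero h0, h.map_one, h.map_uniformizer] at h1
  have := (h.mem_iff y h0).1 hy
  omega

/-- The ultrametric inequality is not among the assumptions; A being a subring replaces it. If 1 +
ϖy were not a unit of A, it would be a multiple of ϖ, and then so would 1. -/
theorem one_add_uniformizer_mul (h : Uniformized A v ϖ) {y : κ} (hy : y ∈ A) : ∃ z ∈ A, (1 + ϖ * y) * z = 1 := by
  have hm : 1 + ϖ * y ∈ A := A.add_mem A.one_mem (A.mul_mem h.uniformizer_mem hy)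
  by_cases hv : 1 + ϖ * y ≠ 0 ∧ v (1 + ϖ * y) = 0
  · refine ⟨_, ((h.isUnitOf_iff (Units.mk0 _ hv.1)).2 hv.2).2, Units.mul_inv (Units.mk0 _ hv.1)⟩
  · exfalso
    obtain ⟨z, hz, e⟩ : ∃ z ∈ A, 1 + ϖ * y = ϖ * z := by
      by_cases h0 : 1 + ϖ * y = 0
      · exact ⟨0, A.zero_mem, by rw [h0, mul_zero]⟩
      · exact h.exists_eq_mul hm fun hv' => hv ⟨h0, hv'⟩
    refine h.uniformizer_mul_ne_one (A.sub_mem hz hy) ?_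
    linear_combination -e

end Uniformized

theorem relIndex_eq_card {κ k : Type*} [Field κ] [Ring k] {A : Subring κ} (π : A →+* k)
    (hπ : Function.Surjective π) (J : AddSubgroup κ) (hJ : ∀ x : A, x.1 ∈ J ↔ π x = 0) :
    J.relIndex A.toAddSubgroup = Nat.card k := by
  have e : J.addSubgroupOf A.toAddSubgroup = π.toAddMonoidHom.ker := by
    ext x; exact hJ x
  rw [AddSubgroup.relIndex, e, AddSubgroup.index_ker]
  have : π.toAddMonoidHom.range = ⊤ := AddMonoidHom.range_eq_top.2 hπ
  rw [this, Nat.card_congr AddSubgroup.topEquiv.toEquiv]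

section Criterion

variable {K κ : Type*} [Field K] [Field κ]

/-- A two-dimensional local field with residue field `κ`, from the reduction homomorphism `ρ`. -/
theorem exists_localDatum {O B : Subring K} {q : ℕ} {w : K → ℤ} {t : Kˣ} (hO : Uniformized O w t)
    (htB : IsUnitOf B t) {A : Subring κ} {v : κ → ℤ} {ϖ : κˣ} (hA : Uniformized A v ϖ)
    (ρ : O →+* κ) (hρt : ρ ⟨t, hO.uniformizer_mem⟩ = 0)
    (hρB : ∀ x : O, x.1 ∈ B → ρ x ∈ A) (hsurj : ∀ a ∈ A, ∃ x : O, x.1 ∈ B ∧ ρ x = a)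
    (hunit : ∀ a : κˣ, IsUnitOf A a → ∃ (r : Kˣ) (hr : (r : K) ∈ O), IsUnitOf B r ∧
      ρ ⟨r, hr⟩ = a)
    {u : K} (huO : u ∈ O) (huB : u ∈ B) (hu : ρ ⟨u, huO⟩ = ϖ)
    (hq : ∀ J : AddSubgroup κ, (∀ x, x ∈ J ↔ ∃ a ∈ A, x = ϖ * a) →
      J.relIndex A.toAddSubgroup = q) (hq1 : 1 < q)
    {rv : K → ℤ} (hrv : ∀ x (hx : x ∈ O), rv x = v (ρ ⟨x, hx⟩)) :
    Nonempty (LocalDatum O B q fun f g => rv ((f : K) ^ w g / (g : K) ^ w f)) := by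
  have htO := hO.uniformizer_mem
  have ρunit : ∀ (x : Kˣ) (hx : IsUnitOf O x), ρ ⟨x, hx.1⟩ ≠ 0 := fun x hx h0 => by
    have h1 : ρ (⟨x, hx.1⟩ * ⟨_, hx.2⟩) = 1 := by
      rw [← map_one ρ]; exact congrArg ρ (Subtype.ext (Units.mul_inv x))
    rw [map_mul, h0, zero_mul] at h1
    exact zero_ne_one h1
  have ρker : ∀ (x : K) (hx : x ∈ O), ρ ⟨x, hx⟩ = 0 → ∃ y ∈ O, x = t * y := fun x hx h0 => by
    by_cases hx0 : x = 0
    · exact ⟨0, O.zero_mem, by rw [hx0, mul_zero]⟩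
    · refine hO.exists_eq_mul hx fun hv => ?_
      exact ρunit (Units.mk0 x hx0) ((hO.isUnitOf_iff _).2 hv) h0
  have ρt : ∀ y (hy : y ∈ O), ρ ⟨t * y, O.mul_mem htO hy⟩ = 0 := fun y hy => by
    have : ρ ⟨t * y, O.mul_mem htO hy⟩ = ρ ⟨t, htO⟩ * ρ ⟨y, hy⟩ := by rw [← map_mul]; rfl
    rw [this, hρt, zero_mul]
  have ρunit' : ∀ (x : K) (hx : x ∈ O), ρ ⟨x, hx⟩ ≠ 0 → ∃ h0 : x ≠ 0, IsUnitOf O (Units.mk0 x h0) :=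
    fun x hx h => by
      have h0 : x ≠ 0 := fun h0 => h (by subst h0; exact map_zero ρ)
      refine ⟨h0, (hO.isUnitOf_iff _).2 ?_⟩
      by_contra hv
      obtain ⟨y, hy, rfl⟩ := hO.exists_eq_mul hx hv
      exact h (ρt y hy)
  obtain ⟨hu0, huU⟩ := ρunit' u huO (by rw [hu]; exact ϖ.ne_zero)
  let U : Kˣ := Units.mk0 u hu0
  -- the units of `O`, and the composition of the reduction with `v`
  let UO : Subgroup Kˣ :=
    { carrier := {x | IsUnitOf O x}
      one_mem' := (hO.isUnitOf_iff 1).2 hO.map_one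
      mul_mem' := fun {x y} hx hy => ⟨O.mul_mem hx.1 hy.1, by
        rw [mul_inv]; exact O.mul_mem hx.2 hy.2⟩
      inv_mem' := fun {x} hx => ⟨hx.2, by rw [inv_inv]; exact hx.1⟩ }
  let W : UO →* Multiplicative ℤ := MonoidHom.mk' (fun x => Multiplicative.ofAdd (rv x.1))
    fun x y => by
      rw [← ofAdd_add]
      congr 1
      rw [hrv _ x.2.1, hrv _ y.2.1, ← hA.map_mul _ _ (ρunit _ x.2) (ρunit _ y.2), ← map_mul]
      exact hrv _ (x * y).2.1
  have rv_mul : ∀ x y : Kˣ, IsUnitOf O x → IsUnitOf O y →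
      rv ((x * y : Kˣ) : K) = rv x + rv y := fun x y hx hy =>
    congrArg Multiplicative.toAdd (map_mul W ⟨x, hx⟩ ⟨y, hy⟩)
  have rv_zpow : ∀ (x : Kˣ) (n : ℤ), IsUnitOf O x → rv ((x ^ n : Kˣ) : K) = n * rv x :=
    fun x n hx => by
      have := congrArg Multiplicative.toAdd (map_zpow W ⟨x, hx⟩ n)
      rw [toAdd_zpow, smul_eq_mul] at this
      exact this
  have rvu : rv U = 1 := by
    rw [hrv (U : K) huO]
    exact (congrArg v hu).trans hA.map_uniformizer
  have rvm : ∀ m : Kˣ, (∃ y ∈ O, (m : K) = 1 + t * y) → IsUnitOf O m ∧ rv m = 0 := by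
    rintro m ⟨y, hy, hm⟩
    obtain ⟨z, hz, hmz⟩ := hO.one_add_uniformizer_mul hy
    have hmO : (m : K) ∈ O := by rw [hm]; exact O.add_mem O.one_mem (O.mul_mem htO hy)
    refine ⟨⟨hmO, ?_⟩, ?_⟩
    · rw [← hm] at hmz
      rwa [Units.val_inv_eq_inv_val, ← eq_inv_of_mul_eq_one_right hmz]
    · have e : ρ ⟨m, hmO⟩ = 1 := by
        have e1 : (⟨m, hmO⟩ : O) = 1 + ⟨t * y, O.mul_mem htO hy⟩ := Subtype.ext hm
        rw [e1, map_add, ρt y hy, map_one, add_zero]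
      rw [hrv _ hmO, e, hA.map_one]
  have rvr : ∀ r : Kˣ, IsUnitOf O r → IsUnitOf B r → rv r = 0 := fun r hr hrB => by
    have e : ρ ⟨r, hr.1⟩ * ρ ⟨_, hr.2⟩ = 1 := by
      rw [← map_mul, ← map_one ρ]; exact congrArg ρ (Subtype.ext (Units.mul_inv r))
    rw [hrv _ hr.1]
    refine (hA.isUnitOf_iff (Units.mk0 _ (ρunit r hr))).1 ⟨hρB _ hrB.1, ?_⟩
    rw [Units.val_inv_eq_inv_val, Units.val_mk0, ← eq_inv_of_mul_eq_one_right e]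
    exact hρB _ hrB.2
  have wU : ∀ x : Kˣ, IsUnitOf O x → w x = 0 := fun x hx => (hO.isUnitOf_iff x).1 hx
  refine ⟨⟨t, U, htO, htB.1, htB.2, huO, huU.2, huB, ?_, fun x hx => hO.one_add_uniformizer_mul hx,
    ?_, ?_, hq1, ?_⟩⟩
  -- If u - 1 reduced to 0, then u would lie in 1 + tO, where the residual valuation is 0; but that
  -- of u is 1.
  · have hm : u - 1 ∈ O := O.sub_mem huO O.one_mem
    by_cases h1 : ρ ⟨u - 1, hm⟩ = 0
    · exfalso
      obtain ⟨y, hy, e⟩ := ρker _ hm h1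
      have := (rvm U ⟨y, hy, by rw [← e]; exact (add_sub_cancel 1 u).symm⟩).2
      omega
    · obtain ⟨h0, h2⟩ := ρunit' _ hm h1
      exact ⟨_, h2.2, Units.mul_inv (Units.mk0 _ h0)⟩
  · intro x
    -- The exponents i and k are the valuation of x and the residual valuation of x t^{-i}. What
    -- remains reduces to a unit of A, which r lifts; the quotient by r reduces to 1.
    obtain ⟨i, hi⟩ : ∃ i, i = w x := ⟨_, rfl⟩
    obtain ⟨x₀, hx₀⟩ : ∃ x₀, x₀ = (t ^ i)⁻¹ * x := ⟨_, rfl⟩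
    have hx₀U : IsUnitOf O x₀ := (hO.isUnitOf_iff _).2 (by
      rw [hx₀, Units.val_mul, hO.map_mul _ _ (Units.ne_zero _) (Units.ne_zero _), hO.map_inv,
        hO.map_zpow, hO.map_uniformizer, hi]; ring)
    obtain ⟨k, hk⟩ : ∃ k, k = rv x₀ := ⟨_, rfl⟩
    obtain ⟨x₁, hx₁⟩ : ∃ x₁, x₁ = U ^ (-k) * x₀ := ⟨_, rfl⟩
    have hUk : IsUnitOf O (U ^ (-k)) := UO.zpow_mem (x := U) huU _
    have hx₁U : IsUnitOf O x₁ := by rw [hx₁]; exact UO.mul_mem hUk hx₀U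
    have rvx₁ : rv x₁ = 0 := by
      rw [hx₁, rv_mul _ _ hUk hx₀U, rv_zpow _ _ huU, rvu, hk]; ring
    rw [hrv _ hx₁U.1] at rvx₁
    obtain ⟨r, hr, hrB, e⟩ := hunit (Units.mk0 _ (ρunit _ hx₁U)) ((hA.isUnitOf_iff _).2 rvx₁)
    rw [Units.val_mk0] at e
    obtain ⟨h0, hrU⟩ := ρunit' r hr (by rw [e]; exact ρunit _ hx₁U)
    rw [Units.mk0_val] at hrU
    have e3 : ρ ⟨x₁ - r, O.sub_mem hx₁U.1 hr⟩ = 0 := by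
      have : (⟨x₁ - r, O.sub_mem hx₁U.1 hr⟩ : O) = ⟨x₁, hx₁U.1⟩ - ⟨r, hr⟩ := rfl
      rw [this, map_sub, e, sub_self]
    obtain ⟨y, hy, e4⟩ := ρker _ _ e3
    refine ⟨i, k, r, r⁻¹ * x₁, hrU, hrB, ⟨(r⁻¹ : Kˣ) * y, O.mul_mem hrU.2 hy, ?_⟩, ?_⟩
    · rw [Units.val_mul]
      have h1 : ((r⁻¹ : Kˣ) : K) * r = 1 := Units.inv_mul r
      linear_combination ((r⁻¹ : Kˣ) : K) * e4 + h1
    · rw [mul_assoc, mul_inv_cancel_left, hx₁, zpow_neg, mul_assoc, mul_inv_cancel_left, hx₀,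
        mul_inv_cancel_left]
  · intro i k i' k' r m r' m' hr hrB hr' hrB' hm hm'
    -- Each argument is t^i s with s a unit of O of residual valuation k. In the quotient defining
    -- the pairing the powers of t cancel, leaving s^{i'} s'^{-i}.
    have key : ∀ (i k : ℤ) (r m : Kˣ), IsUnitOf O r → IsUnitOf B r →
        (∃ y ∈ O, (m : K) = 1 + t * y) → ∃ s, t ^ i * U ^ k * r * m = t ^ i * s ∧ IsUnitOf O s ∧
          rv s = k ∧ w ((t ^ i * U ^ k * r * m : Kˣ) : K) = i := by
      intro i k r m hr hrB hm
      obtain ⟨hmU, hm0⟩ := rvm m hm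
      have hUk : IsUnitOf O (U ^ k) := UO.zpow_mem (x := U) huU _
      have h1 : IsUnitOf O (r * m) := UO.mul_mem hr hmU
      have h2 : IsUnitOf O (U ^ k * (r * m)) := UO.mul_mem hUk h1
      have e : t ^ i * U ^ k * r * m = t ^ i * (U ^ k * (r * m)) := by simp only [mul_assoc]
      refine ⟨U ^ k * (r * m), e, h2, ?_, ?_⟩
      · rw [rv_mul _ _ hUk h1, rv_mul _ _ hr hmU, rv_zpow _ _ huU, rvu, hm0, rvr r hr hrB]; ring
      · rw [e, Units.val_mul, hO.map_mul _ _ (Units.ne_zero _) (Units.ne_zero _), wU _ h2,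
          hO.map_zpow, hO.map_uniformizer]; ring
    obtain ⟨s, hs, hsU, hs1, hs2⟩ := key i k r m hr hrB hm
    obtain ⟨s', hs', hsU', hs1', hs2'⟩ := key i' k' r' m' hr' hrB' hm'
    change rv _ = _
    rw [hs2, hs2', hs, hs']
    have e : (((t ^ i * s : Kˣ) : K) ^ i' / ((t ^ i' * s' : Kˣ) : K) ^ i)
        = ((s ^ i' * s' ^ (-i) : Kˣ) : K) := by
      rw [← Units.val_zpow_eq_zpow_val, ← Units.val_zpow_eq_zpow_val, ← Units.val_div_eq_div_val]
      congr 1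
      rw [mul_zpow, mul_zpow, ← zpow_mul, ← zpow_mul, mul_comm i', zpow_neg,
        mul_div_mul_left_eq_div, div_eq_mul_inv]
    have g1 : IsUnitOf O (s ^ i') := UO.zpow_mem (x := s) hsU _
    have g2 : IsUnitOf O (s' ^ (-i)) := UO.zpow_mem (x := s') hsU' _
    rw [e, rv_mul _ _ g1 g2, rv_zpow _ _ hsU, rv_zpow _ _ hsU', hs1, hs1']
    ring
  · intro J hJ
    -- Reduction maps O ∩ B onto A, and the ideal (t, u) is the preimage of ϖA, so the index is that
    -- of ϖA in A.
    let ι : ↥(O ⊓ B) →+* O := Subring.inclusion inf_le_left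
    let ψ : ↥(O ⊓ B) →+* A := (ρ.comp ι).codRestrict A fun x => hρB _ x.2.2
    have hψ : Function.Surjective ψ.toAddMonoidHom := fun a => by
      obtain ⟨x, hx, e⟩ := hsurj a.1 a.2
      exact ⟨⟨x.1, x.2, hx⟩, Subtype.ext e⟩
    let I : AddSubgroup κ :=
      { carrier := {x | ∃ a ∈ A, x = ϖ * a}
        zero_mem' := ⟨0, A.zero_mem, (mul_zero _).symm⟩
        add_mem' := by
          rintro _ _ ⟨a, ha, rfl⟩ ⟨b, hb, rfl⟩
          exact ⟨a + b, A.add_mem ha hb, (mul_add _ _ _).symm⟩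
        neg_mem' := by
          rintro _ ⟨a, ha, rfl⟩
          exact ⟨-a, A.neg_mem ha, (mul_neg _ _).symm⟩ }
    have hI := hq I fun x => Iff.rfl
    have e : J.addSubgroupOf (O ⊓ B).toAddSubgroup
        = (I.addSubgroupOf A.toAddSubgroup).comap ψ.toAddMonoidHom := by
      ext x
      rw [AddSubgroup.mem_addSubgroupOf, hJ]
      change _ ↔ ∃ a ∈ A, ρ (ι x) = ϖ * a
      constructor
      · rintro ⟨a, ha, b, hb, h⟩
        refine ⟨ρ ⟨b, hb.1⟩, hρB _ hb.2, ?_⟩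
        have e1 : ι x = ⟨t * a, O.mul_mem htO ha.1⟩ + ⟨u, huO⟩ * ⟨b, hb.1⟩ := Subtype.ext h
        rw [e1, map_add, ρt a ha.1, zero_add, map_mul, hu]
      · rintro ⟨a, ha, h⟩
        obtain ⟨b, hb, rfl⟩ := hsurj a ha
        have e1 : ρ ⟨x.1 - u * b.1, O.sub_mem x.2.1 (O.mul_mem huO b.2)⟩ = 0 := by
          have : (⟨x.1 - u * b.1, O.sub_mem x.2.1 (O.mul_mem huO b.2)⟩ : O)
              = ι x - ⟨u, huO⟩ * b := rfl
          rw [this, map_sub, map_mul, h, hu, sub_self]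
        obtain ⟨y, hy, e2⟩ := ρker _ _ e1
        refine ⟨y, ⟨hy, ?_⟩, b.1, ⟨b.2, hb⟩, ?_⟩
        · have : y = (t⁻¹ : Kˣ) * (x.1 - u * b.1) := by rw [e2, Units.inv_mul_cancel_left]
          rw [this]
          exact B.mul_mem htB.2 (B.sub_mem x.2.2 (B.mul_mem huB hb))
        · change x.1 = t * y + u * b.1
          rw [← e2]; ring
    rw [AddSubgroup.relIndex, e, AddSubgroup.index_comap_of_surjective _ hψ]
    exact hI

/-- Transport of structure along an isomorphism. -/
theorem LocalDatum.nonempty_comap {F : Type*} [Field F] {O B : Subring F} {q : ℕ}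
    {ν : Fˣ → Fˣ → ℤ} (D : LocalDatum O B q ν) (e : K ≃+* F) {ν' : Kˣ → Kˣ → ℤ}
    (hν : ∀ f g, ν' f g = ν (Units.map e f) (Units.map e g)) :
    Nonempty (LocalDatum (O.comap e.toRingHom) (B.comap e.toRingHom) q ν') := by
  have hs : ∀ x : Fˣ, e ((Units.map (e.symm : F →* K) x : Kˣ) : K) = x := fun x =>
    e.apply_symm_apply _
  have hs' : ∀ x : Fˣ, e (((Units.map (e.symm : F →* K) x)⁻¹ : Kˣ) : K) = (x⁻¹ : Fˣ) := fun x => by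
    rw [← map_inv]; exact e.apply_symm_apply _
  have hss : ∀ x : Fˣ, Units.map (e : K →* F) (Units.map (e.symm : F →* K) x) = x := fun x =>
    Units.ext (hs x)
  have mc : ∀ {R : Subring F} {x : K} {y : F}, e x = y → y ∈ R → x ∈ R.comap e.toRingHom :=
    fun h hy => by subst h; exact hy
  have hm : ∀ m : Kˣ, (∃ y ∈ O.comap e.toRingHom,
      (m : K) = 1 + (Units.map (e.symm : F →* K) D.t : Kˣ) * y) →
      ∃ y ∈ O, ((Units.map (e : K →* F) m : Fˣ) : F) = 1 + D.t * y := by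
    rintro m ⟨y, hy, h⟩
    refine ⟨e y, hy, ?_⟩
    change e m = _
    rw [h, map_add, map_one, map_mul, hs]
  have hmO : ∀ {R : Subring F} (x : Kˣ), (x : K) ∈ R.comap e.toRingHom ∧
      ((x⁻¹ : Kˣ) : K) ∈ R.comap e.toRingHom → IsUnitOf R (Units.map (e : K →* F) x) :=
    fun x hx => ⟨hx.1, by rw [← map_inv]; exact hx.2⟩
  refine ⟨⟨Units.map e.symm D.t, Units.map e.symm D.u, ?_, ?_, ?_, ?_, ?_, ?_, ?_, ?_, ?_, ?_,
    D.one_lt_q, ?_⟩⟩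
  · exact mc (hs D.t) D.t_mem
  · exact mc (hs D.t) D.t_mem_B
  · exact mc (hs' D.t) D.t_inv_mem_B
  · exact mc (hs D.u) D.u_mem
  · exact mc (hs' D.u) D.u_inv_mem
  · exact mc (hs D.u) D.u_mem_B
  · obtain ⟨y, hy, h⟩ := D.one_sub_u
    refine ⟨e.symm y, mc (e.apply_symm_apply y) hy, e.injective ?_⟩
    rw [map_mul, map_sub, map_one, hs, e.apply_symm_apply, h]
  · intro x hx
    obtain ⟨y, hy, h⟩ := D.one_add _ hx
    refine ⟨e.symm y, mc (e.apply_symm_apply y) hy, e.injective ?_⟩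
    rw [map_mul, map_add, map_one, map_mul, hs, e.apply_symm_apply]
    exact h
  · intro x
    obtain ⟨i, k, r, m, hr, hrB, ⟨y, hy, hm⟩, h⟩ := D.decomp (Units.map e x)
    refine ⟨i, k, Units.map e.symm r, Units.map e.symm m, ⟨mc (hs r) hr.1, mc (hs' r) hr.2⟩,
      ⟨mc (hs r) hrB.1, mc (hs' r) hrB.2⟩,
      ⟨e.symm y, mc (e.apply_symm_apply y) hy, e.injective ?_⟩, ?_⟩
    · rw [map_add, map_one, map_mul, hs, hs, e.apply_symm_apply, hm]
    · have : Function.Injective (Units.map (e : K →* F)) := Units.map_injective e.injective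
      apply this
      rw [map_mul, map_mul, map_mul, map_zpow, map_zpow, hss, hss, hss, hss]
      exact h
  · intro i k i' k' r m r' m' hr hrB hr' hrB' hm1 hm2
    rw [hν]
    change ν (Units.map (e : K →* F) _) (Units.map (e : K →* F) _) = _
    simp only [map_mul, map_zpow, hss]
    exact D.nu_eq i k i' k' _ _ _ _ (hmO r hr) (hmO r hrB) (hmO r' hr') (hmO r' hrB') (hm m hm1)
      (hm m' hm2)
  · intro J hJ
    have h1 := D.relIndex_eq (J.map (e : K →+ F)) fun x => by
      rw [AddSubgroup.mem_map]
      constructor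
      · rintro ⟨y, hy, rfl⟩
        obtain ⟨a, ha, b, hb, rfl⟩ := (hJ y).1 hy
        refine ⟨e a, ha, e b, hb, ?_⟩
        change e _ = _
        rw [map_add, map_mul, map_mul, hs, hs]
      · rintro ⟨a, ha, b, hb, rfl⟩
        refine ⟨_, (hJ _).2 ⟨e.symm a, ?_, e.symm b, ?_, rfl⟩, ?_⟩
        · change e (e.symm a) ∈ O ∧ e (e.symm a) ∈ B
          rw [e.apply_symm_apply]; exact ha
        · change e (e.symm b) ∈ O ∧ e (e.symm b) ∈ B
          rw [e.apply_symm_apply]; exact hb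
        · change e _ = _
          rw [map_add, map_mul, map_mul, hs, hs, e.apply_symm_apply, e.apply_symm_apply]
    have h2 : (J.map (e : K →+ F)).comap (e : K →+ F) = J :=
      AddSubgroup.comap_map_eq_self_of_injective e.injective J
    rw [← h2, AddSubgroup.relIndex_comap, ← h1]
    congr 1
    ext x
    rw [AddSubgroup.mem_map]
    constructor
    · rintro ⟨y, hy, rfl⟩; exact hy
    · intro hx
      refine ⟨e.symm x, ?_, e.apply_symm_apply x⟩
      change e (e.symm x) ∈ O ∧ e (e.symm x) ∈ B
      rw [e.apply_symm_apply]; exact hx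

end Criterion

end TwoDim
end

noncomputable section

namespace TwoDim

/-! ### Laurent series fields -/

section Laurent

variable {κ : Type*} [Field κ]

theorem mem_range_ofPowerSeries {x : LaurentSeries κ} :
    x ∈ (HahnSeries.ofPowerSeries ℤ κ).range ↔ ∀ n < 0, x.coeff n = 0 := by
  constructor
  · rintro ⟨p, rfl⟩ n hn
    by_cases hp : p = 0
    · simp [hp]
    · rw [HahnSeries.ofPowerSeries_apply]
      refine HahnSeries.embDomain_of_notMem_range ?_
      rintro ⟨m, hm⟩
      have : ((m : ℕ) : ℤ) = n := hm
      omega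
  · intro h
    refine ⟨PowerSeries.mk fun n => x.coeff n, ?_⟩
    ext n
    rcases lt_or_ge n 0 with hn | hn
    · rw [h n hn]
      rw [HahnSeries.ofPowerSeries_apply]
      refine HahnSeries.embDomain_of_notMem_range ?_
      rintro ⟨m, hm⟩
      have : ((m : ℕ) : ℤ) = n := hm
      omega
    · lift n to ℕ using hn
      rw [LaurentSeries.coeff_coe_powerSeries, PowerSeries.coeff_mk]

/-- The element `t` of `κ((t))`. -/
def laurentT : (LaurentSeries κ)ˣ where
  val := HahnSeries.single 1 1
  inv := HahnSeries.single (-1) 1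
  val_inv := by rw [HahnSeries.single_mul_single]; simp
  inv_val := by rw [HahnSeries.single_mul_single]; simp

theorem uniformized_laurent :
    Uniformized (HahnSeries.ofPowerSeries ℤ κ).range HahnSeries.order laurentT where
  map_mul x y hx hy := HahnSeries.order_mul hx hy
  map_uniformizer := HahnSeries.order_single one_ne_zero
  mem_iff x hx := by
    rw [mem_range_ofPowerSeries]
    constructor
    · intro h
      by_contra h0
      exact hx (HahnSeries.coeff_order_eq_zero.1 (h _ (not_le.1 h0)))
    · intro h n hn
      exact HahnSeries.coeff_eq_zero_of_lt_order (hn.trans_le h)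

variable (κ) in
/-- The reduction homomorphism `κ[[t]] → κ`. -/
def laurentResidue : (HahnSeries.ofPowerSeries ℤ κ).range →+* κ :=
  (PowerSeries.constantCoeff (R := κ)).comp
    (RingEquiv.ofLeftInverse (f := HahnSeries.ofPowerSeries ℤ κ)
      (Function.leftInverse_invFun HahnSeries.ofPowerSeries_injective)).symm.toRingHom

theorem laurentResidue_apply (x : (HahnSeries.ofPowerSeries ℤ κ).range) :
    laurentResidue κ x = x.1.coeff 0 := by
  obtain ⟨p, rfl⟩ := (RingEquiv.ofLeftInverse (f := HahnSeries.ofPowerSeries ℤ κ)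
    (Function.leftInverse_invFun HahnSeries.ofPowerSeries_injective)).surjective x
  rw [laurentResidue, RingHom.comp_apply]
  have : (RingEquiv.ofLeftInverse (f := HahnSeries.ofPowerSeries ℤ κ)
    (Function.leftInverse_invFun HahnSeries.ofPowerSeries_injective)).symm.toRingHom
      ((RingEquiv.ofLeftInverse (f := HahnSeries.ofPowerSeries ℤ κ)
    (Function.leftInverse_invFun HahnSeries.ofPowerSeries_injective)) p) = p :=
    RingEquiv.symm_apply_apply _ _
  rw [this]
  exact (PowerSeries.coeff_zero_eq_constantCoeff_apply p).symm.trans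
    (LaurentSeries.coeff_coe_powerSeries p 0).symm

theorem C_mem_range (a : κ) : HahnSeries.C a ∈ (HahnSeries.ofPowerSeries ℤ κ).range :=
  ⟨PowerSeries.C a, HahnSeries.ofPowerSeries_C a⟩

theorem laurentResidue_C (a : κ) : laurentResidue κ ⟨HahnSeries.C a, C_mem_range a⟩ = a := by
  rw [laurentResidue_apply]; exact HahnSeries.coeff_single_same 0 a

theorem single_mem_coeffSubring {A : Subring κ} {a : κ} (ha : a ∈ A) (i : ℤ) :
    (HahnSeries.single i a : LaurentSeries κ) ∈ coeffSubring A := fun n => by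
  rw [HahnSeries.coeff_single]
  split_ifs
  exacts [ha, A.zero_mem]

/-- `κ((t))` is a two-dimensional local field. -/
theorem exists_localDatum_laurent {A : Subring κ} {v : κ → ℤ} {ϖ : κˣ} (hA : Uniformized A v ϖ)
    {q : ℕ} (hq : ∀ J : AddSubgroup κ, (∀ x, x ∈ J ↔ ∃ a ∈ A, x = ϖ * a) →
      J.relIndex A.toAddSubgroup = q) (hq1 : 1 < q) :
    Nonempty (LocalDatum (HahnSeries.ofPowerSeries ℤ κ).range (coeffSubring A) q
      fun f g => v (((f : LaurentSeries κ) ^ (g : LaurentSeries κ).order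
        / (g : LaurentSeries κ) ^ (f : LaurentSeries κ).order).coeff 0)) := by
  -- The residue field embeds in κ[[t]] as the constants; these serve as all the required lifts.
  refine exists_localDatum (K := LaurentSeries κ) uniformized_laurent
    ⟨single_mem_coeffSubring A.one_mem 1, single_mem_coeffSubring A.one_mem (-1)⟩ hA
    (laurentResidue κ) ?_ ?_ ?_ ?_ (C_mem_range (ϖ : κ))
    (single_mem_coeffSubring hA.uniformizer_mem 0) (laurentResidue_C _) hq hq1
    (rv := fun x => v (x.coeff 0)) (fun x hx => by rw [laurentResidue_apply])
  · rw [laurentResidue_apply]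
    exact HahnSeries.coeff_single_of_ne (by decide)
  · intro x hx
    rw [laurentResidue_apply]
    exact hx 0
  · intro a ha
    exact ⟨⟨_, C_mem_range a⟩, single_mem_coeffSubring ha 0, laurentResidue_C a⟩
  · intro a ha
    refine ⟨Units.map ((HahnSeries.C : κ →+* LaurentSeries κ) : κ →* LaurentSeries κ) a,
      C_mem_range (a : κ),
      ⟨single_mem_coeffSubring ha.1 0, ?_⟩, laurentResidue_C _⟩
    rw [← map_inv]
    exact single_mem_coeffSubring ha.2 0

theorem relIndex_laurent (J : AddSubgroup (LaurentSeries κ))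
    (hJ : ∀ x, x ∈ J ↔ ∃ a ∈ (HahnSeries.ofPowerSeries ℤ κ).range, 
      x = ((laurentT : (LaurentSeries κ)ˣ) : LaurentSeries κ) * a) :
    J.relIndex (HahnSeries.ofPowerSeries ℤ κ).range.toAddSubgroup = Nat.card κ := by
  refine relIndex_eq_card (laurentResidue κ)
    (fun a => ⟨⟨_, C_mem_range a⟩, laurentResidue_C a⟩) J fun x => ?_
  rw [hJ, laurentResidue_apply]
  constructor
  · rintro ⟨y, hy, h⟩
    rw [h]
    change (HahnSeries.single 1 1 * y).coeff 0 = 0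
    rw [HahnSeries.coeff_single_mul, one_mul]
    exact mem_range_ofPowerSeries.1 hy _ (by decide)
  · intro h
    by_cases h0 : x.1 = 0
    · exact ⟨0, Subring.zero_mem _, by rw [h0, mul_zero]⟩
    · refine uniformized_laurent.exists_eq_mul x.2 fun h1 => h0 ?_
      rw [← HahnSeries.coeff_order_eq_zero, h1, h]

/-- `F((u))((t))` for a finite field `F`. -/
theorem exists_localDatum_equalChar (F : Type*) [Field F] [Finite F] :
    Nonempty (LocalDatum (HahnSeries.ofPowerSeries ℤ (LaurentSeries F)).range
      (coeffSubring (HahnSeries.ofPowerSeries ℤ F).range) (Nat.card F)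
      fun f g => (((f : LaurentSeries (LaurentSeries F)) ^
        (g : LaurentSeries (LaurentSeries F)).order /
          (g : LaurentSeries (LaurentSeries F)) ^
            (f : LaurentSeries (LaurentSeries F)).order).coeff 0).order) :=
  exists_localDatum_laurent (κ := LaurentSeries F) (v := HahnSeries.order)
    uniformized_laurent relIndex_laurent Finite.one_lt_card

end Laurent

/-! ### Local fields -/

section Local

open ValuativeRel
open scoped Valued WithZero

variable (L : Type*) [Field L] [ValuativeRel L] [TopologicalSpace L] [IsNonarchimedeanLocalField L]

theorem exists_uniformized : ∃ ϖ : Lˣ, Uniformized 𝒪[L] (localVal L) ϖ := by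
  -- The normalized valuation is minus the logarithm, so a uniformizer has multiplicative value
  -- exp(-1).
  obtain ⟨g, hg⟩ := (IsNonarchimedeanLocalField.valueGroupWithZeroIsoInt L).surjective 
    (WithZero.exp (-1 : ℤ))
  change IsNonarchimedeanLocalField.valueGroupWithZeroIsoInt L g = _ at hg
  obtain ⟨x, hx⟩ := ValuativeRel.valuation_surjective g
  have hx0 : x ≠ 0 := fun h => by
    rw [h, map_zero] at hx
    rw [← hx, map_zero] at hg
    exact WithZero.zero_ne_coe hg
  have h0 : ∀ x : L, x ≠ 0 →
      IsNonarchimedeanLocalField.valueGroupWithZeroIsoInt L (valuation L x) ≠ 0 := fun x hx => by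
    simpa using hx
  refine ⟨Units.mk0 x hx0, fun x y hx hy => ?_, ?_, fun x hx => ?_⟩
  · rw [localVal, map_mul, map_mul, WithZero.log_mul (h0 x hx) (h0 y hy)]
    simp only [localVal]; ring
  · rw [localVal, Units.val_mk0, hx, hg, WithZero.log_exp, neg_neg]
  · rw [localVal, neg_nonneg, ← WithZero.log_one, WithZero.log_le_log (h0 x hx) one_ne_zero,
      ← map_one (IsNonarchimedeanLocalField.valueGroupWithZeroIsoInt L)]
    exact (map_le_map_iff (IsNonarchimedeanLocalField.valueGroupWithZeroIsoInt L)
      (a := valuation L x) (b := 1)).symm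

theorem one_lt_card_residue : 1 < Nat.card 𝓀[L] := Finite.one_lt_card

theorem relIndex_uniformizer {ϖ : Lˣ} (h : Uniformized 𝒪[L] (localVal L) ϖ)
    (J : AddSubgroup L) (hJ : ∀ x, x ∈ J ↔ ∃ a ∈ 𝒪[L], x = ϖ * a) :
    J.relIndex 𝒪[L].toAddSubgroup = Nat.card 𝓀[L] := by
  refine relIndex_eq_card (A := 𝒪[L]) (IsLocalRing.residue 𝒪[L])
    IsLocalRing.residue_surjective J fun x => ?_
  rw [hJ, IsLocalRing.residue_eq_zero_iff, IsLocalRing.mem_maximalIdeal, mem_nonunits_iff]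
  constructor
  · rintro ⟨a, ha, e⟩ hu
    obtain ⟨b, hb⟩ := hu.exists_right_inv
    have hb' : x.1 * b.1 = 1 := congrArg Subtype.val hb
    rw [e, mul_assoc] at hb'
    exact h.uniformizer_mul_ne_one (𝒪[L].mul_mem ha b.2) hb'
  · intro hu
    by_cases h0 : x.1 = 0
    · exact ⟨0, Subring.zero_mem _, by rw [h0, mul_zero]⟩
    · refine h.exists_eq_mul x.2 fun h1 => hu ?_
      have := (h.isUnitOf_iff (Units.mk0 x.1 h0)).2 h1
      exact IsUnit.of_mul_eq_one (⟨_, this.2⟩ : 𝒪[L]) (Subtype.ext (Units.mul_inv (Units.mk0 x.1 h0)))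

/-- `L((t))` for a local field `L`. -/
theorem exists_localDatum_local :
    Nonempty (LocalDatum (HahnSeries.ofPowerSeries ℤ L).range (coeffSubring 𝒪[L])
      (Nat.card 𝓀[L]) fun f g => localVal L
        (((f : LaurentSeries L) ^ (g : LaurentSeries L).order
        / (g : LaurentSeries L) ^ (f : LaurentSeries L).order).coeff 0)) := by
  obtain ⟨ϖ, h⟩ := exists_uniformized L
  exact exists_localDatum_laurent h (relIndex_uniformizer L h) (one_lt_card_residue L)

end Local

end TwoDim
end

noncomputable section

namespace TwoDim

/-! ### The field `L{{u}}` -/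

section CurlyDatum

open IsDedekindDomain HeightOneSpectrum IsLocalRing PowerSeries

variable {A : Type*} [CommRing A] [IsDomain A] [IsDiscreteValuationRing A]

variable (A) in
/-- The embedding of `A[[u]]` in the ring of integers of `L{{u}}`. -/
def curlyInt : A⟦X⟧ →+* curlyIntegers A :=
  (algebraMap (CurlyLoc A) ((curlyPlace A).adicCompletionIntegers (FractionRing A⟦X⟧))).comp
    (algebraMap A⟦X⟧ (CurlyLoc A))

theorem curlyResidue_curlyInt (f : A⟦X⟧) : curlyResidue A (curlyInt A f)
    = HahnSeries.ofPowerSeries ℤ (ResidueField A) (PowerSeries.map (residue A) f) := by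
  refine (adicResidue_algebraMap (F := FractionRing A⟦X⟧) (curlyPlace A) (curlyLocResidue A)
    (curlyPlace_le_ker A) _).trans ?_
  rw [curlyLocResidue, IsLocalization.lift_eq]
  rfl

theorem curlyOfPowerSeries_injective : Function.Injective (curlyOfPowerSeries A) :=
  ((algebraMap (FractionRing A⟦X⟧)
    ((curlyPlace A).adicCompletion (FractionRing A⟦X⟧))).injective).comp
      (IsFractionRing.injective A⟦X⟧ (FractionRing A⟦X⟧))

/-- The uniformizer of `L{{u}}` defined by a uniformizer of `A`. -/
def curlyT {ϖ : A} (hϖ : Irreducible ϖ) : (CurlyField A)ˣ :=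
  Units.mk0 (curlyOfPowerSeries A (PowerSeries.C ϖ)) (by
    rw [Ne, map_eq_zero_iff _ curlyOfPowerSeries_injective,
      map_eq_zero_iff _ PowerSeries.C_injective]
    exact hϖ.ne_zero)

theorem curlyVal_curlyT {ϖ : A} (hϖ : Irreducible ϖ) : curlyVal A (curlyT hϖ) = 1 := by
  have hspan : (curlyPlace A).asIdeal
      = Ideal.span {algebraMap A⟦X⟧ (CurlyLoc A) (PowerSeries.C ϖ)} := by
    change maximalIdeal (CurlyLoc A) = _
    rw [curlyLoc_maximalIdeal, curlyPrime, hϖ.maximalIdeal_eq, Ideal.map_span,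
      Set.image_singleton, Ideal.map_span, Set.image_singleton]
  have hne : algebraMap A⟦X⟧ (CurlyLoc A) (PowerSeries.C ϖ) ≠ 0 := by
    rw [Ne, map_eq_zero_iff _ (IsLocalization.injective _ (curlyPrime A).primeCompl_le_nonZeroDivisors),
      map_eq_zero_iff _ PowerSeries.C_injective]
    exact hϖ.ne_zero
  have h1 := (curlyPlace A).intValuation_singleton hne hspan
  have h2 : Valued.v (R := (curlyPlace A).adicCompletion (FractionRing A⟦X⟧))
      (curlyT hϖ : CurlyField A) = WithZero.exp (-1 : ℤ) := by
    refine (valuedAdicCompletion_eq_valuation' (curlyPlace A)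
      (algebraMap (CurlyLoc A) (FractionRing A⟦X⟧)
        (algebraMap A⟦X⟧ (CurlyLoc A) (PowerSeries.C ϖ)))).trans ?_
    rw [valuation_of_algebraMap, h1]
  rw [curlyVal, h2, WithZero.log_exp, neg_neg]

theorem uniformized_curly {ϖ : A} (hϖ : Irreducible ϖ) :
    Uniformized (curlyIntegers A).toSubring (curlyVal A) (curlyT hϖ) where
  map_mul x y hx hy := by
    have h0 : ∀ x : CurlyField A, x ≠ 0 →
        Valued.v (R := (curlyPlace A).adicCompletion (FractionRing A⟦X⟧)) x ≠ 0 :=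
      fun x hx => (Valuation.ne_zero_iff _).2 hx
    have e : Valued.v (R := (curlyPlace A).adicCompletion (FractionRing A⟦X⟧)) (x * y)
      = Valued.v (R := (curlyPlace A).adicCompletion (FractionRing A⟦X⟧)) x *
        Valued.v (R := (curlyPlace A).adicCompletion (FractionRing A⟦X⟧)) y := Valuation.map_mul _ _ _
    rw [curlyVal, e, WithZero.log_mul (h0 x hx) (h0 y hy)]
    simp only [curlyVal]; ring
  map_uniformizer := curlyVal_curlyT hϖ
  mem_iff x hx := by
    have h0 : Valued.v (R := (curlyPlace A).adicCompletion (FractionRing A⟦X⟧)) x ≠ 0 :=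
      (Valuation.ne_zero_iff _).2 hx
    rw [curlyVal, neg_nonneg, ← WithZero.log_one, WithZero.log_le_log h0 one_ne_zero]
    rfl

theorem curlyOfPowerSeries_mem_B (f : A⟦X⟧) : curlyOfPowerSeries A f ∈ curlyB A :=
  ⟨1, one_ne_zero, f, by simp⟩

theorem C_dvd_of_map_residue {ϖ : A} (hϖ : Irreducible ϖ) {f : A⟦X⟧}
    (hf : PowerSeries.map (residue A) f = 0) : ∃ g, f = PowerSeries.C ϖ * g := by
  have h : f ∈ curlyPrime A := by rw [curlyPrime_eq_ker]; exact hf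
  rw [curlyPrime, hϖ.maximalIdeal_eq, Ideal.map_span, Set.image_singleton,
    Ideal.mem_span_singleton] at h
  exact h

/-- The integral elements of L · A[[u]] are those of A[[u]]. If xϖⁿ = f with n > 0, then f reduces
to 0, so it is divisible by ϖ, and the factors ϖ can be removed one by one. -/
theorem exists_eq_curlyInt {ϖ : A} (hϖ : Irreducible ϖ) (x : curlyIntegers A)
    (hx : (x : CurlyField A) ∈ curlyB A) : ∃ f, x = curlyInt A f := by
  obtain ⟨c, hc, f, hf⟩ := hx
  obtain ⟨n, ε, rfl⟩ := IsDiscreteValuationRing.eq_unit_mul_pow_irreducible hc hϖ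
  have hf' : x * curlyInt A (PowerSeries.C (ε * ϖ ^ n)) = curlyInt A f := Subtype.ext hf
  have key : ∀ (n : ℕ) (f : A⟦X⟧), x * curlyInt A (PowerSeries.C ϖ) ^ n = curlyInt A f →
      ∃ f, x = curlyInt A f := by
    intro n
    induction n with
    | zero => exact fun f h => ⟨f, by rw [← h, pow_zero, mul_one]⟩
    | succ n ih =>
      intro f h
      have h1 : PowerSeries.map (residue A) f = 0 := by
        apply HahnSeries.ofPowerSeries_injective (Γ := ℤ)
        rw [← curlyResidue_curlyInt, ← h, map_mul, map_pow, curlyResidue_curlyInt,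
          PowerSeries.map_C, (residue_eq_zero_iff ϖ).2 (by
            rw [hϖ.maximalIdeal_eq]; exact Ideal.mem_span_singleton_self ϖ)]
        simp
      obtain ⟨g, rfl⟩ := C_dvd_of_map_residue hϖ h1
      refine ih g ?_
      have h0 : curlyInt A (PowerSeries.C ϖ) ≠ 0 := fun h0 =>
        (curlyT hϖ).ne_zero (congrArg Subtype.val h0)
      apply mul_right_cancel₀ h0
      rw [mul_assoc, ← pow_succ, h, map_mul, mul_comm]
  refine key n (PowerSeries.C (ε⁻¹ : Aˣ).val * f) ?_
  rw [map_mul, ← hf', map_mul, map_mul, map_pow, map_pow]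
  have e : curlyInt A (PowerSeries.C (ε⁻¹ : Aˣ).val) * curlyInt A (PowerSeries.C (ε : A)) = 1 := by
    rw [← map_mul, ← map_mul, Units.inv_mul, map_one, map_one]
  linear_combination (-x * curlyInt A (PowerSeries.C ϖ) ^ n) * e

theorem curlyInt_unit {f : A⟦X⟧} (hf : residue A (PowerSeries.constantCoeff f) ≠ 0) : IsUnit f := by
  rw [PowerSeries.isUnit_iff_constantCoeff]
  exact (residue_ne_zero_iff_isUnit _).1 hf

variable (A) in
/-- `L{{u}}` is a two-dimensional local field. -/
theorem exists_localDatum_curly [Finite (ResidueField A)] :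
    Nonempty (LocalDatum (curlyIntegers A).toSubring (curlyB A) (Nat.card (ResidueField A))
      fun f g => curlyResidueVal A ((f : CurlyField A) ^ curlyVal A g
        / (g : CurlyField A) ^ curlyVal A f)) := by
  obtain ⟨ϖ, hϖ⟩ := IsDiscreteValuationRing.exists_irreducible A
  have hϖ0 : residue A ϖ = 0 := (residue_eq_zero_iff ϖ).2 (by
    rw [hϖ.maximalIdeal_eq]; exact Ideal.mem_span_singleton_self ϖ)
  -- The parameters are t = ϖ and u = X, and the ring of the residue field k((u)) is k[[u]].
  refine exists_localDatum (uniformized_curly hϖ) ⟨curlyOfPowerSeries_mem_B _, ?_⟩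
    uniformized_laurent (curlyResidue A) ?_ ?_ ?_ ?_ (curlyInt A PowerSeries.X).2
    (curlyOfPowerSeries_mem_B _) ?_ relIndex_laurent Finite.one_lt_card (fun x hx => ?_)
  · refine ⟨ϖ, hϖ.ne_zero, 1, ?_⟩
    rw [map_one]
    exact Units.inv_mul (curlyT hϖ)
  · refine (curlyResidue_curlyInt (PowerSeries.C ϖ)).trans ?_
    rw [PowerSeries.map_C, hϖ0, map_zero, map_zero]
  · intro x hx
    obtain ⟨f, rfl⟩ := exists_eq_curlyInt hϖ x hx
    rw [curlyResidue_curlyInt]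
    exact ⟨_, rfl⟩
  · rintro _ ⟨p, rfl⟩
    obtain ⟨f, rfl⟩ := PowerSeries.map_surjective _ residue_surjective p
    exact ⟨curlyInt A f, curlyOfPowerSeries_mem_B f, curlyResidue_curlyInt f⟩
  · rintro a ⟨⟨p, hp⟩, ⟨p', hp'⟩⟩
    have hpp : p * p' = 1 := by
      apply HahnSeries.ofPowerSeries_injective (Γ := ℤ)
      rw [map_mul, map_one]
      exact (congrArg₂ (· * ·) hp hp').trans (Units.mul_inv a)
    obtain ⟨f, rfl⟩ := PowerSeries.map_surjective _ residue_surjective p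
    -- A unit of k[[u]] has nonzero constant term, so that the constant term of any lift is a unit
    -- of the local ring A.
    have hf : IsUnit f := curlyInt_unit (by
      have h1 := congrArg PowerSeries.constantCoeff hpp
      rw [map_mul, map_one] at h1
      have h2 := left_ne_zero_of_mul_eq_one h1
      rwa [← PowerSeries.coeff_zero_eq_constantCoeff_apply, PowerSeries.coeff_map,
        PowerSeries.coeff_zero_eq_constantCoeff_apply] at h2)
    obtain ⟨φ, rfl⟩ := hf
    refine ⟨Units.map (curlyOfPowerSeries A : A⟦X⟧ →* CurlyField A) φ, (curlyInt A φ).2,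
      ⟨curlyOfPowerSeries_mem_B _, ?_⟩, ?_⟩
    · rw [← map_inv]
      exact curlyOfPowerSeries_mem_B _
    · exact (curlyResidue_curlyInt (φ : A⟦X⟧)).trans hp
  · refine (curlyResidue_curlyInt PowerSeries.X).trans ?_
    rw [PowerSeries.map_X]
    exact HahnSeries.ofPowerSeries_X
  · exact dif_pos (c := x ∈ curlyIntegers A) hx

end CurlyDatum

/-! ### The three types of two-dimensional local fields -/

namespace Model

open ValuativeRel
open scoped Valued

variable {K : Type*} [Field K]

theorem nonempty_localDatum (M : Model K) : Nonempty (LocalDatum M.integers M.B M.q M.nu) := by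
  cases M with
  | equalChar F e =>
    obtain ⟨D⟩ := exists_localDatum_equalChar F
    refine D.nonempty_comap e fun f g => ?_
    simp only [nu, residueVal, val, map_div₀, map_zpow₀]
    rfl
  | laurent L e =>
    obtain ⟨D⟩ := exists_localDatum_local L
    refine D.nonempty_comap e fun f g => ?_
    simp only [nu, residueVal, val, map_div₀, map_zpow₀]
    rfl
  | curly L e =>
    obtain ⟨D⟩ := exists_localDatum_curly 𝒪[L]
    refine D.nonempty_comap e fun f g => ?_
    simp only [nu, residueVal, val, map_div₀, map_zpow₀]
    rfl

end Model

end TwoDim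
end

/-- A central extension of `GL₂(K)` by `ℂ^*` is obtained from `\widehat{GL₂(K)}` by means of the
homomorphism `K₂(K) → ℂ^*`, `(f, g) ↦ q^{-a ν_K(f, g)}`, for some `a`, if and only if it splits over
`GL₂(O_K)`, over `GL₂(B)` and over `K^*`. -/
theorem proposition5 {K : Type*} [Field K] (M : TwoDim.Model K) {E : Type*} [Group E]
    (S : GroupExtension ℂˣ E (Matrix.GeneralLinearGroup (Fin 2) K)) (hS : TwoDim.IsCentral S) :
    (∃ (a : ℂ) (φ : TwoDim.K2 K →* ℂˣ),
        (∀ f g : Kˣ, ((φ (TwoDim.symbol f g) : ℂˣ) : ℂ) = (M.q : ℂ) ^ (-a * (M.nu f g : ℂ))) ∧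
        TwoDim.ObtainedBy (TwoDim.GL2hat.extension K) φ S) ↔
      TwoDim.SplitsOver S (TwoDim.GL2sub M.integers) ∧
      TwoDim.SplitsOver S (TwoDim.GL2sub M.B) ∧
      TwoDim.SplitsOver S (TwoDim.upperLeft K).range := by
  obtain ⟨D⟩ := M.nonempty_localDatum
  exact D.obtainedBy_iff S hS
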